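/- **Setting.** A *rank one ray geometry* on $\mathbb R^n$ is a group $G=\mathbb R^n\rtimes KA$ of affine transformations, where for some basis $(e_1,\dots,e_n)$ of $\mathbb R^n$ and some exponents $d_1,\dots,d_n\in\mathbb R$, not all zero, $A=\{\mathrm{diag}(\beta^{d_1},\dots,\beta^{d_n}) : \beta>0\}$, and where $K\subset \mathrm{GL}(\mathbb R^n)$ is a compact subgroup centralizing $A$. Let $M$ be a closed manifold with a $(G,\mathbb R^n)$-structure, let $\pi:\widetilde M\to M$ be its universal cover, $D:\widetilde M\to\mathbb R^n$ its developing map and $\rho:\pi_1(M)\to G$ its holonomy, and fix a metric on $M$ that induces its topology. $M$ is *complete* if $D$ is a diffeomorphism. A set $C\subset\widetilde M$ is *convex* if $D$ is injective on $C$ and $D(C)$ is convex. An *incomplete (invisible) geodesic ending at* $w\in\mathbb R^n$ is a continuous curve $\gamma:[0,1)\to\widetilde M$ with $D(\gamma(t))=(1-t)D(\gamma(0))+tw$ that has no continuous extension to $t=1$. A *Fried dynamics* associated to such a $\gamma$ consists of a point $y\in M$; a compact, convex neighborhood $U$ of $y$ that trivializes $\pi$ (convex meaning that its lifts are); decreasing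 $\epsilon_i\to0$ and increasing times $t_i\to1$ such that $\pi(\gamma(t_i))$ is at distance at most $\epsilon_i$ from $y$ and $\pi\circ\gamma$ leaves $U$ between $t_i$ and $t_{i+1}$; lifts $y_i\in U_i$ of $y\in U$ with $\gamma(t_i)\in U_i$; and the deck transformations $g_{ji}$ with $g_{ji}(U_i)=U_j$. Write the linear part of $\rho(g_{ji})$ as $k_{ji}\,\mathrm{diag}(\beta_{ji}^{d_1},\dots,\beta_{ji}^{d_n})$ with $k_{ji}\in K$, $\beta_{ji}>0$. The sequence is chosen (by passing to a subsequence) such that for fixed $i$ the $k_{ji}$ converge as $j\to\infty$ and each $\beta_{ji}^{d_q}$ is monotone in $j>i$, that $\lim_{i\to\infty}\lim_{j\to\infty}k_{ji}=\mathrm{id}$, and that $\omega_q=\lim_{i\to\infty}\lim_{j\to\infty}\beta_{ji}^{d_q}$ exists in $[0,\infty]$ for every $q$ (it is then $0$, $1$ or $\infty$). The contracted, neutral and expanded subspaces $E,P,F$ are spanned by the $e_q$ with $\omega_q=0$, $\omega_q=1$ and $\omega_q=\infty$ respectively. For $w\in\mathbb R^n$ put $P|_w=w+P$. An affine subspace $I\subset\mathbb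 R^n$ is *the invisible subspace avoided by $D$* if $I$ is the set of the endpoints of all incomplete geodesics, $D(\widetilde M)\cap I=\emptyset$, and $D$ is a covering map onto a connected component of $\mathbb R^n\setminus I$ (which is all of $\mathbb R^n\setminus I$ unless $I$ is a hyperplane). $M$ is *radiant* if for some point $w$ the holonomy fixes $w$ and $\{w\}$ is the invisible subspace avoided by $D$. **Proposition.** Let $M$ be a closed manifold with a rank one ray structure as above, and suppose that $M$ is not complete. 1. If $F=\{0\}$ for every Fried dynamics of $M$, then there is a nonempty invisible affine subspace $I$ avoided by the developing map. Every incomplete geodesic ends at a point of $I$ and has an associated Fried dynamics, and $I=P|_w$ for every Fried dynamics associated to an incomplete geodesic ending at $w$. 2. If $F=P=\{0\}$ for every Fried dynamics of $M$, then $M$ is radiant. 3. In particular (Fried's theorem is the case of the similarity geometry, where $d_1=\dots=d_n=1$), if $d_q>0$ for all $q$, then $M$ is radiant. -/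

import Mathlib

open Set Filter Topology

noncomputable section

/-- The model space `ℝⁿ`. -/
abbrev RSpace (n : ℕ) : Type := EuclideanSpace ℝ (Fin n)

/-- The linear map that is diagonal in the basis `e`, with diagonal entries `β ^ d q`. -/
def diagMap {n : ℕ} (e : Module.Basis (Fin n) ℝ (RSpace n)) (d : Fin n → ℝ) (β : ℝ) :
    RSpace n →ₗ[ℝ] RSpace n :=
  e.constr ℝ fun q => (β ^ d q) • e q

theorem diagMap_one {n : ℕ} (e : Module.Basis (Fin n) ℝ (RSpace n)) (d : Fin n → ℝ) :
    diagMap e d 1 = LinearMap.id := by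
  apply e.ext
  intro q
  simp [diagMap]

theorem diagMap_mul {n : ℕ} (e : Module.Basis (Fin n) ℝ (RSpace n)) (d : Fin n → ℝ)
    {a b : ℝ} (ha : 0 < a) (hb : 0 < b) (x : RSpace n) :
    diagMap e d a (diagMap e d b x) = diagMap e d (a * b) x := by
  have h : (diagMap e d a).comp (diagMap e d b) = diagMap e d (a * b) := by
    apply e.ext
    intro q
    simp only [diagMap, LinearMap.comp_apply, Module.Basis.constr_basis, map_smul, smul_smul]
    rw [Real.mul_rpow ha.le hb.le, mul_comm]
  exact LinearMap.congr_fun h x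

/-- A ray geometry of rank one on `ℝⁿ`: a basis `e` and exponents `d`, not all zero, so that
`β ↦ diag (β ^ d q)` is an isomorphism of the positive reals onto the group `A`, and a compact
group `K` of linear automorphisms that centralizes `A`. -/
structure RankOneRayGeometry (n : ℕ) where
  e : Module.Basis (Fin n) ℝ (RSpace n)
  d : Fin n → ℝ
  d_ne_zero : ∃ q, d q ≠ 0
  K : Subgroup (RSpace n →L[ℝ] RSpace n)ˣ
  K_compact : IsCompact (K : Set (RSpace n →L[ℝ] RSpace n)ˣ)
  K_centralizes : ∀ k ∈ K, ∀ β : ℝ, 0 < β → ∀ x : RSpace n,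
    (k : RSpace n →L[ℝ] RSpace n) (diagMap e d β x) =
      diagMap e d β ((k : RSpace n →L[ℝ] RSpace n) x)

namespace RankOneRayGeometry

variable {n : ℕ} (𝒢 : RankOneRayGeometry n)

/-- The element of `A` with parameter `β`. -/
def a (β : ℝ) : RSpace n →ₗ[ℝ] RSpace n := diagMap 𝒢.e 𝒢.d β

/-- The group `G = ℝⁿ ⋊ K A` of affine transformations with linear part in `K A`. -/
def G : Subgroup (RSpace n ≃ᵃ[ℝ] RSpace n) where
  carrier := {T | ∃ k ∈ 𝒢.K, ∃ β : ℝ, 0 < β ∧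
    ∀ x, T.linear x = (k : RSpace n →L[ℝ] RSpace n) (𝒢.a β x)}
  one_mem' := by
    refine ⟨1, 𝒢.K.one_mem, 1, one_pos, fun x => ?_⟩
    simp [a, diagMap_one, AffineEquiv.one_def]
  mul_mem' := by
    rintro S T ⟨k, hk, β, hβ, hS⟩ ⟨l, hl, β', hβ', hT⟩
    refine ⟨k * l, 𝒢.K.mul_mem hk hl, β * β', mul_pos hβ hβ', fun x => ?_⟩
    have h1 : (S * T).linear x = S.linear (T.linear x) := rfl
    rw [h1, hT, hS, a, ← 𝒢.K_centralizes l hl β hβ, a, diagMap_mul _ _ hβ hβ', a]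
    rfl
  inv_mem' := by
    rintro T ⟨k, hk, β, hβ, hT⟩
    refine ⟨k⁻¹, 𝒢.K.inv_mem hk, β⁻¹, inv_pos.2 hβ, fun x => ?_⟩
    have h1 : (T⁻¹).linear x = T.linear.symm x := rfl
    rw [h1, LinearEquiv.symm_apply_eq, hT, a, a,
      𝒢.K_centralizes _ (𝒢.K.inv_mem hk) _ (inv_pos.2 hβ),
      diagMap_mul _ _ hβ (inv_pos.2 hβ), mul_inv_cancel₀ hβ.ne', diagMap_one]
    change x = ((k * k⁻¹ : (RSpace n →L[ℝ] RSpace n)ˣ) : RSpace n →L[ℝ] RSpace n) x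
    simp

end RankOneRayGeometry

/-- The group of deck transformations of `p`. -/
def deckGroup {M N : Type*} [TopologicalSpace N] (p : N → M) : Subgroup (N ≃ₜ N) where
  carrier := {g | ∀ x, p (g x) = p x}
  one_mem' := fun _ => rfl
  mul_mem' := fun {g h} hg hh x => (hg (h x)).trans (hh x)
  inv_mem' := fun {g} hg x => by
    have h := hg (g⁻¹ x)
    rw [← h]
    exact congrArg p (g.apply_symm_apply x)

/-- A set is convex for `D` if `D` is injective on it and its image is convex. -/
def DevConvex {n : ℕ} {N : Type*} (D : N → RSpace n) (C : Set N) : Prop :=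
  InjOn D C ∧ Convex ℝ (D '' C)

/-- `γ`, considered on `[0, 1)`, is a geodesic that is incomplete (invisible) at `t = 1`:
it develops onto the segment from `D (γ 0)` to `w`, affinely parametrized, and has no continuous
completion at `t = 1`. The point `w` is the endpoint `D(γ)(1)`. -/
structure IsIncompleteGeodesic {n : ℕ} {N : Type*} [TopologicalSpace N] (D : N → RSpace n)
    (γ : ℝ → N) (w : RSpace n) : Prop where
  continuousOn : ContinuousOn γ (Ico 0 1)
  develops : ∀ t ∈ Ico (0 : ℝ) 1, D (γ t) = AffineMap.lineMap (D (γ 0)) w t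
  no_completion : ¬ ∃ z, Tendsto γ (𝓝[<] 1) (𝓝 z)

/-- A `(G, ℝⁿ)`-structure on `M`, with universal cover `p : N → M` (`N` is to be simply
connected). The group `π₁(M)` acts on `N` as the deck group, `D` is the developing map and `ρ` the
holonomy morphism. The smooth structures of `N` and `M` are those for which `D` and `p` are local
diffeomorphisms. -/
structure RayStructure {n : ℕ} (𝒢 : RankOneRayGeometry n) (M N : Type*)
    [TopologicalSpace M] [TopologicalSpace N] where
  p : N → M
  p_covering : IsCoveringMap p
  p_surjective : Function.Surjective p
  D : N → RSpace n
  D_local : IsLocalHomeomorph D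
  ρ : deckGroup p →* 𝒢.G
  equivariant : ∀ (g : deckGroup p) (x : N),
    D ((g : N ≃ₜ N) x) = (ρ g : RSpace n ≃ᵃ[ℝ] RSpace n) (D x)

namespace RayStructure

/-- `M` is complete if the developing map is a diffeomorphism; as it is a local diffeomorphism,
this means a homeomorphism. -/
def IsComplete {n : ℕ} {𝒢 : RankOneRayGeometry n} {M N : Type*}
    [TopologicalSpace M] [TopologicalSpace N] (X : RayStructure 𝒢 M N) : Prop :=
  IsHomeomorph X.D

/-- A Fried dynamics, along a subsequence for which the linear parts behave well. -/
structure FriedDynamics {n : ℕ} {𝒢 : RankOneRayGeometry n} {M N : Type*}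
    [MetricSpace M] [TopologicalSpace N] (X : RayStructure 𝒢 M N) where
  /-- the incomplete geodesic and its endpoint -/
  γ : ℝ → N
  w : RSpace n
  incomplete : IsIncompleteGeodesic X.D γ w
  /-- the recurrent point and its neighborhood -/
  y : M
  U : Set M
  U_nhds : U ∈ 𝓝 y
  U_compact : IsCompact U
  /-- the distances and the times of return; the projected geodesic leaves `U` in between -/
  ε : ℕ → ℝ
  ε_antitone : Antitone ε
  ε_tendsto : Tendsto ε atTop (𝓝 0)
  t : ℕ → ℝ
  t_mem : ∀ i, t i ∈ Ico (0 : ℝ) 1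
  t_strictMono : StrictMono t
  t_tendsto : Tendsto t atTop (𝓝 1)
  close : ∀ i, dist (X.p (γ (t i))) y ≤ ε i
  exits : ∀ i, ∃ s ∈ Ioo (t i) (t (i + 1)), X.p (γ s) ∉ U
  /-- the lifts `Ui i` of `U` and `yi i` of `y`. A compact set that `p` maps bijectively to `U` is
  mapped homeomorphically, and its deck translates are the sheets over `U`: `U` trivializes the
  universal cover, and it is convex as its lifts are. -/
  Ui : ℕ → Set N
  Ui_compact : ∀ i, IsCompact (Ui i)
  Ui_bijOn : ∀ i, BijOn X.p (Ui i) U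
  Ui_convex : ∀ i, DevConvex X.D (Ui i)
  yi : ℕ → N
  yi_mem : ∀ i, yi i ∈ Ui i
  yi_lift : ∀ i, X.p (yi i) = y
  γ_mem : ∀ i, γ (t i) ∈ Ui i
  /-- the transformations `g j i` with `g j i (Ui i) = Ui j` -/
  g : ℕ → ℕ → deckGroup X.p
  g_image : ∀ j i, (g j i : N ≃ₜ N) '' Ui i = Ui j
  /-- the factors in `K` and in `A` of the linear part of `T j i = ρ (g j i)` -/
  k : ℕ → ℕ → (RSpace n →L[ℝ] RSpace n)ˣ
  k_mem : ∀ j i, k j i ∈ 𝒢.K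
  β : ℕ → ℕ → ℝ
  β_pos : ∀ j i, 0 < β j i
  linear_eq : ∀ j i x, (X.ρ (g j i) : RSpace n ≃ᵃ[ℝ] RSpace n).linear x =
    (k j i : RSpace n →L[ℝ] RSpace n) (𝒢.a (β j i) x)
  /-- for fixed `i` the `K`-factors converge, and their limits tend to the identity -/
  kLim : ℕ → (RSpace n →L[ℝ] RSpace n)ˣ
  k_tendsto : ∀ i, Tendsto (fun j => k j i) atTop (𝓝 (kLim i))
  kLim_tendsto : Tendsto kLim atTop (𝓝 1)
  /-- for fixed `i` the diagonal entries are monotone in `j > i` -/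
  β_monotone : ∀ i q, MonotoneOn (fun j => β j i ^ 𝒢.d q) (Ioi i) ∨
    AntitoneOn (fun j => β j i ^ 𝒢.d q) (Ioi i)
  /-- `ω q` is the limit in `[0, ∞]` of the `q`-th diagonal entries when `j ≫ i → ∞` -/
  βLim : ℕ → Fin n → ENNReal
  β_tendsto : ∀ i q, Tendsto (fun j => ENNReal.ofReal (β j i ^ 𝒢.d q)) atTop (𝓝 (βLim i q))
  ω : Fin n → ENNReal
  βLim_tendsto : ∀ q, Tendsto (fun i => βLim i q) atTop (𝓝 (ω q))

namespace FriedDynamics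

variable {n : ℕ} {𝒢 : RankOneRayGeometry n} {M N : Type*}
  [MetricSpace M] [TopologicalSpace N] {X : RayStructure 𝒢 M N} (𝓕 : X.FriedDynamics)

/-- The contracted subspace. -/
def E : Submodule ℝ (RSpace n) := Submodule.span ℝ (𝒢.e '' {q | 𝓕.ω q = 0})

/-- The neutral subspace. -/
def P : Submodule ℝ (RSpace n) := Submodule.span ℝ (𝒢.e '' {q | 𝓕.ω q = 1})

/-- The expanded subspace. -/
def F : Submodule ℝ (RSpace n) := Submodule.span ℝ (𝒢.e '' {q | 𝓕.ω q = ⊤})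

end FriedDynamics

/-- `I` is the invisible subspace avoided by the developing map: its points are the endpoints of
the incomplete geodesics, and the developing map is a covering of (a connected component of) its
complement. The complement is connected unless `I` is a hyperplane, where it has two components,
and the connected space `N` covers one of them. -/
structure IsInvisibleSubspace {n : ℕ} {𝒢 : RankOneRayGeometry n} {M N : Type*}
    [TopologicalSpace M] [TopologicalSpace N] (X : RayStructure 𝒢 M N)
    (I : AffineSubspace ℝ (RSpace n)) : Prop where
  mem_iff : ∀ w, w ∈ I ↔ ∃ γ, IsIncompleteGeodesic X.D γ w
  avoids : ∀ x, X.D x ∉ I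
  range_eq : ∀ x, range X.D = connectedComponentIn (I : Set (RSpace n))ᶜ (X.D x)
  covering : IsCoveringMap (rangeFactorization X.D)

/-- `M` is radiant: the holonomy fixes a point, and the developing map is a covering of (a
connected component of) the complement of this point. -/
def IsRadiant {n : ℕ} {𝒢 : RankOneRayGeometry n} {M N : Type*}
    [TopologicalSpace M] [TopologicalSpace N] (X : RayStructure 𝒢 M N) : Prop :=
  ∃ w : RSpace n, (∀ g, (X.ρ g : RSpace n ≃ᵃ[ℝ] RSpace n) w = w) ∧
    X.IsInvisibleSubspace (AffineSubspace.mk' w ⊥)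

end RayStructure

end

set_option linter.unusedSectionVars false

noncomputable section

section

open unitInterval

/-! Call `v` visible from `z` if the segment from `D z` to `v` lifts to a path starting at `z`. If
`D` is not a homeomorphism, every `z` has invisible points, and incomplete geodesics exist. The
proof has a dynamical and a geometric half.

Dynamics. In a Fried dynamics, for each `i` some diagonal entry of the linear part of `ρ (g j i)`
tends to 0 (`exists_βLim_eq_zero`). Otherwise the inverse maps would have bounded linear part and
would carry the endpoint `w` into `D '' Ui i`; then `w` would lie in `D '' Ui j`, and the geodesic
could be completed inside `Ui j`. As all entries are powers of one number `β j i`, exponents of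
opposite signs give one contracted and one expanded direction. Hence `F = ⊥` forces all exponents to
have the same sign, and then `P` is the span `𝒢.neutral` of the directions with exponent 0
(`d_nonneg_or_nonpos`, `P_eq_neutral`). Every incomplete geodesic carries a Fried dynamics
(`exists_friedDynamics`), so the hypothesis on `F` can be used. Inverting the parameter of `A`
reduces to nonnegative exponents.

Geometry, for nonnegative exponents. The `K`-invariant seminorms `wt q` are multiplied by `s ^ d q`
under elements of `G`. Neutral directions are complete by compactness of `M`. Around each `z` there
is a largest visible box, of size `radius z`, which deck transformations rescale; an invisible point
`w` lies on its boundary (`exists_nearest`). Moving `z` towards `w` along an orbit of `A` (`shrink`)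
keeps `w` nearest and multiplies the radius by `s`. Modulo deck transformations this motion stays in
a compact set, so it recurs (`exists_recurrence`). When two close pairs `(z, w)` and `(z', w')`
recur together, the same deck transformation brings both back; it almost fixes `w` and `w'`, but
stretches their difference by at least 2 in each non-neutral direction. Therefore `w` and `w'` agree
modulo neutral directions (`exists_near_tip_eq`). It follows that the nearest point is unique, and
by connectedness its non-neutral part does not depend on `z` (`Nearest.unique`,
`exists_nearest_const`).

So an affine subspace `I` parallel to `𝒢.neutral` is invisible from everywhere, while the radius is
bounded below in terms of the distance to `I`. Away from `I`, small boxes are therefore evenly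
covered (`exists_isInvisibleSubspace`). -/

theorem IsLocalHomeomorph.eqOn_of_lift {E N A : Type*} [TopologicalSpace E] [TopologicalSpace N]
    [T2Space N] [TopologicalSpace A] {D : N → E} (hD : IsLocalHomeomorph D) {s : Set A}
    (hs : IsPreconnected s) {f g : A → N} (hf : ContinuousOn f s)
    (hg : ContinuousOn g s) (he : EqOn (D ∘ f) (D ∘ g) s) {a : A} (ha : a ∈ s) (h : f a = g a) :
    EqOn f g s :=
  (T2Space.isSeparatedMap D).eqOn_of_comp_eqOn hD.isLocallyInjective hs hf hg he ha h

/-! ### Visibility and lifts of segments. -/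

section Visibility

variable {E N : Type*} [NormedAddCommGroup E] [NormedSpace ℝ E] [TopologicalSpace N]

/-- `v` is visible from `z` if the segment from `D z` to `v` lifts through `D` to a path
starting at `z`. -/
def Visible (D : N → E) (z : N) (v : E) : Prop :=
  ∃ Γ : C(I, N), Γ 0 = z ∧ ∀ t : I, D (Γ t) = AffineMap.lineMap (D z) v (t : ℝ)

open Classical in
/-- The endpoint of the lift, starting at `z`, of the segment from `D z` to `v`. -/
def expMap (D : N → E) (z : N) (v : E) : N :=
  if h : Visible D z v then h.choose 1 else z

variable {D : N → E}

theorem apply_expMap {z : N} {v : E} (h : Visible D z v) : D (expMap D z v) = v := by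
  rw [expMap, dif_pos h, h.choose_spec.2 1]
  simp

theorem visible_self (z : N) : Visible D z (D z) :=
  ⟨ContinuousMap.const I z, rfl, fun t => by simp⟩

variable [T2Space N]

theorem expMap_eq_of_path (hD : IsLocalHomeomorph D) {z : N} {v : E} {Γ : C(I, N)} (h0 : Γ 0 = z)
    (h : ∀ t : I, D (Γ t) = AffineMap.lineMap (D z) v (t : ℝ)) : expMap D z v = Γ 1 := by
  have hv : Visible D z v := ⟨Γ, h0, h⟩
  rw [expMap, dif_pos hv]
  refine hD.eqOn_of_lift isPreconnected_univ hv.choose.continuous.continuousOn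
    Γ.continuous.continuousOn (fun t _ => ?_) (mem_univ 0) (hv.choose_spec.1.trans h0.symm)
    (mem_univ 1)
  exact (hv.choose_spec.2 t).trans (h t).symm

theorem Visible.of_continuousOn (hD : IsLocalHomeomorph D) {z : N} {v : E} {f : ℝ → N}
    (hf : ContinuousOn f (Icc 0 1)) (h0 : f 0 = z)
    (h : ∀ t ∈ Icc (0 : ℝ) 1, D (f t) = AffineMap.lineMap (D z) v t) :
    Visible D z v ∧ expMap D z v = f 1 := by
  let Γ : C(I, N) := ⟨fun t => f t, hf.comp_continuous continuous_subtype_val fun t => t.2⟩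
  have h0' : Γ 0 = z := by simpa [Γ] using h0
  have h1' : ∀ t : I, D (Γ t) = AffineMap.lineMap (D z) v (t : ℝ) := fun t => h t t.2
  exact ⟨⟨Γ, h0', h1'⟩, by rw [expMap_eq_of_path hD h0' h1']; simp [Γ]⟩

theorem Visible.exists_continuous (hD : IsLocalHomeomorph D) {z : N} {v : E} (h : Visible D z v) :
    ∃ f : ℝ → N, Continuous f ∧ f 0 = z ∧ f 1 = expMap D z v ∧
      ∀ t ∈ Icc (0 : ℝ) 1, D (f t) = AffineMap.lineMap (D z) v t := by
  obtain ⟨Γ, h0, h1⟩ := h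
  refine ⟨fun t => Γ (projIcc 0 1 zero_le_one t), by fun_prop, ?_, ?_, fun t ht => ?_⟩
  · simpa using h0
  · simpa using (expMap_eq_of_path hD h0 h1).symm
  · simp [projIcc_of_mem _ ht, h1]

theorem expMap_self (hD : IsLocalHomeomorph D) (z : N) : expMap D z (D z) = z :=
  (expMap_eq_of_path hD (Γ := ContinuousMap.const I z) rfl fun t => by simp)

theorem Visible.lineMap (hD : IsLocalHomeomorph D) {z : N} {v : E} {f : ℝ → N} {b : ℝ}
    (hb : 0 ≤ b) (hf : ContinuousOn f (Icc 0 b)) (h0 : f 0 = z)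
    (h : ∀ t ∈ Icc (0 : ℝ) b, D (f t) = AffineMap.lineMap (D z) v t) :
    Visible D z (AffineMap.lineMap (D z) v b) ∧
      expMap D z (AffineMap.lineMap (D z) v b) = f b := by
  have hm : MapsTo (fun s : ℝ => b * s) (Icc 0 1) (Icc 0 b) := fun s hs =>
    ⟨mul_nonneg hb hs.1, mul_le_of_le_one_right hb hs.2⟩
  have := Visible.of_continuousOn hD (z := z) (v := AffineMap.lineMap (D z) v b)
    (f := fun s => f (b * s)) (hf.comp (by fun_prop) hm) (by simpa using h0) fun s hs => by
      rw [h _ (hm hs)]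
      simp [AffineMap.lineMap_apply, smul_smul, mul_comm]
  simpa using this

theorem Visible.star (hD : IsLocalHomeomorph D) {z : N} {v : E} (h : Visible D z v) {t : ℝ}
    (ht : t ∈ Icc (0 : ℝ) 1) : Visible D z (AffineMap.lineMap (D z) v t) := by
  obtain ⟨f, hf, h0, -, h2⟩ := h.exists_continuous hD
  exact (Visible.lineMap hD ht.1 hf.continuousOn h0
    fun s hs => h2 s ⟨hs.1, hs.2.trans ht.2⟩).1

/-- The parameter interval is compact, so a lift through a local homeomorphism persists for nearby
segments with nearby starting points. Everything later that uses openness or continuity in both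
arguments comes from here. -/
theorem visible_nhds (hD : IsLocalHomeomorph D) {z : N} {v : E} (h : Visible D z v) :
    (∀ᶠ x : N × E in 𝓝 (z, v), Visible D x.1 x.2) ∧
      ContinuousAt (fun x : N × E => expMap D x.1 x.2) (z, v) := by
  classical
  have hDc := hD.continuous
  let F : I × (N × E) → E := fun x => AffineMap.lineMap (D x.2.1) x.2.2 (x.1 : ℝ)
  have hF : Continuous F := by
    simp only [F, AffineMap.lineMap_apply_module']
    fun_prop
  obtain ⟨Γ, h0, h1⟩ := h
  -- the segments near the given one stay in the range of `D`
  let A : Set (N × E) := {x | ∀ t ∈ (univ : Set I), F (t, x) ∈ range D}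
  have hA : A ∈ 𝓝 (z, v) := by
    refine isCompact_univ.eventually_forall_of_forall_eventually fun t _ => ?_
    have hc : ContinuousAt (fun x : (N × E) × I => F (x.2, x.1)) ((z, v), t) :=
      (hF.comp (by fun_prop : Continuous fun x : (N × E) × I => (x.2, x.1))).continuousAt
    exact hc.eventually (hD.isOpenMap.isOpen_range.mem_nhds ⟨Γ t, h1 t⟩)
  let a₀ : A := ⟨(z, v), mem_of_mem_nhds hA⟩
  let f : C(I × A, E) := ⟨fun x => F (x.1, x.2), by fun_prop⟩
  have hpre : ∀ x : I × A, ∃ y, D y = f x := fun x => x.2.2 x.1 (mem_univ _)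
  -- `exists_lift_nhds` asks only for a set-theoretic lift that is continuous at time 0 and along
  -- the given segment; elsewhere any choice of preimage will do.
  let g : I × A → N := fun x =>
    if x.1 = 0 then x.2.1.1 else if x.2 = a₀ then Γ x.1 else (hpre x).choose
  have hga : ∀ t, g (t, a₀) = Γ t := fun t => by
    by_cases ht : t = 0
    · simp [g, ht, h0, a₀]
    · simp [g, ht]
  obtain ⟨W, hW, g', hg', hg'l, hg'0, hg'a⟩ := hD.exists_lift_nhds (f := f) (g := g)
    (by
      ext1 x
      by_cases ht : x.1 = 0
      · simp [g, ht, f, F]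
      · by_cases hx : x.2 = a₀
        · simp [g, ht, hx, f, F, h1, a₀]
        · simpa [g, ht, hx] using (hpre x).choose_spec)
    (by simpa [g] using (by fun_prop : Continuous fun x : A => x.1.1)) a₀
    (by simpa only [hga] using Γ.continuous)
  have hlift : ∀ x ∈ W, Visible D x.1.1 x.1.2 ∧ expMap D x.1.1 x.1.2 = g' (1, x) := by
    intro x hx
    let Γ' : C(I, N) := ⟨fun t => g' (t, x), hg'.comp_continuous (by fun_prop)
      fun t => ⟨mem_univ _, hx⟩⟩
    have e0 : Γ' 0 = x.1.1 := by simp [Γ', hg'0, g]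
    have e1 : ∀ t : I, D (Γ' t) = AffineMap.lineMap (D x.1.1) x.1.2 (t : ℝ) := fun t =>
      congrFun hg'l (t, x)
    exact ⟨⟨Γ', e0, e1⟩, expMap_eq_of_path hD e0 e1⟩
  have hemb : map ((↑) : A → N × E) (𝓝 a₀) = 𝓝 (z, v) := map_nhds_subtype_coe_eq_nhds _ hA
  refine ⟨?_, ?_⟩
  · rw [← hemb]
    exact eventually_map.2 (mem_of_superset hW fun x hx => (hlift x hx).1)
  · rw [ContinuousAt, ← hemb, tendsto_map'_iff]
    have hc : Tendsto (fun x : A => g' (1, x)) (𝓝 a₀) (𝓝 (g' (1, a₀))) :=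
      ((hg' (1, a₀) ⟨mem_univ _, mem_of_mem_nhds hW⟩).continuousAt
        (prod_mem_nhds univ_mem hW)).comp (f := fun x : A => ((1 : I), x))
        (by fun_prop : ContinuousAt _ _)
    have e : expMap D z v = g' (1, a₀) := (hlift a₀ (mem_of_mem_nhds hW)).2
    change Tendsto _ _ (𝓝 (expMap D z v))
    rw [e]
    refine hc.congr' ?_
    filter_upwards [hW] with x hx using (hlift x hx).2.symm

theorem isOpen_visible (hD : IsLocalHomeomorph D) :
    IsOpen {x : N × E | Visible D x.1 x.2} :=
  isOpen_iff_mem_nhds.2 fun _ hx => (visible_nhds hD hx).1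

theorem isOpen_setOf_visible (hD : IsLocalHomeomorph D) (z : N) : IsOpen {v | Visible D z v} :=
  (isOpen_visible hD).preimage (by fun_prop : Continuous fun v : E => (z, v))

theorem continuousAt_expMap (hD : IsLocalHomeomorph D) {z : N} {v : E} (h : Visible D z v) :
    ContinuousAt (expMap D z) v :=
  (visible_nhds hD h).2.comp (f := fun v : E => (z, v)) (by fun_prop)

theorem continuousOn_expMap (hD : IsLocalHomeomorph D) {z : N} {C : Set E}
    (h : ∀ v ∈ C, Visible D z v) : ContinuousOn (expMap D z) C := fun v hv =>
  (continuousAt_expMap hD (h v hv)).continuousWithinAt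

/-- A segment lifts if it is swept out by segments that lift from a moving origin. -/
theorem Visible.of_visible_path (hD : IsLocalHomeomorph D) {z : N} {v : E} {f : ℝ → N}
    (hf : ContinuousOn f (Icc 0 1)) (h0 : f 0 = z)
    (hv : ∀ t ∈ Icc (0 : ℝ) 1, Visible D (f t) (AffineMap.lineMap (D z) v t)) :
    Visible D z v := by
  refine (Visible.of_continuousOn hD (f := fun t => expMap D (f t) (AffineMap.lineMap (D z) v t))
    (fun t ht => ?_) ?_ fun t ht => apply_expMap (hv t ht)).1
  · exact (visible_nhds hD (hv t ht)).2.comp_continuousWithinAt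
      (f := fun t => (f t, AffineMap.lineMap (D z) v t))
      ((hf t ht).prodMk AffineMap.lineMap_continuous.continuousWithinAt)
  · simp [h0, expMap_self hD]

section Convex

variable {C : Set E}

/-- Over `C` the map `expMap D z` is a continuous section of `D`; applied to the segment from `c` to
`v` it yields the required lift. -/
theorem Visible.of_convex (hD : IsLocalHomeomorph D) (hC : Convex ℝ C) {z : N}
    (h : ∀ v ∈ C, Visible D z v) {c v : E} (hc : c ∈ C) (hv : v ∈ C) :
    Visible D (expMap D z c) v ∧ expMap D (expMap D z c) v = expMap D z v := by
  have hm : MapsTo (fun t : ℝ => AffineMap.lineMap c v t) (Icc 0 1) C := fun t ht =>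
    hC.lineMap_mem hc hv ht
  have := Visible.of_continuousOn hD (z := expMap D z c) (v := v)
    (f := fun t => expMap D z (AffineMap.lineMap c v t))
    ((continuousOn_expMap hD h).comp AffineMap.lineMap_continuous.continuousOn hm)
    (by simp) fun t ht => by
      rw [apply_expMap (h _ (hm ht)), apply_expMap (h _ hc)]
  simpa using this

theorem expMap_eqOn (hD : IsLocalHomeomorph D) (hC : IsPreconnected C) {z : N}
    (h : ∀ v ∈ C, Visible D z v) {s : E → N} (hs : ContinuousOn s C) (hDs : ∀ v ∈ C, D (s v) = v)
    {c : E} (hc : c ∈ C) (he : expMap D z c = s c) : EqOn (expMap D z) s C :=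
  hD.eqOn_of_lift hC (continuousOn_expMap hD h) hs
    (fun v hv => by simp [apply_expMap (h v hv), hDs v hv]) hc he

/-- The intersection of convex sets is connected, so two sections that agree at one common point
agree at all of them. -/
theorem expMap_eqOn_inter (hD : IsLocalHomeomorph D) (hC : Convex ℝ C) {C' : Set E}
    (hC' : Convex ℝ C') {z z' : N} (h : ∀ v ∈ C, Visible D z v) (h' : ∀ v ∈ C', Visible D z' v)
    {c : E} (hc : c ∈ C) (hc' : c ∈ C') (he : expMap D z c = expMap D z' c) :
    EqOn (expMap D z) (expMap D z') (C ∩ C') :=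
  expMap_eqOn hD (hC.inter hC').isPreconnected (fun v hv => h v hv.1)
    ((continuousOn_expMap hD h').mono inter_subset_right)
    (fun v hv => apply_expMap (h' v hv.2)) ⟨hc, hc'⟩ he

end Convex

/-- By continuity the lifted endpoint is close to `z`, where `D` is injective, so it can only be the
second point. -/
theorem eventually_expMap_eq₂ (hD : IsLocalHomeomorph D) (z : N) :
    ∀ᶠ y : N × N in 𝓝 (z, z), Visible D y.1 (D y.2) ∧ expMap D y.1 (D y.2) = y.2 := by
  obtain ⟨U, hU, hzU, hinj⟩ := hD.isLocallyInjective z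
  have hDc := hD.continuous
  have hv := visible_nhds hD (visible_self (D := D) z)
  have hc : ContinuousAt (fun y : N × N => (y.1, D y.2)) (z, z) := by fun_prop
  have h1 := hc.eventually hv.1
  have h2 : ∀ᶠ y : N × N in 𝓝 (z, z), expMap D y.1 (D y.2) ∈ U :=
    (ContinuousAt.comp (x := (z, z)) (f := fun y : N × N => (y.1, D y.2)) hv.2 hc).eventually
      (hU.mem_nhds (by simpa [expMap_self hD] using hzU))
  filter_upwards [h1, h2, continuous_snd.continuousAt.eventually (hU.mem_nhds hzU)] with y a b c
  exact ⟨a, hinj b c (apply_expMap a)⟩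

theorem eventually_expMap_eq (hD : IsLocalHomeomorph D) (z : N) :
    ∀ᶠ z' in 𝓝 z, Visible D z (D z') ∧ expMap D z (D z') = z' :=
  (by fun_prop : ContinuousAt (fun z' : N => (z, z')) z).eventually (eventually_expMap_eq₂ hD z)

theorem Visible.map (hD : IsLocalHomeomorph D) (g : N ≃ₜ N) (T : E ≃ᵃ[ℝ] E)
    (hg : ∀ x, D (g x) = T (D x)) {z : N} {v : E} (h : Visible D z v) :
    Visible D (g z) (T v) ∧ expMap D (g z) (T v) = g (expMap D z v) := by
  obtain ⟨f, hf, h0, h1, h2⟩ := h.exists_continuous hD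
  have := Visible.of_continuousOn hD (z := g z) (v := T v) (f := fun t => g (f t))
    (by fun_prop) (by simp [h0]) fun t ht => by
      rw [hg, hg, h2 t ht]
      exact AffineMap.apply_lineMap (T : E →ᵃ[ℝ] E) _ _ _
  rwa [h1] at this

theorem visible_map_iff (hD : IsLocalHomeomorph D) (g : N ≃ₜ N) (T : E ≃ᵃ[ℝ] E)
    (hg : ∀ x, D (g x) = T (D x)) {z : N} {v : E} :
    Visible D (g z) (T v) ↔ Visible D z v := by
  refine ⟨fun h => ?_, fun h => (h.map hD g T hg).1⟩
  have := (h.map hD g.symm T.symm fun x => by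
    rw [T.eq_symm_apply, ← hg, g.apply_symm_apply]).1
  simpa using this

/-- Visibility of a point in the closure of a visible convex set does not depend on the point of
the convex set that it is seen from. -/
theorem Visible.of_convex_closure (hD : IsLocalHomeomorph D) {C : Set E} (hC : Convex ℝ C) {z : N}
    (h : ∀ v ∈ C, Visible D z v) {c c' w : E} (hc : c ∈ C) (hc' : c' ∈ C)
    (hw : ∀ t ∈ Ico (0 : ℝ) 1, AffineMap.lineMap c w t ∈ C)
    (hv : Visible D (expMap D z c') w) : Visible D (expMap D z c) w := by
  refine Visible.of_visible_path hD
    (f := fun t => expMap D z (AffineMap.lineMap c c' t))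
    ((continuousOn_expMap hD h).comp AffineMap.lineMap_continuous.continuousOn fun t ht =>
      hC.lineMap_mem hc hc' ht) (by simp) fun t ht => ?_
  rw [apply_expMap (h c hc)]
  rcases ht.2.lt_or_eq with h1 | rfl
  · exact (Visible.of_convex hD hC h (hC.lineMap_mem hc hc' ht) (hw t ⟨ht.1, h1⟩)).1
  · simpa using hv

/-- If everything is visible from a point, the developing map is a homeomorphism. -/
theorem expMap_surjective [PathConnectedSpace N] (hD : IsLocalHomeomorph D) {z : N}
    (h : ∀ v, Visible D z v) (y : N) : expMap D z (D y) = y := by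
  let γ := PathConnectedSpace.somePath z y
  have hDc := hD.continuous
  have := hD.eqOn_of_lift (s := (univ : Set I)) isPreconnected_univ
    (f := fun t => expMap D z (D (γ t))) (g := γ)
    ((continuousOn_expMap hD (C := univ) fun v _ => h v).comp (by fun_prop) (mapsTo_univ _ _))
    (by fun_prop) (fun t _ => by simp [apply_expMap (h _)]) (mem_univ 0)
    (by simp [expMap_self hD]) (mem_univ 1)
  simpa using this

theorem isHomeomorph_of_visible [PathConnectedSpace N] (hD : IsLocalHomeomorph D) {z : N}
    (h : ∀ v, Visible D z v) : IsHomeomorph D :=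
  ⟨hD.continuous, hD.isOpenMap,
    fun x y hxy => by rw [← expMap_surjective hD h x, hxy, expMap_surjective hD h y],
    fun v => ⟨expMap D z v, apply_expMap (h v)⟩⟩

end Visibility

/-! ### Incomplete geodesics as obstructions to visibility. -/

section Incomplete

variable {n : ℕ} {N : Type*} [TopologicalSpace N] {D : N → RSpace n} {γ : ℝ → N}
  {w : RSpace n}

theorem IsIncompleteGeodesic.tendsto_develop (h : IsIncompleteGeodesic D γ w) :
    Tendsto (fun t => D (γ t)) (𝓝[<] 1) (𝓝 w) := by
  have h1 : Tendsto (fun t : ℝ => AffineMap.lineMap (D (γ 0)) w t) (𝓝[<] 1) (𝓝 w) := by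
    have : ContinuousAt (fun t : ℝ => AffineMap.lineMap (D (γ 0)) w t) 1 :=
      AffineMap.lineMap_continuous.continuousAt
    have h2 := this.tendsto
    rw [AffineMap.lineMap_apply_one] at h2
    exact h2.mono_left nhdsWithin_le_nhds
  refine h1.congr' ?_
  filter_upwards [Ioo_mem_nhdsLT (zero_lt_one' ℝ)] with t ht
  exact (h.develops t ⟨ht.1.le, ht.2⟩).symm

variable [T2Space N]

/-- An incomplete geodesic does not stay in the domain of a section of the developing map that is
continuous at its endpoint. -/
theorem IsIncompleteGeodesic.not_section (hD : IsLocalHomeomorph D)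
    (h : IsIncompleteGeodesic D γ w) {t : ℝ} (ht : t ∈ Ico (0 : ℝ) 1) {s : RSpace n → N}
    {C : Set (RSpace n)} (hs : ContinuousOn s C) (hDs : ∀ v ∈ C, D (s v) = v)
    (hst : s (D (γ t)) = γ t) (hC : ∀ r ∈ Ico t 1, D (γ r) ∈ C) (hw : w ∈ C) : False := by
  have hsub : Ico t 1 ⊆ Ico (0 : ℝ) 1 := Ico_subset_Ico_left ht.1
  have hγ := h.continuousOn.mono hsub
  have heq := hD.eqOn_of_lift isPreconnected_Ico (f := fun r => s (D (γ r))) (g := γ)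
    (hs.comp (hD.continuous.comp_continuousOn hγ) hC) hγ (fun r hr => hDs _ (hC r hr))
    (left_mem_Ico.2 ht.2) hst
  refine h.no_completion ⟨s w, ?_⟩
  have h1 : ∀ᶠ r in 𝓝[<] (1 : ℝ), r ∈ Ico t 1 := by
    filter_upwards [Ioo_mem_nhdsLT ht.2] with r hr using ⟨hr.1.le, hr.2⟩
  have h2 : Tendsto (fun r => s (D (γ r))) (𝓝[<] 1) (𝓝 (s w)) :=
    (hs w hw).tendsto.comp (tendsto_nhdsWithin_iff.2
      ⟨h.tendsto_develop, h1.mono fun r hr => hC r hr⟩)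
  refine h2.congr' ?_
  filter_upwards [h1] with r hr using heq hr

/-- If `w` were visible, `expMap` from `γ t` would be a section continuous up to `w`, and `γ` would
converge to its value there. -/
theorem IsIncompleteGeodesic.not_visible (hD : IsLocalHomeomorph D)
    (h : IsIncompleteGeodesic D γ w) {t : ℝ} (ht : t ∈ Ico (0 : ℝ) 1) : ¬ Visible D (γ t) w := by
  intro hv
  have hmem : ∀ r ∈ Ico t 1, D (γ r) ∈ segment ℝ (D (γ t)) w := by
    intro r hr
    rw [segment_eq_image_lineMap, h.develops t ht, h.develops r ⟨ht.1.trans hr.1, hr.2⟩]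
    have h1t : 0 < 1 - t := by linarith [ht.2]
    refine ⟨(r - t) / (1 - t), ⟨div_nonneg (by linarith [hr.1]) h1t.le, ?_⟩, ?_⟩
    · rw [div_le_one h1t]; linarith [hr.2]
    · simp only [AffineMap.lineMap_apply_module']
      match_scalars <;> field_simp <;> ring
  have hvis : ∀ v ∈ segment ℝ (D (γ t)) w, Visible D (γ t) v := by
    intro v hv'
    rw [segment_eq_image_lineMap] at hv'
    obtain ⟨s, hs, rfl⟩ := hv'
    exact hv.star hD hs
  exact h.not_section hD ht (continuousOn_expMap hD hvis) (fun v hv' => apply_expMap (hvis v hv'))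
    (expMap_self hD _) hmem (right_mem_segment ℝ _ _)

/-- If a point is not visible, the segment to it contains the end of an incomplete geodesic. -/
theorem exists_isIncompleteGeodesic (hD : IsLocalHomeomorph D) {z : N} {v : RSpace n}
    (h : ¬ Visible D z v) : ∃ s ∈ Ioc (0 : ℝ) 1, ∃ γ : ℝ → N, γ 0 = z ∧
      IsIncompleteGeodesic D γ (AffineMap.lineMap (D z) v s) := by
  set c : ℝ → RSpace n := fun t => AffineMap.lineMap (D z) v t with hc
  have hcc : Continuous c := AffineMap.lineMap_continuous
  set B : Set ℝ := {t | t ∈ Icc (0 : ℝ) 1 ∧ ¬ Visible D z (c t)} with hB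
  have hBc : IsClosed B := isClosed_Icc.inter
    ((isOpen_setOf_visible hD z).preimage hcc).isClosed_compl
  have hBn : B.Nonempty := ⟨1, ⟨zero_le_one, le_rfl⟩, by simpa [hc] using h⟩
  have hBb : BddBelow B := ⟨0, fun t ht => ht.1.1⟩
  have hmem := hBc.csInf_mem hBn hBb
  -- The first invisible parameter. Visibility is open, hence `B` is closed and contains `s`.
  set s := sInf B with hs
  have hvis : ∀ t ∈ Ico 0 s, Visible D z (c t) := fun t ht => by
    by_contra hcon
    exact absurd (csInf_le hBb ⟨⟨ht.1, ht.2.le.trans hmem.1.2⟩, hcon⟩) (not_le.2 ht.2)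
  have hs0 : 0 < s := by
    rcases hmem.1.1.lt_or_eq with h0 | h0
    · exact h0
    · refine absurd (visible_self (D := D) z) ?_
      have := hmem.2
      rw [← h0] at this
      simpa [hc] using this
  have hm : MapsTo (fun t : ℝ => s * t) (Ico 0 1) (Ico 0 s) := fun t ht =>
    ⟨mul_nonneg hs0.le ht.1, by nlinarith [ht.2]⟩
  have hd : ∀ t ∈ Ico (0 : ℝ) 1, D (expMap D z (c (s * t))) =
      AffineMap.lineMap (D z) (c s) t := fun t ht => by
    rw [apply_expMap (hvis _ (hm ht))]
    simp [hc, AffineMap.lineMap_apply, smul_smul, mul_comm]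
  have h0 : expMap D z (c (s * 0)) = z := by simp [hc, expMap_self hD]
  have hco : ContinuousOn (fun t => expMap D z (c (s * t))) (Ico 0 1) :=
    (continuousOn_expMap hD (C := c '' Ico 0 s) (by
      rintro _ ⟨t, ht, rfl⟩
      exact hvis t ht)).comp (by fun_prop) fun t ht => mem_image_of_mem c (hm ht)
  refine ⟨s, ⟨hs0, hmem.1.2⟩, fun t => expMap D z (c (s * t)), h0, hco, fun t ht => ?_, ?_⟩
  · rw [h0]
    exact hd t ht
  -- A limit `y` would extend the lift to the closed interval and make the point at parameter `s`
  -- visible.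
  · rintro ⟨y, hy⟩
    refine hmem.2 (Visible.of_continuousOn hD
      (f := Function.update (fun t => expMap D z (c (s * t))) 1 y) ?_ ?_ ?_).1
    · rw [continuousOn_update_iff]
      exact ⟨hco.mono fun t ht => ⟨ht.1.1, ht.1.2.lt_of_ne ht.2⟩, fun _ => hy.mono_left
        (nhdsWithin_mono _ fun t ht => ht.1.2.lt_of_ne ht.2)⟩
    · rw [Function.update_of_ne (by norm_num)]
      exact h0
    · intro t ht
      rcases ht.2.lt_or_eq with h1 | rfl
      · rw [Function.update_of_ne h1.ne]
        exact hd t ⟨ht.1, h1⟩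
      · rw [Function.update_self, AffineMap.lineMap_apply_one]
        refine tendsto_nhds_unique ((hD.continuous.tendsto y).comp hy) ?_
        have h2 : Tendsto (fun t : ℝ => AffineMap.lineMap (D z) (c s) t) (𝓝[<] 1)
            (𝓝 (AffineMap.lineMap (D z) (c s) (1 : ℝ))) :=
          (AffineMap.lineMap_continuous.tendsto (1 : ℝ)).mono_left nhdsWithin_le_nhds
        rw [AffineMap.lineMap_apply_one] at h2
        refine h2.congr' ?_
        filter_upwards [Ioo_mem_nhdsLT (zero_lt_one' ℝ)] with t ht
        exact (hd t ⟨ht.1.le, ht.2⟩).symm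

end Incomplete

end

/-! ### Topology of the universal cover and its deck group. -/

namespace IsLocalHomeomorph

variable {N E : Type*} [TopologicalSpace N] [TopologicalSpace E] {D : N → E}

theorem locallyCompactSpace [LocallyCompactSpace E] (hD : IsLocalHomeomorph D) :
    LocallyCompactSpace N :=
  let _ : ChartedSpace E N := ⟨range fun x => (hD x).choose, fun x => (hD x).choose,
    fun x => (hD x).choose_spec.1, fun x => mem_range_self x⟩
  ChartedSpace.locallyCompactSpace E N

theorem locallyPathConnectedSpace [LocallyPathConnectedSpace E] (hD : IsLocalHomeomorph D) :
    LocallyPathConnectedSpace N :=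
  let _ : ChartedSpace E N := ⟨range fun x => (hD x).choose, fun x => (hD x).choose,
    fun x => (hD x).choose_spec.1, fun x => mem_range_self x⟩
  ChartedSpace.locallyPathConnectedSpace E N

end IsLocalHomeomorph

namespace RayStructure

variable {n : ℕ} {𝒢 : RankOneRayGeometry n} {M N : Type*} [MetricSpace M] [TopologicalSpace N]
  (X : RayStructure 𝒢 M N)

include X in
theorem t2Space : T2Space N := by
  refine ⟨fun x y hxy => ?_⟩
  by_cases h : X.p x = X.p y
  · exact X.p_covering.isSeparatedMap x y h hxy
  · obtain ⟨u, v, hu, hv, hxu, hyv, huv⟩ := t2_separation h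
    exact ⟨_, _, hu.preimage X.p_covering.continuous, hv.preimage X.p_covering.continuous, hxu,
      hyv, huv.preimage _⟩

theorem deck_p (g : deckGroup X.p) (x : N) : X.p ((g : N ≃ₜ N) x) = X.p x := g.2 x

theorem deck_eq_of_apply_eq [PreconnectedSpace N] {g h : deckGroup X.p} {x : N}
    (hx : (g : N ≃ₜ N) x = (h : N ≃ₜ N) x) : g = h := by
  refine Subtype.ext (Homeomorph.ext fun y => ?_)
  exact congrFun (X.p_covering.eq_of_comp_eq (g : N ≃ₜ N).continuous (h : N ≃ₜ N).continuous
    (funext fun y => (g.2 y).trans (h.2 y).symm) x hx) y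

/-- By simple connectedness `p` lifts through itself with `x ↦ y` and with `y ↦ x`; uniqueness of
lifts makes the two maps inverse to each other. -/
theorem exists_deck [SimplyConnectedSpace N] {x y : N} (h : X.p x = X.p y) :
    ∃ g : deckGroup X.p, (g : N ≃ₜ N) x = y := by
  have := X.D_local.locallyPathConnectedSpace
  let P : C(N, M) := ⟨X.p, X.p_covering.continuous⟩
  obtain ⟨F, ⟨hF, hFp⟩, -⟩ := X.p_covering.existsUnique_continuousMap_lifts P x y h.symm
  obtain ⟨H, ⟨hH, hHp⟩, -⟩ := X.p_covering.existsUnique_continuousMap_lifts P y x h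
  have e1 : H ∘ F = id := X.p_covering.eq_of_comp_eq (H.continuous.comp F.continuous) continuous_id
    (by rw [← Function.comp_assoc, hHp, Function.comp_id]; exact hFp) x (by simp [hF, hH])
  have e2 : F ∘ H = id := X.p_covering.eq_of_comp_eq (F.continuous.comp H.continuous) continuous_id
    (by rw [← Function.comp_assoc, hFp, Function.comp_id]; exact hHp) y (by simp [hF, hH])
  exact ⟨⟨⟨⟨F, H, congrFun e1, congrFun e2⟩, F.continuous, H.continuous⟩, congrFun hFp⟩, hF⟩

/-- The compact set replaces a fundamental domain: it makes local estimates uniform over `N`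
whenever they are compatible with deck transformations. -/
theorem exists_isCompact_cover [SimplyConnectedSpace N] [CompactSpace M] :
    ∃ Q : Set N, IsCompact Q ∧ ∀ x, ∃ g : deckGroup X.p, (g : N ≃ₜ N) x ∈ Q := by
  have := X.D_local.locallyCompactSpace
  choose s hs using X.p_surjective
  choose C hC hCs using fun m => exists_compact_mem_nhds (s m)
  have hn : ∀ m ∈ (univ : Set M), X.p '' C m ∈ 𝓝 m := fun m _ => by
    have := X.p_covering.isOpenMap.image_mem_nhds (hCs m)
    rwa [hs] at this
  obtain ⟨t, -, ht⟩ := isCompact_univ.elim_nhds_subcover (fun m => X.p '' C m) hn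
  refine ⟨⋃ m ∈ t, C m, t.isCompact_biUnion fun m _ => hC m, fun x => ?_⟩
  obtain ⟨m, hm, y, hy, hxy⟩ : ∃ m ∈ t, ∃ y ∈ C m, X.p y = X.p x := by
    simpa using ht (mem_univ (X.p x))
  obtain ⟨g, hg⟩ := X.exists_deck hxy.symm
  exact ⟨g, mem_biUnion hm (hg ▸ hy)⟩

end RayStructure

/-! ### Seminorms invariant under `K` and scaled by `A`. -/

namespace RankOneRayGeometry

variable {n : ℕ} (𝒢 : RankOneRayGeometry n)

theorem repr_a (s : ℝ) (v : RSpace n) (q : Fin n) :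
    𝒢.e.repr (𝒢.a s v) q = s ^ 𝒢.d q * 𝒢.e.repr v q := by
  simp only [a, diagMap, Module.Basis.constr_apply_fintype, map_sum, map_smul, smul_smul,
    Finsupp.coe_finsetSum, Finset.sum_apply, Finsupp.smul_apply, Module.Basis.repr_self,
    Module.Basis.equivFun_apply, smul_eq_mul]
  rw [Finset.sum_eq_single q (fun b _ hb => by simp [hb]) (by simp)]
  simp [mul_comm]

theorem a_one (v : RSpace n) : 𝒢.a 1 v = v := by
  simp [a, diagMap_one]

theorem a_mul {s t : ℝ} (hs : 0 ≤ s) (ht : 0 ≤ t) (v : RSpace n) :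
    𝒢.a (s * t) v = 𝒢.a s (𝒢.a t v) := by
  apply 𝒢.e.repr.injective
  ext q
  rw [repr_a, repr_a, repr_a, Real.mul_rpow hs ht, mul_assoc]

/-- As `0 ^ 0 = 1` and `0 ^ x = 0` for `x ≠ 0`, the map `a 0` is the projection onto the directions
with exponent 0 along the other basis vectors. It is used throughout to split off neutral
components. -/
theorem a_zero_a {s : ℝ} (hs : 0 ≤ s) (v : RSpace n) : 𝒢.a 0 (𝒢.a s v) = 𝒢.a 0 v := by
  rw [← 𝒢.a_mul le_rfl hs, zero_mul]

theorem a_inv_a {s : ℝ} (hs : 0 < s) (v : RSpace n) : 𝒢.a s⁻¹ (𝒢.a s v) = v := by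
  rw [← 𝒢.a_mul (inv_nonneg.2 hs.le) hs.le, inv_mul_cancel₀ hs.ne', a_one]

theorem bddAbove_coord (q : Fin n) (v : RSpace n) :
    BddAbove (range fun k : 𝒢.K => |𝒢.e.repr ((k : (RSpace n →L[ℝ] RSpace n)ˣ) • v) q|) := by
  have hc : Continuous fun k : (RSpace n →L[ℝ] RSpace n)ˣ => |𝒢.e.repr (k • v) q| := by
    have h1 : Continuous fun x : RSpace n => 𝒢.e.repr x q :=
      (𝒢.e.coord q).continuous_of_finiteDimensional
    have h2 : Continuous fun k : (RSpace n →L[ℝ] RSpace n)ˣ =>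
        (k : RSpace n →L[ℝ] RSpace n) v := by
      fun_prop
    exact (h1.comp h2).abs
  have := (𝒢.K_compact.image hc).bddAbove
  rwa [image_eq_range] at this

/-- The seminorm `sup |v_q|` over the `K`-orbit of `v`. -/
def wt (q : Fin n) : Seminorm ℝ (RSpace n) :=
  Seminorm.of (fun v => ⨆ k : 𝒢.K, |𝒢.e.repr ((k : (RSpace n →L[ℝ] RSpace n)ˣ) • v) q|)
    (fun v w => ciSup_le fun k => by
      rw [smul_add, map_add, Finsupp.add_apply]
      exact (abs_add_le _ _).trans (add_le_add (le_ciSup (𝒢.bddAbove_coord q v) k)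
        (le_ciSup (𝒢.bddAbove_coord q w) k)))
    (fun c v => by
      rw [Real.norm_eq_abs, Real.mul_iSup_of_nonneg (abs_nonneg c)]
      refine iSup_congr fun k => ?_
      rw [smul_comm, map_smul, Finsupp.smul_apply, smul_eq_mul, abs_mul])

theorem wt_apply (q : Fin n) (v : RSpace n) :
    𝒢.wt q v = ⨆ k : 𝒢.K, |𝒢.e.repr ((k : (RSpace n →L[ℝ] RSpace n)ˣ) • v) q| := rfl

theorem abs_repr_le_wt (q : Fin n) (v : RSpace n) : |𝒢.e.repr v q| ≤ 𝒢.wt q v := by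
  have := le_ciSup (𝒢.bddAbove_coord q v) 1
  rw [wt_apply]
  simpa using this

theorem wt_smul {k : (RSpace n →L[ℝ] RSpace n)ˣ} (hk : k ∈ 𝒢.K) (q : Fin n) (v : RSpace n) :
    𝒢.wt q (k • v) = 𝒢.wt q v := by
  rw [wt_apply, wt_apply]
  refine (Equiv.iSup_congr (Equiv.mulRight ⟨k, hk⟩) fun l => ?_)
  simp [mul_smul]

theorem norm_le_sum_wt (v : RSpace n) : ‖v‖ ≤ ∑ q, 𝒢.wt q v * ‖𝒢.e q‖ := by
  conv_lhs => rw [← 𝒢.e.sum_repr v]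
  refine (norm_sum_le _ _).trans (Finset.sum_le_sum fun q _ => ?_)
  rw [norm_smul, Real.norm_eq_abs]
  exact mul_le_mul_of_nonneg_right (𝒢.abs_repr_le_wt q v) (norm_nonneg _)

theorem eq_zero_of_wt {v : RSpace n} (h : ∀ q, 𝒢.wt q v = 0) : v = 0 := by
  have := 𝒢.norm_le_sum_wt v
  simpa [h] using this

theorem continuous_wt (q : Fin n) : Continuous (𝒢.wt q) := by
  have : ConvexOn ℝ univ (𝒢.wt q) := (𝒢.wt q).convexOn
  exact continuousOn_univ.1 (this.continuousOn isOpen_univ)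

theorem tendsto_of_wt {ι : Type*} {l : Filter ι} {f : ι → RSpace n} {v : RSpace n}
    (h : ∀ q, Tendsto (fun i => 𝒢.wt q (f i - v)) l (𝓝 0)) : Tendsto f l (𝓝 v) := by
  rw [tendsto_iff_norm_sub_tendsto_zero]
  refine squeeze_zero (fun i => norm_nonneg _) (fun i => 𝒢.norm_le_sum_wt _) ?_
  have : Tendsto (fun i => ∑ q, 𝒢.wt q (f i - v) * ‖𝒢.e q‖) l (𝓝 (∑ q, 0 * ‖𝒢.e q‖)) :=
    tendsto_finsetSum _ fun q _ => (h q).mul_const _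
  simpa using this

theorem isCompact_setOf_wt_le (c : RSpace n) (R : Fin n → ℝ) :
    IsCompact {v | ∀ q, 𝒢.wt q (v - c) ≤ R q} := by
  refine Metric.isCompact_of_isClosed_isBounded ?_ ?_
  · simp only [ofPred_forall]
    exact isClosed_iInter fun q => isClosed_le
      ((𝒢.continuous_wt q).comp (by fun_prop)) continuous_const
  · refine (Metric.isBounded_closedBall (x := c) (r := ∑ q, R q * ‖𝒢.e q‖)).subset fun v hv => ?_
    rw [Metric.mem_closedBall, dist_eq_norm]
    exact (𝒢.norm_le_sum_wt _).trans (Finset.sum_le_sum fun q _ =>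
      mul_le_mul_of_nonneg_right (hv q) (norm_nonneg _))

theorem exists_wt_lt_of_mem_nhds {U : Set (RSpace n)} (hU : U ∈ 𝓝 0) :
    ∃ ε > 0, ∀ v, (∀ q, 𝒢.wt q v < ε) → v ∈ U := by
  obtain ⟨r, hr, hrU⟩ := Metric.mem_nhds_iff.1 hU
  have hS : 0 ≤ ∑ q, ‖𝒢.e q‖ := Finset.sum_nonneg fun q _ => norm_nonneg _
  refine ⟨r / (∑ q, ‖𝒢.e q‖ + 1), by positivity, fun v hv => hrU ?_⟩
  rw [mem_ball_zero_iff]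
  refine (𝒢.norm_le_sum_wt v).trans_lt ?_
  calc ∑ q, 𝒢.wt q v * ‖𝒢.e q‖ ≤ ∑ q, r / (∑ q, ‖𝒢.e q‖ + 1) * ‖𝒢.e q‖ :=
        Finset.sum_le_sum fun q _ => mul_le_mul_of_nonneg_right (hv q).le (norm_nonneg _)
    _ = r * (∑ q, ‖𝒢.e q‖ / (∑ q, ‖𝒢.e q‖ + 1)) := by
        rw [Finset.mul_sum]
        exact Finset.sum_congr rfl fun q _ => by ring
    _ < r := by
        rw [← Finset.sum_div]
        refine mul_lt_of_lt_one_right hr ?_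
        rw [div_lt_one (by positivity)]
        linarith

section Nonneg

variable (hd : ∀ q, 0 ≤ 𝒢.d q)
include hd

theorem continuousAt_a (v : RSpace n) (s : ℝ) : Tendsto (fun t => 𝒢.a t v) (𝓝 s) (𝓝 (𝒢.a s v)) := by
  have h : ∀ t, 𝒢.a t v = ∑ q, (t ^ 𝒢.d q * 𝒢.e.repr v q) • 𝒢.e q := fun t => by
    rw [← 𝒢.e.sum_repr (𝒢.a t v)]
    simp only [repr_a]
  simp only [h]
  exact tendsto_finsetSum _ fun q _ =>
    (((Real.continuous_rpow_const (hd q)).tendsto s).mul_const _).smul_const _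

/-- The case `s = 0` is the limit of positive parameters, which exists because the exponents are
nonnegative. Thus `K` also commutes with the neutral projection. -/
theorem smul_a {k : (RSpace n →L[ℝ] RSpace n)ˣ} (hk : k ∈ 𝒢.K) {s : ℝ} (hs : 0 ≤ s)
    (v : RSpace n) : k • 𝒢.a s v = 𝒢.a s (k • v) := by
  rcases hs.lt_or_eq with h | rfl
  · exact 𝒢.K_centralizes k hk s h v
  · have h1 : Tendsto (fun t => k • 𝒢.a t v) (𝓝[>] 0) (𝓝 (k • 𝒢.a 0 v)) :=
      ((k : RSpace n →L[ℝ] RSpace n).continuous.tendsto _).comp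
        ((𝒢.continuousAt_a hd v 0).mono_left nhdsWithin_le_nhds)
    refine tendsto_nhds_unique h1
      (((𝒢.continuousAt_a hd (k • v) 0).mono_left nhdsWithin_le_nhds).congr' ?_)
    filter_upwards [self_mem_nhdsWithin] with t ht
    exact (𝒢.K_centralizes k hk t ht v).symm

/-- `a s` commutes with `K`, so it multiplies the `q`-th coordinate by the same factor along the
whole `K`-orbit. -/
theorem wt_a {s : ℝ} (hs : 0 ≤ s) (q : Fin n) (v : RSpace n) :
    𝒢.wt q (𝒢.a s v) = s ^ 𝒢.d q * 𝒢.wt q v := by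
  rw [wt_apply, wt_apply, Real.mul_iSup_of_nonneg (Real.rpow_nonneg hs _)]
  refine iSup_congr fun k => ?_
  rw [𝒢.smul_a hd k.2 hs, repr_a, abs_mul, abs_of_nonneg (Real.rpow_nonneg hs _)]

theorem wt_sub_a {s : ℝ} (hs : 0 ≤ s) (q : Fin n) (v : RSpace n) :
    𝒢.wt q (v - 𝒢.a s v) = |1 - s ^ 𝒢.d q| * 𝒢.wt q v := by
  rw [wt_apply, wt_apply, Real.mul_iSup_of_nonneg (abs_nonneg _)]
  refine iSup_congr fun k => ?_
  rw [smul_sub, 𝒢.smul_a hd k.2 hs, map_sub, Finsupp.sub_apply, repr_a, ← abs_mul, sub_mul, one_mul]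

theorem wt_eq_zero_of_a_zero_eq_self {p : RSpace n} (hp : 𝒢.a 0 p = p) {q : Fin n}
    (hq : 𝒢.d q ≠ 0) : 𝒢.wt q p = 0 := by
  rw [← hp, 𝒢.wt_a hd le_rfl, Real.zero_rpow hq, zero_mul]

theorem wt_eq_zero_of_a_zero_eq_zero {u : RSpace n} (hu : 𝒢.a 0 u = 0) {q : Fin n}
    (hq : 𝒢.d q = 0) : 𝒢.wt q u = 0 := by
  have := 𝒢.wt_a hd le_rfl q u
  rwa [hu, hq, Real.rpow_zero, one_mul, map_zero, eq_comm] at this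

theorem a_zero_eq_self_of_wt {p : RSpace n} (hp : ∀ q, 𝒢.d q ≠ 0 → 𝒢.wt q p = 0) :
    𝒢.a 0 p = p := by
  refine (sub_eq_zero.1 (𝒢.eq_zero_of_wt fun q => ?_)).symm
  rw [𝒢.wt_sub_a hd le_rfl]
  by_cases hq : 𝒢.d q = 0
  · simp [hq]
  · simp [hp q hq]

/-- An element of `G` scales the seminorms and commutes with `A`. -/
theorem exists_scale (T : 𝒢.G) : ∃ s : ℝ, 0 < s ∧
    (∀ q v, 𝒢.wt q ((T : RSpace n ≃ᵃ[ℝ] RSpace n).linear v) = s ^ 𝒢.d q * 𝒢.wt q v) ∧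
    ∀ t, 0 ≤ t → ∀ v, (T : RSpace n ≃ᵃ[ℝ] RSpace n).linear (𝒢.a t v) =
      𝒢.a t ((T : RSpace n ≃ᵃ[ℝ] RSpace n).linear v) := by
  obtain ⟨T, k, hk, s, hs, h⟩ := T
  refine ⟨s, hs, fun q v => ?_, fun t ht v => ?_⟩
  · rw [h]
    exact (𝒢.wt_smul hk q _).trans (𝒢.wt_a hd hs.le q v)
  · rw [h, h, ← 𝒢.a_mul hs.le ht, mul_comm, 𝒢.a_mul ht hs.le]
    exact 𝒢.smul_a hd hk ht _

end Nonneg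

end RankOneRayGeometry

/-! ### Boxes. -/

namespace RankOneRayGeometry

variable {n : ℕ} (𝒢 : RankOneRayGeometry n)

/-- The box of size `R` around `c`; it is unbounded in the neutral directions. -/
def box (c : RSpace n) (R : ℝ) : Set (RSpace n) :=
  {v | ∀ q, 𝒢.d q ≠ 0 → 𝒢.wt q (v - c) < R ^ 𝒢.d q}

theorem convex_box (c : RSpace n) (R : ℝ) : Convex ℝ (𝒢.box c R) := by
  have : 𝒢.box c R = ⋂ q, ⋂ (_ : 𝒢.d q ≠ 0), (𝒢.wt q).ball c (R ^ 𝒢.d q) := by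
    ext v
    simp [box, Seminorm.mem_ball]
  rw [this]
  exact convex_iInter fun q => convex_iInter fun _ => (𝒢.wt q).convex_ball _ _

theorem mem_box_self (c : RSpace n) {R : ℝ} (hR : 0 < R) : c ∈ 𝒢.box c R := fun q _ => by
  simpa using Real.rpow_pos_of_pos hR _

theorem isOpen_box (c : RSpace n) (R : ℝ) : IsOpen (𝒢.box c R) := by
  simp only [box, ofPred_forall]
  exact isOpen_iInter_of_finite fun q => isOpen_iInter_of_finite fun _ =>
    isOpen_lt ((𝒢.continuous_wt q).comp (by fun_prop)) continuous_const

/-- A point of the closed box is joined to the points of the box inside the box. -/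
theorem lineMap_mem_box {c x w : RSpace n} {R : ℝ} (hx : x ∈ 𝒢.box c R)
    (hw : ∀ q, 𝒢.d q ≠ 0 → 𝒢.wt q (w - c) ≤ R ^ 𝒢.d q) {t : ℝ} (ht : t ∈ Ico (0 : ℝ) 1) :
    AffineMap.lineMap x w t ∈ 𝒢.box c R := by
  intro q hq
  have e : AffineMap.lineMap x w t - c = (1 - t) • (x - c) + t • (w - c) := by
    rw [AffineMap.lineMap_apply_module]
    module
  rw [e]
  refine (map_add_le_add _ _ _).trans_lt ?_
  rw [map_smul_eq_mul, map_smul_eq_mul, Real.norm_of_nonneg ht.1,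
    Real.norm_of_nonneg (by linarith [ht.2])]
  have h1 := hx q hq
  have h2 := hw q hq
  nlinarith [ht.1, ht.2, mul_pos (sub_pos.2 ht.2) (sub_pos.2 h1)]

variable (hd : ∀ q, 0 ≤ 𝒢.d q)
include hd

theorem box_mono (c : RSpace n) {R R' : ℝ} (hR : 0 ≤ R) (h : R ≤ R') :
    𝒢.box c R ⊆ 𝒢.box c R' := fun _ hv q hq =>
  (hv q hq).trans_le (Real.rpow_le_rpow hR h (hd q))

end RankOneRayGeometry

/-! ### Deck transformations on the model space, and completeness in the neutral directions. -/

namespace RayStructure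

variable {n : ℕ} {𝒢 : RankOneRayGeometry n} {M N : Type*} [MetricSpace M] [TopologicalSpace N]
  (X : RayStructure 𝒢 M N) (hd : ∀ q, 0 ≤ 𝒢.d q)

/-- The factor by which a deck transformation rescales. -/
def scale (g : deckGroup X.p) : ℝ := (𝒢.exists_scale hd (X.ρ g)).choose

theorem scale_pos (g : deckGroup X.p) : 0 < X.scale hd g :=
  (𝒢.exists_scale hd (X.ρ g)).choose_spec.1

/-- The affine map by which a deck transformation acts on the model space. -/
abbrev hol (g : deckGroup X.p) : RSpace n ≃ᵃ[ℝ] RSpace n := (X.ρ g : RSpace n ≃ᵃ[ℝ] RSpace n)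

theorem wt_linear (g : deckGroup X.p) (q : Fin n) (v : RSpace n) :
    𝒢.wt q ((X.hol g).linear v) = X.scale hd g ^ 𝒢.d q * 𝒢.wt q v :=
  (𝒢.exists_scale hd (X.ρ g)).choose_spec.2.1 q v

include hd in
theorem linear_a (g : deckGroup X.p) {t : ℝ} (ht : 0 ≤ t) (v : RSpace n) :
    (X.hol g).linear (𝒢.a t v) = 𝒢.a t ((X.hol g).linear v) :=
  (𝒢.exists_scale hd (X.ρ g)).choose_spec.2.2 t ht v

theorem hol_sub (g : deckGroup X.p) (v w : RSpace n) :
    X.hol g v - X.hol g w = (X.hol g).linear (v - w) := by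
  have := AffineMap.linearMap_vsub ((X.hol g) : RSpace n →ᵃ[ℝ] RSpace n) v w
  exact this.symm

theorem hol_add (g : deckGroup X.p) (v w : RSpace n) :
    X.hol g (v + w) = X.hol g v + (X.hol g).linear w := by
  rw [← sub_eq_iff_eq_add', hol_sub, add_sub_cancel_left]

theorem wt_hol_sub (g : deckGroup X.p) (q : Fin n) (v w : RSpace n) :
    𝒢.wt q (X.hol g v - X.hol g w) = X.scale hd g ^ 𝒢.d q * 𝒢.wt q (v - w) := by
  rw [hol_sub, wt_linear]

variable [T2Space N]

theorem visible_deck_iff (g : deckGroup X.p) {z : N} {v : RSpace n} :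
    Visible X.D ((g : N ≃ₜ N) z) (X.hol g v) ↔ Visible X.D z v :=
  visible_map_iff X.D_local _ _ (X.equivariant g)

theorem expMap_deck (g : deckGroup X.p) {z : N} {v : RSpace n} (h : Visible X.D z v) :
    expMap X.D ((g : N ≃ₜ N) z) (X.hol g v) = (g : N ≃ₜ N) (expMap X.D z v) :=
  (h.map X.D_local _ _ (X.equivariant g)).2

theorem hol_mem_box_iff (g : deckGroup X.p) (z : N) {v : RSpace n} {R : ℝ} (hR : 0 ≤ R) :
    X.hol g v ∈ 𝒢.box (X.D ((g : N ≃ₜ N) z)) (X.scale hd g * R) ↔ v ∈ 𝒢.box (X.D z) R := by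
  refine forall₂_congr fun q _ => ?_
  rw [X.equivariant g, X.wt_hol_sub hd, Real.mul_rpow (X.scale_pos hd g).le hR]
  exact mul_lt_mul_iff_right₀ (Real.rpow_pos_of_pos (X.scale_pos hd g) _)

section Neutral

variable [SimplyConnectedSpace N] [CompactSpace M]
include hd

/-- Uniformity over a compact `Q` is spread by deck transformations: the seminorms with exponent 0
are preserved since `s ^ 0 = 1`, and all others vanish on neutral vectors. -/
theorem exists_visible_neutral : ∃ ε > 0, ∀ (z : N) (p : RSpace n), 𝒢.a 0 p = p →
    (∀ q, 𝒢.wt q p < ε) → Visible X.D z (X.D z + p) := by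
  obtain ⟨Q, hQ, hcov⟩ := X.exists_isCompact_cover
  have hDc := X.D_local.continuous
  have h : ∀ᶠ p in 𝓝 (0 : RSpace n), ∀ z ∈ Q, Visible X.D z (X.D z + p) := by
    refine hQ.eventually_forall_of_forall_eventually fun z _ => ?_
    have hc : ContinuousAt (fun x : RSpace n × N => (x.2, X.D x.2 + x.1)) (0, z) := by fun_prop
    exact hc.eventually ((isOpen_visible X.D_local).mem_nhds
      (by simpa using visible_self (D := X.D) z))
  obtain ⟨ε, hε, hU⟩ := 𝒢.exists_wt_lt_of_mem_nhds h
  refine ⟨ε, hε, fun z p hp hpε => ?_⟩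
  obtain ⟨g, hg⟩ := hcov z
  rw [← X.visible_deck_iff g, hol_add, ← X.equivariant g]
  refine hU _ (fun q => ?_) _ hg
  rw [X.wt_linear hd]
  by_cases hq : 𝒢.d q = 0
  · simpa [hq] using hpε q
  · simpa [𝒢.wt_eq_zero_of_a_zero_eq_self hd hp hq] using hε

/-- Steps of the uniform size `ε` can be repeated without end, so no neutral segment stops. -/
theorem visible_neutral (z : N) {p : RSpace n} (hp : 𝒢.a 0 p = p) :
    Visible X.D z (X.D z + p) := by
  obtain ⟨ε, hε, hvis⟩ := X.exists_visible_neutral hd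
  have key : ∀ m : ℕ, ∀ p : RSpace n, 𝒢.a 0 p = p → (∀ q, 𝒢.wt q p < ε) →
      Visible X.D z (X.D z + (m : ℝ) • p) := by
    intro m
    induction m with
    | zero =>
      intro p _ _
      simpa using visible_self (D := X.D) z
    | succ m ih =>
      intro p hp hpε
      have hseg : ∀ t ∈ Icc (0 : ℝ) 1,
          Visible X.D z (AffineMap.lineMap (X.D z) (X.D z + (m : ℝ) • p) t) := fun t ht =>
        (ih p hp hpε).star X.D_local ht
      -- Sweep along the lifted segment to `X.D z + m • p`: at time `t` the displacement still to be
      -- covered is `t • p`, which is within the uniform size.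
      refine Visible.of_visible_path X.D_local
        (f := fun t => expMap X.D z (AffineMap.lineMap (X.D z) (X.D z + (m : ℝ) • p) t))
        ((continuousOn_expMap X.D_local (C := (fun t : ℝ => AffineMap.lineMap (X.D z)
          (X.D z + (m : ℝ) • p) t) '' Icc 0 1) (by rintro _ ⟨t, ht, rfl⟩; exact hseg t ht)).comp
          AffineMap.lineMap_continuous.continuousOn (mapsTo_image _ _))
        (by simp [expMap_self X.D_local]) fun t ht => ?_
      have e : AffineMap.lineMap (X.D z) (X.D z + ((m + 1 : ℕ) : ℝ) • p) t =
          X.D (expMap X.D z (AffineMap.lineMap (X.D z) (X.D z + (m : ℝ) • p) t)) + t • p := by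
        rw [apply_expMap (hseg t ht)]
        simp only [AffineMap.lineMap_apply_module']
        push_cast
        module
      rw [e]
      refine hvis _ _ (by rw [map_smul, hp]) fun q => ?_
      rw [map_smul_eq_mul, Real.norm_of_nonneg ht.1]
      exact (mul_le_of_le_one_left (apply_nonneg _ _) ht.2).trans_lt (hpε q)
  obtain ⟨m, hm⟩ : ∃ m : ℕ, ∀ q, 𝒢.wt q p < m * ε := by
    have : ∀ᶠ m : ℕ in atTop, ∀ q, 𝒢.wt q p < m * ε :=
      eventually_all.2 fun q =>
        (tendsto_natCast_atTop_atTop.atTop_mul_const hε).eventually_gt_atTop _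
    exact this.exists
  rcases Nat.eq_zero_or_pos m with rfl | hm0
  · have : p = 0 := 𝒢.eq_zero_of_wt fun q => le_antisymm
      (by simpa using (hm q).le) (apply_nonneg _ _)
    simpa [this] using visible_self (D := X.D) z
  · have hm0' : (0 : ℝ) < m := by exact_mod_cast hm0
    have := key m ((m : ℝ)⁻¹ • p) (by rw [map_smul, hp]) fun q => by
      rw [map_smul_eq_mul, Real.norm_of_nonneg (by positivity), inv_mul_lt_iff₀ hm0']
      exact hm q
    rwa [smul_smul, mul_inv_cancel₀ hm0'.ne', one_smul] at this

/-- Along the lifted segment to `v`, the segment to `v + p` deviates by the neutral vector `t • p`,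
which is visible from the moving origin. -/
theorem Visible.add_neutral {z : N} {v p : RSpace n} (h : Visible X.D z v) (hp : 𝒢.a 0 p = p) :
    Visible X.D z (v + p) := by
  have hseg : ∀ t ∈ Icc (0 : ℝ) 1, Visible X.D z (AffineMap.lineMap (X.D z) v t) := fun t ht =>
    h.star X.D_local ht
  refine Visible.of_visible_path X.D_local
    (f := fun t => expMap X.D z (AffineMap.lineMap (X.D z) v t))
    ((continuousOn_expMap X.D_local (C := (fun t : ℝ => AffineMap.lineMap (X.D z) v t) '' Icc 0 1)
      (by rintro _ ⟨t, ht, rfl⟩; exact hseg t ht)).comp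
      AffineMap.lineMap_continuous.continuousOn (mapsTo_image _ _))
    (by simp [expMap_self X.D_local]) fun t ht => ?_
  have e : AffineMap.lineMap (X.D z) (v + p) t =
      X.D (expMap X.D z (AffineMap.lineMap (X.D z) v t)) + t • p := by
    rw [apply_expMap (hseg t ht)]
    simp only [AffineMap.lineMap_apply_module']
    module
  rw [e]
  exact X.visible_neutral hd _ (by rw [map_smul, hp])

theorem visible_add_neutral_iff {z : N} {v p : RSpace n} (hp : 𝒢.a 0 p = p) :
    Visible X.D z (v + p) ↔ Visible X.D z v := by
  refine ⟨fun h => ?_, fun h => Visible.add_neutral X hd h hp⟩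
  have := Visible.add_neutral X hd h (p := -p) (by rw [map_neg, hp])
  simpa using this

end Neutral

/-! ### The largest visible box. -/

/-- The box of size `R` around `z` is visible from `z`. -/
def BoxVisible (z : N) (R : ℝ) : Prop := ∀ v ∈ 𝒢.box (X.D z) R, Visible X.D z v

/-- The size of the largest visible box. -/
def radius (z : N) : ℝ := sSup {R | 0 < R ∧ X.BoxVisible z R}

section Radius

variable [SimplyConnectedSpace N] [CompactSpace M]
include hd

/-- The box is unbounded in the neutral directions, but these do not affect visibility. Once the
neutral projection of `v - X.D z` is removed, the remainder is small in every seminorm. -/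
theorem exists_boxVisible (z : N) : ∃ R > 0, X.BoxVisible z R := by
  have hU : {u | Visible X.D z (X.D z + u)} ∈ 𝓝 (0 : RSpace n) :=
    ((isOpen_setOf_visible X.D_local z).preimage
      (by fun_prop : Continuous fun u => X.D z + u)).mem_nhds
      (by simpa using visible_self (D := X.D) z)
  obtain ⟨ε, hε, hεU⟩ := 𝒢.exists_wt_lt_of_mem_nhds hU
  have hev : ∀ᶠ R : ℝ in 𝓝[>] 0, ∀ q, 𝒢.d q ≠ 0 → R ^ 𝒢.d q < ε := by
    refine eventually_all.2 fun q => ?_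
    by_cases hq : 𝒢.d q = 0
    · simp [hq]
    · have := (Real.continuous_rpow_const (hd q)).tendsto 0
      rw [Real.zero_rpow hq] at this
      filter_upwards [(this.mono_left nhdsWithin_le_nhds).eventually_lt_const hε] with R hR _
      exact hR
  obtain ⟨R, hR, hR0⟩ := (hev.and self_mem_nhdsWithin).exists
  refine ⟨R, hR0, fun v hv => ?_⟩
  set u := v - X.D z with hu
  have h1 : Visible X.D z (X.D z + (u - 𝒢.a 0 u)) := by
    refine hεU _ fun q => ?_
    rw [𝒢.wt_sub_a hd le_rfl]
    by_cases hq : 𝒢.d q = 0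
    · simpa [hq] using hε
    · simpa [Real.zero_rpow hq] using (hv q hq).trans (hR q hq)
  rw [← X.visible_add_neutral_iff hd (p := 𝒢.a 0 u) (𝒢.a_zero_a le_rfl u)] at h1
  convert h1 using 1
  rw [hu]
  abel

theorem bddAbove_boxVisible {z : N} (h : ∃ v, ¬ Visible X.D z v) :
    BddAbove {R | 0 < R ∧ X.BoxVisible z R} := by
  obtain ⟨v, hv⟩ := h
  have hev : ∀ᶠ R : ℝ in atTop, v ∈ 𝒢.box (X.D z) R := by
    refine eventually_all.2 fun q => ?_
    by_cases hq : 𝒢.d q = 0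
    · simp [hq]
    · filter_upwards [(tendsto_rpow_atTop ((hd q).lt_of_ne' hq)).eventually_gt_atTop
        (𝒢.wt q (v - X.D z))] with R hR _
      exact hR
  obtain ⟨R₀, hR₀⟩ := eventually_atTop.1 hev
  refine ⟨R₀, fun R hR => ?_⟩
  by_contra hcon
  exact hv (hR.2 v (hR₀ R (not_le.1 hcon).le))

variable (hinc : ∀ z, ∃ v, ¬ Visible X.D z v)
include hinc

theorem radius_pos (z : N) : 0 < X.radius z := by
  obtain ⟨R, hR, h⟩ := X.exists_boxVisible hd z
  exact hR.trans_le (le_csSup (X.bddAbove_boxVisible hd (hinc z)) ⟨hR, h⟩)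

/-- Boxes are defined by finitely many strict inequalities, so each point of the box already lies in
a smaller one: the supremum is attained. -/
theorem boxVisible_radius (z : N) : X.BoxVisible z (X.radius z) := by
  intro v hv
  have hr := X.radius_pos hd hinc z
  have hev : ∀ᶠ R : ℝ in 𝓝[<] X.radius z, v ∈ 𝒢.box (X.D z) R := by
    refine eventually_all.2 fun q => ?_
    by_cases hq : 𝒢.d q = 0
    · simp [hq]
    · filter_upwards [(((Real.continuous_rpow_const (hd q)).tendsto (X.radius z)).mono_left
        nhdsWithin_le_nhds).eventually_const_lt (hv q hq)] with R hR _
      exact hR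
  obtain ⟨R, hR, hR0, hRr⟩ := (hev.and (Ioo_mem_nhdsLT hr)).exists
  obtain ⟨b, hb⟩ := X.exists_boxVisible hd z
  obtain ⟨R', hR', hlt⟩ := exists_lt_of_lt_csSup ⟨b, hb⟩ hRr
  exact hR'.2 v (𝒢.box_mono hd _ hR0.le hlt.le hR)

theorem boxVisible_iff (z : N) {R : ℝ} (hR : 0 < R) : X.BoxVisible z R ↔ R ≤ X.radius z :=
  ⟨fun h => le_csSup (X.bddAbove_boxVisible hd (hinc z)) ⟨hR, h⟩,
    fun h v hv => X.boxVisible_radius hd hinc z v (𝒢.box_mono hd _ hR.le h hv)⟩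

theorem radius_le {z : N} {w : RSpace n} {R : ℝ} (hw : ¬ Visible X.D z w) (hR : 0 < R)
    (h : ∀ q, 𝒢.d q ≠ 0 → 𝒢.wt q (w - X.D z) ≤ R ^ 𝒢.d q) : X.radius z ≤ R := by
  by_contra hcon
  refine hw (X.boxVisible_radius hd hinc z w fun q hq => (h q hq).trans_lt ?_)
  exact Real.rpow_lt_rpow hR.le (not_le.1 hcon) ((hd q).lt_of_ne' hq)

/-- The holonomy maps boxes to boxes rescaled by `scale`, and deck transformations preserve
visibility. -/
theorem radius_deck (g : deckGroup X.p) (z : N) :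
    X.radius ((g : N ≃ₜ N) z) = X.scale hd g * X.radius z := by
  have hs := X.scale_pos hd g
  have hr := X.radius_pos hd hinc
  have key : ∀ R, 0 < R → (X.BoxVisible ((g : N ≃ₜ N) z) (X.scale hd g * R) ↔
      X.BoxVisible z R) := by
    intro R hR
    refine ⟨fun h v hv => ?_, fun h v hv => ?_⟩
    · rw [← X.visible_deck_iff g]
      exact h _ ((X.hol_mem_box_iff hd g z hR.le).2 hv)
    · obtain ⟨u, rfl⟩ := (X.hol g).surjective v
      exact (X.visible_deck_iff g).2 (h u ((X.hol_mem_box_iff hd g z hR.le).1 hv))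
  refine le_antisymm ?_ ?_
  · have h1 : 0 < (X.scale hd g)⁻¹ * X.radius ((g : N ≃ₜ N) z) := mul_pos (inv_pos.2 hs) (hr _)
    have := (X.boxVisible_iff hd hinc z h1).1 ((key _ h1).1 (by
      rw [mul_inv_cancel_left₀ hs.ne']
      exact X.boxVisible_radius hd hinc _))
    rwa [inv_mul_le_iff₀ hs] at this
  · exact (X.boxVisible_iff hd hinc _ (mul_pos hs (hr z))).1
      ((key _ (hr z)).2 (X.boxVisible_radius hd hinc z))

end Radius

end RayStructure

/-! ### Nearest invisible points, and shrinking towards them. -/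

namespace RayStructure

variable {n : ℕ} {𝒢 : RankOneRayGeometry n} {M N : Type*} [MetricSpace M] [TopologicalSpace N]
  (X : RayStructure 𝒢 M N) (hd : ∀ q, 0 ≤ 𝒢.d q)

/-- `w` is a nearest invisible point: it is not visible from `z` and lies on the boundary of the
largest visible box, at the same height as `z` in the neutral directions. -/
structure Nearest (z : N) (w : RSpace n) : Prop where
  not_visible : ¬ Visible X.D z w
  neutral : 𝒢.a 0 (w - X.D z) = 0
  wt_le : ∀ q, 𝒢.wt q (w - X.D z) ≤ X.radius z ^ 𝒢.d q

/-- The point that divides the segment from `z` to `w`, in the sense of the group `A`, with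
ratio `s`. -/
def shrink (z : N) (w : RSpace n) (s : ℝ) : N := expMap X.D z (w + 𝒢.a s (X.D z - w))

variable [T2Space N] [SimplyConnectedSpace N] [CompactSpace M]
  (hinc : ∀ z, ∃ v, ¬ Visible X.D z v)
include hd hinc

/-- The large box is convex and visible from `z`, so any box inside it is visible from the point of
`N` over its own center. -/
theorem le_radius {z : N} {c : RSpace n} (hc : c ∈ 𝒢.box (X.D z) (X.radius z)) {R : ℝ}
    (hR : 0 < R) (hsub : 𝒢.box c R ⊆ 𝒢.box (X.D z) (X.radius z)) :
    R ≤ X.radius (expMap X.D z c) := by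
  have hvis := X.boxVisible_radius hd hinc z
  rw [← X.boxVisible_iff hd hinc _ hR]
  intro v hv
  rw [apply_expMap (hvis c hc)] at hv
  exact (Visible.of_convex X.D_local (𝒢.convex_box _ _) hvis hc (hsub hv)).1

theorem not_visible_expMap {z : N} {w c : RSpace n} (hw : ¬ Visible X.D z w)
    (hwt : ∀ q, 𝒢.d q ≠ 0 → 𝒢.wt q (w - X.D z) ≤ X.radius z ^ 𝒢.d q)
    (hc : c ∈ 𝒢.box (X.D z) (X.radius z)) : ¬ Visible X.D (expMap X.D z c) w := by
  intro hv
  have hz := 𝒢.mem_box_self (X.D z) (X.radius_pos hd hinc z)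
  refine hw ?_
  have := Visible.of_convex_closure X.D_local (𝒢.convex_box _ _) (X.boxVisible_radius hd hinc z)
    hz hc (fun t ht => 𝒢.lineMap_mem_box hz hwt ht) hv
  rwa [expMap_self X.D_local] at this

/-- Boxes slightly larger than the visible one contain invisible points. A limit of these is still
invisible, because visibility is open, and it lies in the closed box. -/
theorem exists_nearest (z : N) : ∃ w, X.Nearest z w := by
  have hr := X.radius_pos hd hinc z
  set r := X.radius z with hrdef
  have h1 : ∀ k : ℕ, ∃ w, ¬ Visible X.D z w ∧ 𝒢.a 0 (w - X.D z) = 0 ∧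
      ∀ q, 𝒢.wt q (w - X.D z) ≤ (r + 1 / ((k : ℝ) + 1)) ^ 𝒢.d q := by
    intro k
    have hk : 0 < 1 / ((k : ℝ) + 1) := by positivity
    have : ¬ X.BoxVisible z (r + 1 / ((k : ℝ) + 1)) := by
      rw [X.boxVisible_iff hd hinc z (by positivity)]
      linarith
    simp only [BoxVisible, not_forall] at this
    obtain ⟨v, hv, hvis⟩ := this
    have ha : 𝒢.a 0 (v - X.D z - 𝒢.a 0 (v - X.D z)) = 0 := by
      rw [map_sub, 𝒢.a_zero_a le_rfl, sub_self]
    have e : v - 𝒢.a 0 (v - X.D z) - X.D z = v - X.D z - 𝒢.a 0 (v - X.D z) := by abel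
    -- Removing the neutral component keeps the point invisible and prevents the sequence from
    -- escaping along the unbounded directions of the box.
    refine ⟨v - 𝒢.a 0 (v - X.D z), fun h => hvis ?_, by rw [e, ha], fun q => ?_⟩
    · rw [← X.visible_add_neutral_iff hd (𝒢.a_zero_a le_rfl (v - X.D z))] at h
      simpa using h
    · rw [e]
      by_cases hq : 𝒢.d q = 0
      · rw [𝒢.wt_eq_zero_of_a_zero_eq_zero hd ha hq]
        positivity
      · rw [𝒢.wt_sub_a hd le_rfl, Real.zero_rpow hq]
        simpa using (hv q hq).le
  choose w hw1 hw2 hw3 using h1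
  have hcpt := 𝒢.isCompact_setOf_wt_le (X.D z) fun q => (r + 1) ^ 𝒢.d q
  obtain ⟨w₀, -, φ, hφ, hlim⟩ := hcpt.tendsto_subseq (x := w) fun k q =>
    (hw3 k q).trans (Real.rpow_le_rpow (by positivity) (by
      gcongr
      rw [div_le_one (by positivity)]
      linarith [(Nat.cast_nonneg k : (0 : ℝ) ≤ k)]) (hd q))
  refine ⟨w₀, ?_, ?_, fun q => ?_⟩
  · have hcl : IsClosed {v | ¬ Visible X.D z v} :=
      (isOpen_setOf_visible X.D_local z).isClosed_compl
    exact hcl.mem_of_tendsto hlim (Eventually.of_forall fun k => hw1 _)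
  · have hc : Continuous fun v => 𝒢.a 0 (v - X.D z) :=
      (𝒢.a 0).continuous_of_finiteDimensional.comp (by fun_prop)
    exact tendsto_nhds_unique ((hc.tendsto w₀).comp hlim)
      (by simp only [Function.comp_def, hw2]; exact tendsto_const_nhds)
  · have hc : Continuous fun v => 𝒢.wt q (v - X.D z) := (𝒢.continuous_wt q).comp (by fun_prop)
    have h2 : Tendsto (fun k => (r + 1 / (((φ k : ℕ) : ℝ) + 1)) ^ 𝒢.d q) atTop
        (𝓝 (r ^ 𝒢.d q)) := by
      have h3 := tendsto_one_div_add_atTop_nhds_zero_nat (𝕜 := ℝ) |>.comp hφ.tendsto_atTop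
      have h4 := (tendsto_const_nhds (x := r)).add h3
      rw [add_zero] at h4
      exact ((Real.continuous_rpow_const (hd q)).tendsto r).comp h4
    exact le_of_tendsto_of_tendsto' ((hc.tendsto w₀).comp hlim) h2 fun k => hw3 _ q

/-- For `z'` near `z`, a slightly smaller box around `z'` fits into the visible box of `z`, which
bounds the radius from below. A nearest point of `z` stays invisible from `z'`, which bounds it from
above. -/
theorem continuous_radius : Continuous X.radius := by
  refine continuous_iff_continuousAt.2 fun z => ?_
  have hr := X.radius_pos hd hinc z
  have hDc := X.D_local.continuous
  have hbox : ∀ᶠ z' in 𝓝 z, X.D z' ∈ 𝒢.box (X.D z) (X.radius z) :=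
    hDc.continuousAt.eventually ((𝒢.isOpen_box _ _).mem_nhds (𝒢.mem_box_self _ hr))
  have hwt : ∀ (q : Fin n) (v : RSpace n), Tendsto (fun z' => 𝒢.wt q (v - X.D z')) (𝓝 z)
      (𝓝 (𝒢.wt q (v - X.D z))) := fun q v =>
    ((𝒢.continuous_wt q).comp (continuous_const.sub hDc)).tendsto z
  refine tendsto_order.2 ⟨fun a ha => ?_, fun b hb => ?_⟩
  · obtain ⟨R, hR1, hR2⟩ := exists_between (max_lt ha hr)
    have hR0 : 0 < R := (le_max_right _ _).trans_lt hR1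
    have hsub : ∀ᶠ z' in 𝓝 z, 𝒢.box (X.D z') R ⊆ 𝒢.box (X.D z) (X.radius z) := by
      have : ∀ᶠ z' in 𝓝 z, ∀ q, 𝒢.d q ≠ 0 →
          𝒢.wt q (X.D z - X.D z') < X.radius z ^ 𝒢.d q - R ^ 𝒢.d q := by
        refine eventually_all.2 fun q => ?_
        by_cases hq : 𝒢.d q = 0
        · simp [hq]
        · have h1 := hwt q (X.D z)
          rw [sub_self, map_zero] at h1
          filter_upwards [h1.eventually_lt_const (sub_pos.2 (Real.rpow_lt_rpow hR0.le hR2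
            ((hd q).lt_of_ne' hq)))] with z' hz' _ using hz'
      filter_upwards [this] with z' hz' v hv q hq
      have h2 : v - X.D z = (v - X.D z') - (X.D z - X.D z') := by abel
      rw [h2]
      refine (map_sub_le_add _ _ _).trans_lt ?_
      linarith [hv q hq, hz' q hq]
    filter_upwards [hbox, hsub, eventually_expMap_eq X.D_local z] with z' h1 h2 h3
    have := X.le_radius hd hinc h1 hR0 h2
    rw [h3.2] at this
    exact ((le_max_left _ _).trans_lt hR1).trans_le this
  · obtain ⟨R, hR1, hR2⟩ := exists_between hb
    obtain ⟨w, hw⟩ := X.exists_nearest hd hinc z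
    have hwR : ∀ᶠ z' in 𝓝 z, ∀ q, 𝒢.d q ≠ 0 → 𝒢.wt q (w - X.D z') ≤ R ^ 𝒢.d q := by
      refine eventually_all.2 fun q => ?_
      by_cases hq : 𝒢.d q = 0
      · simp [hq]
      · filter_upwards [(hwt q w).eventually_lt_const ((hw.wt_le q).trans_lt
          (Real.rpow_lt_rpow hr.le hR1 ((hd q).lt_of_ne' hq)))] with z' hz' _ using hz'.le
    filter_upwards [hbox, hwR, eventually_expMap_eq X.D_local z] with z' h1 h2 h3
    have hnv := X.not_visible_expMap hd hinc hw.not_visible (fun q _ => hw.wt_le q) h1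
    rw [h3.2] at hnv
    exact (X.radius_le hd hinc hnv (hr.trans hR1) h2).trans_lt hR2

theorem Nearest.deck {z : N} {w : RSpace n} (h : X.Nearest z w) (g : deckGroup X.p) :
    X.Nearest ((g : N ≃ₜ N) z) (X.hol g w) where
  not_visible := by
    rw [X.visible_deck_iff]
    exact h.not_visible
  neutral := by
    rw [X.equivariant g, X.hol_sub, ← X.linear_a hd g le_rfl, h.neutral, map_zero]
  wt_le q := by
    rw [X.equivariant g, X.wt_hol_sub hd, X.radius_deck hd hinc,
      Real.mul_rpow (X.scale_pos hd g).le (X.radius_pos hd hinc z).le]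
    exact mul_le_mul_of_nonneg_left (h.wt_le q) (Real.rpow_nonneg (X.scale_pos hd g).le _)

theorem Nearest.of_tendsto {ι : Type*} {l : Filter ι} [l.NeBot] {z : ι → N} {w : ι → RSpace n}
    {z₀ : N} {w₀ : RSpace n} (h : ∀ i, X.Nearest (z i) (w i)) (hz : Tendsto z l (𝓝 z₀))
    (hw : Tendsto w l (𝓝 w₀)) : X.Nearest z₀ w₀ where
  not_visible := by
    have hcl : IsClosed {x : N × RSpace n | ¬ Visible X.D x.1 x.2} :=
      (isOpen_visible X.D_local).isClosed_compl
    exact hcl.mem_of_tendsto (hz.prodMk_nhds hw) (Eventually.of_forall fun i => (h i).not_visible)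
  neutral := by
    have hc : Continuous (𝒢.a 0) := (𝒢.a 0).continuous_of_finiteDimensional
    have h1 := (hc.tendsto _).comp (hw.sub ((X.D_local.continuous.tendsto _).comp hz))
    refine tendsto_nhds_unique h1 (tendsto_const_nhds.congr fun i => ((h i).neutral).symm)
  wt_le q := by
    have h1 := ((𝒢.continuous_wt q).tendsto _).comp
      (hw.sub ((X.D_local.continuous.tendsto _).comp hz))
    have h2 := ((Real.continuous_rpow_const (hd q)).tendsto _).comp
      (((X.continuous_radius hd hinc).tendsto _).comp hz)
    exact le_of_tendsto_of_tendsto' h1 h2 fun i => (h i).wt_le q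

section Shrink

variable {z : N} {w : RSpace n} {s : ℝ}

theorem Nearest.shrink_mem (h : X.Nearest z w) (hs : 0 < s) (hs1 : s ≤ 1) :
    w + 𝒢.a s (X.D z - w) ∈ 𝒢.box (X.D z) (X.radius z) := by
  intro q hq
  have e : w + 𝒢.a s (X.D z - w) - X.D z = (w - X.D z) - 𝒢.a s (w - X.D z) := by
    rw [← neg_sub w (X.D z), map_neg]
    abel
  have h1 : s ^ 𝒢.d q ≤ 1 := Real.rpow_le_one hs.le hs1 (hd q)
  have h2 : 0 < s ^ 𝒢.d q := Real.rpow_pos_of_pos hs _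
  have h3 : 0 < X.radius z ^ 𝒢.d q := Real.rpow_pos_of_pos (X.radius_pos hd hinc z) _
  rw [e, 𝒢.wt_sub_a hd hs.le, abs_of_nonneg (by linarith)]
  nlinarith [h.wt_le q]

theorem Nearest.apply_shrink (h : X.Nearest z w) (hs : 0 < s) (hs1 : s ≤ 1) :
    X.D (X.shrink z w s) = w + 𝒢.a s (X.D z - w) :=
  apply_expMap (X.boxVisible_radius hd hinc z _ (h.shrink_mem X hd hinc hs hs1))

/-- With `r` the radius, the small box contributes `s ^ d q * r ^ d q` and the shift of its center
at most `(1 - s ^ d q) * r ^ d q`: the sum is exactly the bound of the large box. -/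
theorem Nearest.box_shrink_subset (h : X.Nearest z w) (hs : 0 < s) (hs1 : s ≤ 1) :
    𝒢.box (X.D (X.shrink z w s)) (s * X.radius z) ⊆ 𝒢.box (X.D z) (X.radius z) := by
  intro v hv q hq
  have hvq := hv q hq
  rw [h.apply_shrink X hd hinc hs hs1,
    Real.mul_rpow hs.le (X.radius_pos hd hinc z).le] at hvq
  have e : v - X.D z = (v - (w + 𝒢.a s (X.D z - w))) + ((w - X.D z) - 𝒢.a s (w - X.D z)) := by
    rw [← neg_sub w (X.D z), map_neg]
    abel
  have h1 : s ^ 𝒢.d q ≤ 1 := Real.rpow_le_one hs.le hs1 (hd q)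
  rw [e]
  refine (map_add_le_add _ _ _).trans_lt ?_
  rw [𝒢.wt_sub_a hd hs.le, abs_of_nonneg (by linarith)]
  nlinarith [h.wt_le q]

/-- `w` stays invisible and its offset is scaled by `a s`, so the radius is at most `s * X.radius
z`. The inclusion of boxes gives the opposite bound. -/
theorem Nearest.shrink (h : X.Nearest z w) (hs : 0 < s) (hs1 : s ≤ 1) :
    X.Nearest (X.shrink z w s) w ∧ X.radius (X.shrink z w s) = s * X.radius z := by
  have hr := X.radius_pos hd hinc z
  have hD := h.apply_shrink X hd hinc hs hs1
  have hmem := h.shrink_mem X hd hinc hs hs1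
  have hnv : ¬ Visible X.D (X.shrink z w s) w :=
    X.not_visible_expMap hd hinc h.not_visible (fun q _ => h.wt_le q) hmem
  have hsub := h.box_shrink_subset X hd hinc hs hs1
  rw [hD] at hsub
  have e : w - X.D (X.shrink z w s) = 𝒢.a s (w - X.D z) := by
    rw [hD, ← neg_sub w (X.D z), map_neg]
    abel
  have hwt : ∀ q, 𝒢.wt q (w - X.D (X.shrink z w s)) ≤ (s * X.radius z) ^ 𝒢.d q := fun q => by
    rw [e, 𝒢.wt_a hd hs.le, Real.mul_rpow hs.le hr.le]
    exact mul_le_mul_of_nonneg_left (h.wt_le q) (Real.rpow_nonneg hs.le _)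
  have hrad : X.radius (X.shrink z w s) = s * X.radius z :=
    le_antisymm (X.radius_le hd hinc hnv (mul_pos hs hr) fun q _ => hwt q)
      (X.le_radius hd hinc hmem (mul_pos hs hr) hsub)
  refine ⟨⟨hnv, ?_, by rwa [hrad]⟩, hrad⟩
  rw [e, 𝒢.a_zero_a hs.le, h.neutral]

theorem Nearest.shrink_shrink (h : X.Nearest z w) (hs : 0 < s) (hs1 : s ≤ 1) {t : ℝ} (ht : 0 < t)
    (ht1 : t ≤ 1) : X.shrink (X.shrink z w s) w t = X.shrink z w (t * s) := by
  have hD := h.apply_shrink X hd hinc hs hs1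
  have e : w + 𝒢.a t (X.D (X.shrink z w s) - w) = w + 𝒢.a (t * s) (X.D z - w) := by
    rw [hD, add_sub_cancel_left, 𝒢.a_mul ht.le hs.le]
  rw [RayStructure.shrink, e]
  exact (Visible.of_convex X.D_local (𝒢.convex_box _ _) (X.boxVisible_radius hd hinc z)
    (h.shrink_mem X hd hinc hs hs1) (h.shrink_mem X hd hinc (mul_pos ht hs)
      (mul_le_one₀ ht1 hs.le hs1))).2

theorem Nearest.shrink_deck (h : X.Nearest z w) (hs : 0 < s) (hs1 : s ≤ 1) (g : deckGroup X.p) :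
    X.shrink ((g : N ≃ₜ N) z) (X.hol g w) s = (g : N ≃ₜ N) (X.shrink z w s) := by
  rw [RayStructure.shrink, RayStructure.shrink, ← X.expMap_deck g
    (X.boxVisible_radius hd hinc z _ (h.shrink_mem X hd hinc hs hs1)), X.equivariant g, X.hol_sub,
    ← X.linear_a hd g hs.le, X.hol_add]

end Shrink

end RayStructure

/-! ### Closeness at the scale of the visible boxes. -/

namespace RayStructure

variable {n : ℕ} {𝒢 : RankOneRayGeometry n} {M N : Type*} [MetricSpace M] [TopologicalSpace N]
  (X : RayStructure 𝒢 M N) (hd : ∀ q, 0 ≤ 𝒢.d q)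

/-- The pairs `(z, w)` and `(z', w')` are `ε`-close at the scale of the largest visible boxes. -/
structure Near (ε : ℝ) (z : N) (w : RSpace n) (z' : N) (w' : RSpace n) : Prop where
  exp : expMap X.D z (X.D z') = z'
  base : ∀ q, 𝒢.wt q (X.D z' - X.D z) < ε * X.radius z ^ 𝒢.d q
  tip : ∀ q, 𝒢.wt q (w' - w) < ε * X.radius z ^ 𝒢.d q
  upper : ∀ q, X.radius z' ^ 𝒢.d q ≤ (1 + ε) * X.radius z ^ 𝒢.d q
  lower : ∀ q, X.radius z ^ 𝒢.d q ≤ (1 + ε) * X.radius z' ^ 𝒢.d q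

variable [T2Space N] [SimplyConnectedSpace N] [CompactSpace M]
  (hinc : ∀ z, ∃ v, ¬ Visible X.D z v)
include hd hinc

theorem rpow_radius_pos (z : N) (q : Fin n) : 0 < X.radius z ^ 𝒢.d q :=
  Real.rpow_pos_of_pos (X.radius_pos hd hinc z) _

variable {ε ε' : ℝ} {z z' z'' : N} {w w' w'' : RSpace n}

theorem Near.mono (h : X.Near ε z w z' w') (hε : ε ≤ ε') : X.Near ε' z w z' w' where
  exp := h.exp
  base q := (h.base q).trans_le (by gcongr; exact (X.rpow_radius_pos hd hinc z q).le)
  tip q := (h.tip q).trans_le (by gcongr; exact (X.rpow_radius_pos hd hinc z q).le)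
  upper q := (h.upper q).trans (by gcongr; exact (X.rpow_radius_pos hd hinc z q).le)
  lower q := (h.lower q).trans (by gcongr; exact (X.rpow_radius_pos hd hinc z' q).le)

theorem Near.mem_box (h : X.Near ε z w z' w') (hε : ε ≤ 1) :
    X.D z' ∈ 𝒢.box (X.D z) (X.radius z) := fun q _ => by
  have := h.base q
  nlinarith [X.rpow_radius_pos hd hinc z q]

theorem Near.symm (h : X.Near ε z w z' w') (hε0 : 0 ≤ ε) (hε : ε ≤ 1) :
    X.Near (2 * ε) z' w' z w := by
  have hr := X.rpow_radius_pos hd hinc z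
  have hr' := X.rpow_radius_pos hd hinc z'
  have key : ∀ q, ε * X.radius z ^ 𝒢.d q ≤ 2 * ε * X.radius z' ^ 𝒢.d q := fun q => by
    have h1 := mul_le_mul_of_nonneg_left (h.lower q) hε0
    have h2 : ε * ((1 + ε) * X.radius z' ^ 𝒢.d q) ≤ ε * (2 * X.radius z' ^ 𝒢.d q) := by
      have := (hr' q).le
      gcongr
      linarith
    linarith
  refine ⟨?_, fun q => ?_, fun q => ?_, fun q => ?_, fun q => ?_⟩
  · have := (Visible.of_convex X.D_local (𝒢.convex_box _ _) (X.boxVisible_radius hd hinc z)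
      (h.mem_box X hd hinc hε) (𝒢.mem_box_self _ (X.radius_pos hd hinc z))).2
    rwa [h.exp, expMap_self X.D_local] at this
  · rw [map_sub_rev]
    exact (h.base q).trans_le (key q)
  · rw [map_sub_rev]
    exact (h.tip q).trans_le (key q)
  · nlinarith [h.lower q, hr' q]
  · nlinarith [h.upper q, hr q]

/-- The second error is measured at the scale of `z'`, which is at most twice that of `z`; this
gives `ε + 2 * ε`. For the radii, `(1 + ε) ^ 2 ≤ 1 + 3 * ε` when `ε ≤ 1`. -/
theorem Near.trans (h : X.Near ε z w z' w') (h' : X.Near ε z' w' z'' w'') (hε0 : 0 ≤ ε)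
    (hε : 3 * ε ≤ 1) : X.Near (3 * ε) z w z'' w'' := by
  have hr := X.rpow_radius_pos hd hinc z
  have hr' := X.rpow_radius_pos hd hinc z'
  have key : ∀ q, ε * X.radius z ^ 𝒢.d q + ε * X.radius z' ^ 𝒢.d q ≤
      3 * ε * X.radius z ^ 𝒢.d q := fun q => by
    have h1 := mul_le_mul_of_nonneg_left (h.upper q) hε0
    have h2 : ε * ((1 + ε) * X.radius z ^ 𝒢.d q) ≤ ε * (2 * X.radius z ^ 𝒢.d q) := by
      have := (hr q).le
      gcongr
      linarith
    linarith
  have hb : ∀ q, 𝒢.wt q (X.D z'' - X.D z) < 3 * ε * X.radius z ^ 𝒢.d q := fun q => by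
    rw [← sub_add_sub_cancel (X.D z'') (X.D z') (X.D z)]
    refine (map_add_le_add _ _ _).trans_lt ?_
    linarith [h.base q, h'.base q, key q]
  have h3 : (1 + ε) * (1 + ε) ≤ 1 + 3 * ε := by nlinarith
  refine ⟨?_, hb, fun q => ?_, fun q => ?_, fun q => ?_⟩
  · have := (Visible.of_convex X.D_local (𝒢.convex_box _ _) (X.boxVisible_radius hd hinc z)
      (h.mem_box X hd hinc (by linarith)) (v := X.D z'') fun q _ => (hb q).trans_le (by
        nlinarith [hr q])).2
    rwa [h.exp, h'.exp, eq_comm] at this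
  · rw [← sub_add_sub_cancel w'' w' w]
    refine (map_add_le_add _ _ _).trans_lt ?_
    linarith [h.tip q, h'.tip q, key q]
  · calc _ ≤ (1 + ε) * ((1 + ε) * X.radius z ^ 𝒢.d q) :=
        (h'.upper q).trans (mul_le_mul_of_nonneg_left (h.upper q) (by linarith))
      _ = (1 + ε) * (1 + ε) * X.radius z ^ 𝒢.d q := by ring
      _ ≤ _ := mul_le_mul_of_nonneg_right h3 (hr q).le
  · calc _ ≤ (1 + ε) * ((1 + ε) * X.radius z'' ^ 𝒢.d q) :=
        (h.lower q).trans (mul_le_mul_of_nonneg_left (h'.lower q) (by linarith))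
      _ = (1 + ε) * (1 + ε) * X.radius z'' ^ 𝒢.d q := by ring
      _ ≤ _ := mul_le_mul_of_nonneg_right h3 (X.rpow_radius_pos hd hinc z'' q).le

/-- Both sides of each inequality are multiplied by `scale g ^ d q`: closeness is measured relative
to the radius for this purpose. -/
theorem Near.deck (h : X.Near ε z w z' w') (hε : ε ≤ 1) (g : deckGroup X.p) :
    X.Near ε ((g : N ≃ₜ N) z) (X.hol g w) ((g : N ≃ₜ N) z') (X.hol g w') := by
  have hs := X.scale_pos hd g
  have e : ∀ z q, X.radius ((g : N ≃ₜ N) z) ^ 𝒢.d q =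
      X.scale hd g ^ 𝒢.d q * X.radius z ^ 𝒢.d q := fun z q => by
    rw [X.radius_deck hd hinc, Real.mul_rpow hs.le (X.radius_pos hd hinc z).le]
  have hsq : ∀ q, 0 < X.scale hd g ^ 𝒢.d q := fun q => Real.rpow_pos_of_pos hs _
  refine ⟨?_, fun q => ?_, fun q => ?_, fun q => ?_, fun q => ?_⟩
  · rw [X.equivariant g z', X.expMap_deck g (X.boxVisible_radius hd hinc z _
      (h.mem_box X hd hinc hε)), h.exp]
  · rw [X.equivariant g, X.equivariant g, X.wt_hol_sub hd, e]
    nlinarith [mul_lt_mul_of_pos_left (h.base q) (hsq q)]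
  · rw [X.wt_hol_sub hd, e]
    nlinarith [mul_lt_mul_of_pos_left (h.tip q) (hsq q)]
  · rw [e, e]
    nlinarith [mul_le_mul_of_nonneg_left (h.upper q) (hsq q).le]
  · rw [e, e]
    nlinarith [mul_le_mul_of_nonneg_left (h.lower q) (hsq q).le]

/-- Closeness of the images under `shrink` implies closeness at the larger scale. -/
theorem Near.of_shrink {s : ℝ} (hs : 0 < s) (hs1 : s ≤ 1) (hn : X.Nearest z w)
    (hn' : X.Nearest z' w') (h : X.Near ε (X.shrink z w s) w (X.shrink z' w' s) w')
    (hε0 : 0 ≤ ε) (hε : 3 * ε ≤ 1) : X.Near (3 * ε) z w z' w' := by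
  have hr := X.rpow_radius_pos hd hinc z
  have hr' := X.rpow_radius_pos hd hinc z'
  have hsq : ∀ q, 0 < s ^ 𝒢.d q := fun q => Real.rpow_pos_of_pos hs _
  have hsq1 : ∀ q, s ^ 𝒢.d q ≤ 1 := fun q => Real.rpow_le_one hs.le hs1 (hd q)
  have e : ∀ q, X.radius (X.shrink z w s) ^ 𝒢.d q = s ^ 𝒢.d q * X.radius z ^ 𝒢.d q := fun q => by
    rw [(hn.shrink X hd hinc hs hs1).2, Real.mul_rpow hs.le (X.radius_pos hd hinc z).le]
  have e' : ∀ q, X.radius (X.shrink z' w' s) ^ 𝒢.d q = s ^ 𝒢.d q * X.radius z' ^ 𝒢.d q :=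
    fun q => by
      rw [(hn'.shrink X hd hinc hs hs1).2, Real.mul_rpow hs.le (X.radius_pos hd hinc z').le]
  have htip : ∀ q, 𝒢.wt q (w' - w) < ε * (s ^ 𝒢.d q * X.radius z ^ 𝒢.d q) := fun q => by
    have := h.tip q
    rwa [e] at this
  have hb : ∀ q, 𝒢.wt q (X.D z' - X.D z) < 3 * ε * X.radius z ^ 𝒢.d q := fun q => by
    have h1 := h.base q
    -- The formula for `shrink`, solved for the difference of the base points. The errors of the
    -- shrunken bases and of the tips both carry a factor `s ^ d q`, which cancels.
    have h2 : 𝒢.a s (X.D z' - X.D z) = (X.D (X.shrink z' w' s) - X.D (X.shrink z w s)) -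
        ((w' - w) - 𝒢.a s (w' - w)) := by
      rw [hn.apply_shrink X hd hinc hs hs1, hn'.apply_shrink X hd hinc hs hs1]
      simp only [map_sub]
      abel
    have h3 := congrArg (𝒢.wt q) h2
    rw [𝒢.wt_a hd hs.le] at h3
    have h4 := map_sub_le_add (𝒢.wt q) (X.D (X.shrink z' w' s) - X.D (X.shrink z w s))
      ((w' - w) - 𝒢.a s (w' - w))
    rw [← h3, 𝒢.wt_sub_a hd hs.le, abs_of_nonneg (by linarith [hsq1 q])] at h4
    rw [e] at h1
    have h5 : (1 - s ^ 𝒢.d q) * 𝒢.wt q (w' - w) ≤ 𝒢.wt q (w' - w) := by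
      nlinarith [hsq q, apply_nonneg (𝒢.wt q) (w' - w)]
    have h6 : s ^ 𝒢.d q * 𝒢.wt q (X.D z' - X.D z) <
        s ^ 𝒢.d q * (2 * ε * X.radius z ^ 𝒢.d q) := by linarith [htip q]
    have h7 := lt_of_mul_lt_mul_left h6 (hsq q).le
    nlinarith [hr q]
  have hbox := X.boxVisible_radius hd hinc
  have hz : X.D z' ∈ 𝒢.box (X.D z) (X.radius z) := fun q _ =>
    (hb q).trans_le (by nlinarith [hr q])
  have hy : X.D (X.shrink z' w' s) ∈ 𝒢.box (X.D z) (X.radius z) := by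
    refine hn.box_shrink_subset X hd hinc hs hs1 ?_
    have := h.mem_box X hd hinc (by linarith)
    rwa [(hn.shrink X hd hinc hs hs1).2] at this
  have hy' := hn'.shrink_mem X hd hinc hs hs1
  rw [← hn'.apply_shrink X hd hinc hs hs1] at hy'
  -- The two boxes overlap over the shrunken base of `z'`, and the sections from `z` and `z'` agree
  -- there. They then agree at `X.D z'` too, which puts `z'` on the sheet seen from `z`.
  have heq : expMap X.D z (X.D (X.shrink z' w' s)) = expMap X.D z' (X.D (X.shrink z' w' s)) := by
    have h1 := (Visible.of_convex X.D_local (𝒢.convex_box _ _) (hbox z)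
      (hn.shrink_mem X hd hinc hs hs1) hy).2
    rw [← h1]
    refine h.exp.trans ?_
    rw [hn'.apply_shrink X hd hinc hs hs1]
    rfl
  refine ⟨?_, hb, fun q => ?_, fun q => ?_, fun q => ?_⟩
  · have := expMap_eqOn_inter X.D_local (𝒢.convex_box _ _) (𝒢.convex_box _ _) (hbox z) (hbox z')
      hy hy' heq ⟨hz, 𝒢.mem_box_self _ (X.radius_pos hd hinc z')⟩
    rw [this, expMap_self X.D_local]
  · refine (htip q).trans_le ?_
    have : s ^ 𝒢.d q * X.radius z ^ 𝒢.d q ≤ X.radius z ^ 𝒢.d q :=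
      mul_le_of_le_one_left (hr q).le (hsq1 q)
    nlinarith [mul_le_mul_of_nonneg_left this hε0, hr q]
  · have h1 := h.upper q
    rw [e, e', mul_left_comm] at h1
    have h2 := le_of_mul_le_mul_left h1 (hsq q)
    nlinarith [hr q]
  · have h1 := h.lower q
    rw [e, e', mul_left_comm] at h1
    have h2 := le_of_mul_le_mul_left h1 (hsq q)
    nlinarith [hr' q]

theorem eventually_near (hε : 0 < ε) (z : N) (w : RSpace n) :
    ∃ U ∈ 𝓝 (z, w), ∀ x ∈ U, ∀ y ∈ U, X.Near ε x.1 x.2 y.1 y.2 := by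
  have hDc := X.D_local.continuous
  have hrc := X.continuous_radius hd hinc
  have hr := X.rpow_radius_pos hd hinc
  have hrq : ∀ q, Continuous fun z => X.radius z ^ 𝒢.d q := fun q =>
    (Real.continuous_rpow_const (hd q)).comp hrc
  have key : ∀ᶠ u : (N × RSpace n) × (N × RSpace n) in 𝓝 ((z, w), (z, w)),
      X.Near ε u.1.1 u.1.2 u.2.1 u.2.2 := by
    have h1 : ∀ᶠ u : (N × RSpace n) × (N × RSpace n) in 𝓝 ((z, w), (z, w)),
        expMap X.D u.1.1 (X.D u.2.1) = u.2.1 := by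
      have hc : ContinuousAt (fun u : (N × RSpace n) × (N × RSpace n) => (u.1.1, u.2.1))
        ((z, w), (z, w)) := by fun_prop
      exact (hc.eventually (eventually_expMap_eq₂ X.D_local z)).mono fun u hu => hu.2
    have h2 : ∀ᶠ u : (N × RSpace n) × (N × RSpace n) in 𝓝 ((z, w), (z, w)), ∀ q,
        𝒢.wt q (X.D u.2.1 - X.D u.1.1) < ε * X.radius u.1.1 ^ 𝒢.d q :=
      eventually_all.2 fun q => (((𝒢.continuous_wt q).comp (by fun_prop)).continuousAt.eventually_lt
        (((hrq q).comp (by fun_prop : Continuous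
          fun u : (N × RSpace n) × (N × RSpace n) => u.1.1)).const_mul ε).continuousAt
        (by simpa using mul_pos hε (hr z q)))
    have h3 : ∀ᶠ u : (N × RSpace n) × (N × RSpace n) in 𝓝 ((z, w), (z, w)), ∀ q,
        𝒢.wt q (u.2.2 - u.1.2) < ε * X.radius u.1.1 ^ 𝒢.d q :=
      eventually_all.2 fun q => (((𝒢.continuous_wt q).comp (by fun_prop)).continuousAt.eventually_lt
        (((hrq q).comp (by fun_prop : Continuous
          fun u : (N × RSpace n) × (N × RSpace n) => u.1.1)).const_mul ε).continuousAt
        (by simpa using mul_pos hε (hr z q)))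
    have h4 : ∀ᶠ u : (N × RSpace n) × (N × RSpace n) in 𝓝 ((z, w), (z, w)), ∀ q,
        X.radius u.2.1 ^ 𝒢.d q < (1 + ε) * X.radius u.1.1 ^ 𝒢.d q :=
      eventually_all.2 fun q => (((hrq q).comp (by fun_prop)).continuousAt.eventually_lt
        (((hrq q).comp (by fun_prop : Continuous
          fun u : (N × RSpace n) × (N × RSpace n) => u.1.1)).const_mul (1 + ε)).continuousAt
        (by
          simp only [Function.comp_apply]
          nlinarith [hr z q]))
    have h5 : ∀ᶠ u : (N × RSpace n) × (N × RSpace n) in 𝓝 ((z, w), (z, w)), ∀ q,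
        X.radius u.1.1 ^ 𝒢.d q < (1 + ε) * X.radius u.2.1 ^ 𝒢.d q :=
      eventually_all.2 fun q => (((hrq q).comp (by fun_prop)).continuousAt.eventually_lt
        (((hrq q).comp (by fun_prop : Continuous
          fun u : (N × RSpace n) × (N × RSpace n) => u.2.1)).const_mul (1 + ε)).continuousAt
        (by
          simp only [Function.comp_apply]
          nlinarith [hr z q]))
    filter_upwards [h1, h2, h3, h4, h5] with u h1 h2 h3 h4 h5
    exact ⟨h1, h2, h3, fun q => (h4 q).le, fun q => (h5 q).le⟩
  rw [nhds_prod_eq] at key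
  obtain ⟨U, hU, h⟩ := (Filter.eventually_prod_self_iff (r := fun x y : N × RSpace n =>
    X.Near ε x.1 x.2 y.1 y.2)).1 key
  exact ⟨U, hU, fun x hx y hy => h x hx y hy⟩

theorem exists_rpow_radius_le {Q : Set N} (hQ : IsCompact Q) :
    ∃ B > 0, ∀ z ∈ Q, ∀ q, X.radius z ^ 𝒢.d q ≤ B := by
  have h1 : ∀ q, ∃ B, ∀ z ∈ Q, X.radius z ^ 𝒢.d q ≤ B := fun q => by
    obtain ⟨B, hB⟩ := (hQ.image ((Real.continuous_rpow_const (hd q)).comp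
      (X.continuous_radius hd hinc))).bddAbove
    exact ⟨B, fun z hz => hB (mem_image_of_mem _ hz)⟩
  choose B hB using h1
  refine ⟨∑ q, |B q| + 1, by positivity, fun z hz q => (hB q z hz).trans ?_⟩
  have := Finset.single_le_sum (f := fun q => |B q|) (fun q _ => abs_nonneg _) (Finset.mem_univ q)
  linarith [le_abs_self (B q)]

/-- Different points of a fibre of the covering are not close. -/
theorem exists_near_rigid : ∃ ε > 0, ε ≤ 1 ∧ ∀ (z z' : N) (w w' : RSpace n),
    X.Near ε z w z' w' → X.p z' = X.p z → z' = z := by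
  obtain ⟨Q, hQ, hcov⟩ := X.exists_isCompact_cover
  have hDc := X.D_local.continuous
  have hev : ∀ᶠ v in 𝓝 (0 : RSpace n), ∀ z ∈ Q, ∀ x, expMap X.D z (X.D z + v) = x →
      X.p x = X.p z → x = z := by
    refine hQ.eventually_forall_of_forall_eventually fun z _ => ?_
    obtain ⟨U, hU, hzU, hinj⟩ := X.p_covering.isLocalHomeomorph.isLocallyInjective z
    have hc : ContinuousAt (fun x : RSpace n × N => (x.2, X.D x.2 + x.1)) (0, z) := by fun_prop
    have hv := visible_nhds X.D_local (visible_self (D := X.D) z)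
    have h0 : ((fun x : RSpace n × N => (x.2, X.D x.2 + x.1)) (0, z)) = (z, X.D z) := by simp
    have h1 : ContinuousAt (fun x : RSpace n × N => expMap X.D x.2 (X.D x.2 + x.1)) (0, z) :=
      ContinuousAt.comp_of_eq (g := fun x : N × RSpace n => expMap X.D x.1 x.2) hv.2 hc h0
    have h2 : ∀ᶠ x : RSpace n × N in 𝓝 (0, z), expMap X.D x.2 (X.D x.2 + x.1) ∈ U :=
      h1.eventually (hU.mem_nhds (by simpa [expMap_self X.D_local] using hzU))
    have h3 : ∀ᶠ x : RSpace n × N in 𝓝 (0, z), x.2 ∈ U :=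
      (continuous_snd.continuousAt (x := ((0 : RSpace n), z))).eventually (hU.mem_nhds hzU)
    filter_upwards [h2, h3] with x h2 h3 y hy hp
    rw [hy] at h2
    exact hinj h2 h3 hp
  obtain ⟨δ, hδ, hδU⟩ := 𝒢.exists_wt_lt_of_mem_nhds hev
  obtain ⟨B, hB⟩ := X.exists_rpow_radius_le hd hinc hQ
  -- `B` bounds the scales over `Q`, so relative closeness `δ / B` implies the absolute closeness
  -- `δ` once the base point has been moved into `Q`.
  refine ⟨min 1 (δ / B), lt_min one_pos (div_pos hδ hB.1), min_le_left _ _,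
    fun z z' w w' h hp => ?_⟩
  obtain ⟨g, hg⟩ := hcov z
  have h' := h.deck X hd hinc (min_le_left _ _) g
  refine (g : N ≃ₜ N).injective (hδU (X.D ((g : N ≃ₜ N) z') - X.D ((g : N ≃ₜ N) z))
    (fun q => (h'.base q).trans_le ?_) _ hg _ ?_ ?_)
  · calc _ ≤ δ / B * B := by
          gcongr
          · exact (X.rpow_radius_pos hd hinc _ q).le
          · exact (div_pos hδ hB.1).le
          · exact min_le_right _ _
          · exact hB.2 _ hg q
      _ = δ := div_mul_cancel₀ _ hB.1.ne'
  · rw [add_sub_cancel]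
    exact h'.exp
  · rw [X.deck_p, X.deck_p, hp]

end RayStructure

theorem RankOneRayGeometry.exists_rpow_le {n : ℕ} (𝒢 : RankOneRayGeometry n)
    (hd : ∀ q, 0 ≤ 𝒢.d q) {δ : ℝ} (hδ : 0 < δ) :
    ∃ s, 0 < s ∧ s ≤ 1 ∧ ∀ q, 𝒢.d q ≠ 0 → s ^ 𝒢.d q ≤ δ := by
  have hev : ∀ᶠ R : ℝ in 𝓝[>] 0, ∀ q, 𝒢.d q ≠ 0 → R ^ 𝒢.d q ≤ δ := by
    refine eventually_all.2 fun q => ?_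
    by_cases hq : 𝒢.d q = 0
    · simp [hq]
    · have h1 := (Real.continuous_rpow_const (hd q)).tendsto 0
      rw [Real.zero_rpow hq] at h1
      filter_upwards [(h1.mono_left nhdsWithin_le_nhds).eventually_lt_const hδ] with R hR _
        using hR.le
  obtain ⟨s, h1, h2⟩ := (hev.and (Ioc_mem_nhdsGT (zero_lt_one' ℝ))).exists
  exact ⟨s, h2.1, h2.2, h1⟩

/-! ### Recurrence, and uniqueness of the nearest point. -/

namespace RayStructure

variable {n : ℕ} {𝒢 : RankOneRayGeometry n} {M N : Type*} [MetricSpace M] [TopologicalSpace N]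
  (X : RayStructure 𝒢 M N) (hd : ∀ q, 0 ≤ 𝒢.d q)

theorem hol_mul (g h : deckGroup X.p) (v : RSpace n) :
    X.hol (g * h) v = X.hol g (X.hol h v) := by
  simp only [hol, map_mul]
  rfl

theorem hol_inv_hol (g : deckGroup X.p) (v : RSpace n) : X.hol g⁻¹ (X.hol g v) = v := by
  rw [← hol_mul, inv_mul_cancel]
  simp only [hol, map_one]
  rfl

theorem deck_inv_deck (g : deckGroup X.p) (x : N) :
    ((g⁻¹ : deckGroup X.p) : N ≃ₜ N) ((g : N ≃ₜ N) x) = x :=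
  (g : N ≃ₜ N).symm_apply_apply x

variable [T2Space N] [SimplyConnectedSpace N] [CompactSpace M]
  (hinc : ∀ z, ∃ v, ¬ Visible X.D z v)
include hd hinc

variable {ε ε' : ℝ} {z z' z'' : N} {w w' w'' : RSpace n}

/-- A near coincidence between the scales `t` and `t * s` becomes one between the scales 1 and `s`:
undo the shrinking by `t` at the cost of a factor 3, then apply `g⁻¹`. -/
theorem Near.of_shrink_deck (hn : X.Nearest z w) {s t : ℝ} (hs : 0 < s) (hs1 : s ≤ 1) (ht : 0 < t)
    (ht1 : t ≤ 1) {g g' : deckGroup X.p} (hε0 : 0 ≤ ε) (hε : 3 * ε ≤ 1)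
    (h : X.Near ε ((g : N ≃ₜ N) (X.shrink z w t)) (X.hol g w)
      ((g' : N ≃ₜ N) (X.shrink z w (t * s))) (X.hol g' w)) :
    X.Near (3 * ε) z w (((g⁻¹ * g' : deckGroup X.p) : N ≃ₜ N) (X.shrink z w s))
      (X.hol (g⁻¹ * g') w) := by
  have hns := (hn.shrink X hd hinc hs hs1).1
  rw [← hn.shrink_shrink X hd hinc hs hs1 ht ht1, ← hn.shrink_deck X hd hinc ht ht1,
    ← hns.shrink_deck X hd hinc ht ht1] at h
  have h1 := (h.of_shrink X hd hinc ht ht1 (hn.deck X hd hinc g) (hns.deck X hd hinc g')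
    hε0 hε).deck X hd hinc hε g⁻¹
  rw [X.hol_inv_hol, X.deck_inv_deck] at h1
  rw [X.hol_mul]
  exact h1

theorem isCompact_nearest {Q : Set N} (hQ : IsCompact Q) :
    ∃ T : Set (N × RSpace n), IsCompact T ∧ ∀ z ∈ Q, ∀ w, X.Nearest z w → (z, w) ∈ T := by
  obtain ⟨B, hB0, hB⟩ := X.exists_rpow_radius_le hd hinc hQ
  have hDc := X.D_local.continuous
  refine ⟨(fun x : N × RSpace n => (x.1, X.D x.1 + x.2)) ''
    (Q ×ˢ {v | ∀ q, 𝒢.wt q (v - 0) ≤ B}),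
    (hQ.prod (𝒢.isCompact_setOf_wt_le 0 fun _ => B)).image (by fun_prop), fun z hz w hw => ?_⟩
  refine ⟨(z, w - X.D z), ⟨hz, fun q => ?_⟩, by simp⟩
  rw [sub_zero]
  exact (hw.wt_le q).trans (hB z hz q)

/-- Two nearest pairs return simultaneously close to themselves under `shrink`, up to deck
transformations. -/
theorem exists_recurrence (hn : X.Nearest z w) (hn' : X.Nearest z' w') (hε : 0 < ε) (hε1 : ε ≤ 1)
    {s₀ : ℝ} (hs₀ : 0 < s₀) : ∃ s, 0 < s ∧ s ≤ s₀ ∧ s ≤ 1 ∧ ∃ h h' : deckGroup X.p,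
      X.Near ε z w ((h : N ≃ₜ N) (X.shrink z w s)) (X.hol h w) ∧
      X.Near ε z' w' ((h' : N ≃ₜ N) (X.shrink z' w' s)) (X.hol h' w') := by
  obtain ⟨Q, hQ, hcov⟩ := X.exists_isCompact_cover
  obtain ⟨T, hT, hTn⟩ := X.isCompact_nearest hd hinc hQ
  have h2 : ∀ k : ℕ, 0 < (2⁻¹ : ℝ) ^ k := fun k => by positivity
  have h21 : ∀ k : ℕ, (2⁻¹ : ℝ) ^ k ≤ 1 := fun k => pow_le_one₀ (by norm_num) (by norm_num)
  choose g hg using fun k : ℕ => hcov (X.shrink z w (2⁻¹ ^ k))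
  choose g' hg' using fun k : ℕ => hcov (X.shrink z' w' (2⁻¹ ^ k))
  -- Both shrinking orbits, sampled at powers of `1/2` and moved back over `Q`, stay in a compact
  -- set; one cluster point of the product makes them recur simultaneously.
  let f : ℕ → (N × RSpace n) × (N × RSpace n) := fun k =>
    ((((g k : N ≃ₜ N) (X.shrink z w (2⁻¹ ^ k))), X.hol (g k) w),
      (((g' k : N ≃ₜ N) (X.shrink z' w' (2⁻¹ ^ k))), X.hol (g' k) w'))
  have hf : ∀ k, f k ∈ T ×ˢ T := fun k =>
    ⟨hTn _ (hg k) _ ((hn.shrink X hd hinc (h2 k) (h21 k)).1.deck X hd hinc _),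
      hTn _ (hg' k) _ ((hn'.shrink X hd hinc (h2 k) (h21 k)).1.deck X hd hinc _)⟩
  obtain ⟨⟨⟨a, b⟩, ⟨a', b'⟩⟩, -, hcl⟩ := (hT.prod hT).exists_mapClusterPt (u := f) (f := atTop)
    (le_principal_iff.2 (mem_map.2 (Eventually.of_forall hf)))
  obtain ⟨U, hU, hUn⟩ := X.eventually_near hd hinc (ε := ε / 3) (by positivity) a b
  obtain ⟨U', hU', hUn'⟩ := X.eventually_near hd hinc (ε := ε / 3) (by positivity) a' b'
  have hfr := mapClusterPt_iff_frequently.1 hcl (U ×ˢ U') (prod_mem_nhds hU hU')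
  -- Taking the second index at least `m` after the first ensures that the ratio of the two scales
  -- is at most `s₀`.
  obtain ⟨m, hm⟩ := exists_pow_lt_of_lt_one hs₀ (by norm_num : (2⁻¹ : ℝ) < 1)
  obtain ⟨i, -, hi⟩ := frequently_atTop.1 hfr 0
  obtain ⟨j, hij, hj⟩ := frequently_atTop.1 hfr (i + m)
  obtain ⟨k, rfl⟩ := Nat.exists_eq_add_of_le hij
  refine ⟨2⁻¹ ^ (m + k), h2 _, ?_, h21 _, (g i)⁻¹ * g (i + m + k), (g' i)⁻¹ * g' (i + m + k),
    ?_, ?_⟩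
  · rw [pow_add]
    exact (mul_le_of_le_one_right (h2 m).le (h21 k)).trans hm.le
  · have h1 := hUn _ hi.1 _ hj.1
    simp only [f, add_assoc, pow_add (2⁻¹ : ℝ) i] at h1
    have h2 := Near.of_shrink_deck X hd hinc hn (h2 _) (h21 _) (h2 i) (h21 i) (by positivity)
      (by linarith) h1
    rwa [mul_div_cancel₀ _ (by norm_num : (3 : ℝ) ≠ 0), ← add_assoc] at h2
  · have h1 := hUn' _ hi.2 _ hj.2
    simp only [f, add_assoc, pow_add (2⁻¹ : ℝ) i] at h1
    have h2 := Near.of_shrink_deck X hd hinc hn' (h2 _) (h21 _) (h2 i) (h21 i) (by positivity)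
      (by linarith) h1
    rwa [mul_div_cancel₀ _ (by norm_num : (3 : ℝ) ≠ 0), ← add_assoc] at h2

/-- Close nearest points agree up to the neutral directions. -/
theorem exists_near_tip_eq : ∃ ε > 0, ε ≤ 1 ∧ ∀ (z z' : N) (w w' : RSpace n), X.Nearest z w →
    X.Nearest z' w' → X.Near ε z w z' w' → ∀ q, 𝒢.d q ≠ 0 → 𝒢.wt q (w' - w) = 0 := by
  obtain ⟨ε₁, hε₁, hε₁1, hrig⟩ := X.exists_near_rigid hd hinc
  -- `162 = 2 * 3 ^ 4`: the comparison below uses one `symm`, three `trans` and one `of_shrink`.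
  refine ⟨ε₁ / 162, by positivity, by linarith, fun z z' w w' hn hn' hnear q hq => ?_⟩
  obtain ⟨s₀, hs₀, hs₀1, hs₀q⟩ := 𝒢.exists_rpow_le hd (δ := 1 / 4) (by norm_num)
  have hr := X.rpow_radius_pos hd hinc
  by_contra hne
  have hpos : 0 < 𝒢.wt q (w' - w) := (apply_nonneg _ _).lt_of_ne' hne
  set ε := ε₁ / 162 with hε
  have hε0 : 0 < ε := by positivity
  -- With recurrence this precise, the two tips together move by less than the `q`-gap between them.
  obtain ⟨η, hη0, hη⟩ := exists_between (lt_min hε0 (div_pos hpos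
    (add_pos (hr z q) (hr z' q))))
  have hηε : η ≤ ε := (hη.trans_le (min_le_left _ _)).le
  have hηw : η * (X.radius z ^ 𝒢.d q + X.radius z' ^ 𝒢.d q) < 𝒢.wt q (w' - w) :=
    (lt_div_iff₀ (add_pos (hr z q) (hr z' q))).1 (hη.trans_le (min_le_right _ _))
  obtain ⟨s, hs, hss₀, hs1, h, h', hh, hh'⟩ :=
    X.exists_recurrence hd hinc hn hn' hη0 (by linarith) hs₀
  -- The shrunken points, moved by `h` and `h'`, are close to `z` and `z'`, hence to each other.
  -- Unshrinking shows that `h z` is close to `h' z'`, and so to `h' z`. These lie in one fibre and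
  -- coincide by rigidity.
  have heq : h' = h := by
    have h1 := (hh.mono X hd hinc hηε).symm X hd hinc hε0.le (by linarith)
    have h2 := h1.trans X hd hinc (hnear.mono X hd hinc (by linarith)) (by linarith) (by linarith)
    have h3 := h2.trans X hd hinc (hh'.mono X hd hinc (by linarith)) (by linarith) (by linarith)
    rw [← hn.shrink_deck X hd hinc hs hs1, ← hn'.shrink_deck X hd hinc hs hs1] at h3
    have h4 := h3.of_shrink X hd hinc hs hs1 (hn.deck X hd hinc h) (hn'.deck X hd hinc h')
      (by linarith) (by linarith)
    have h5 := ((hnear.symm X hd hinc hε0.le (by linarith)).deck X hd hinc (by linarith) h').mono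
      X hd hinc (ε' := 3 * (3 * (3 * (2 * ε)))) (by linarith)
    have h6 := (h4.trans X hd hinc h5 (by linarith) (by linarith)).mono X hd hinc
      (ε' := ε₁) (by linarith)
    exact X.deck_eq_of_apply_eq (hrig _ _ _ _ h6 (by rw [X.deck_p, X.deck_p]))
  subst heq
  have hlow := hh.lower q
  rw [X.radius_deck hd hinc, (hn.shrink X hd hinc hs hs1).2,
    Real.mul_rpow (X.scale_pos hd h').le (mul_pos hs (X.radius_pos hd hinc z)).le,
    Real.mul_rpow hs.le (X.radius_pos hd hinc z).le] at hlow
  have hsq : s ^ 𝒢.d q ≤ 1 / 4 := (Real.rpow_le_rpow hs.le hss₀ (hd q)).trans (hs₀q q hq)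
  set σ := X.scale hd h' ^ 𝒢.d q with hσ
  have hσ0 : 0 < σ := Real.rpow_pos_of_pos (X.scale_pos hd h') _
  -- `h'` brings the radius back almost to its value before shrinking, while `s ^ d q ≤ 1 / 4`; the
  -- factor 2 absorbs `1 + η`.
  have hσ2 : 2 ≤ σ := by
    have h1 : σ * (s ^ 𝒢.d q * X.radius z ^ 𝒢.d q) ≤ σ * (1 / 4 * X.radius z ^ 𝒢.d q) := by
      have := (hr z q).le
      gcongr
    have h2 : X.radius z ^ 𝒢.d q ≤ 2 * (σ * (1 / 4 * X.radius z ^ 𝒢.d q)) := by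
      refine hlow.trans ?_
      have h3 : 0 ≤ σ * (1 / 4 * X.radius z ^ 𝒢.d q) :=
        mul_nonneg hσ0.le (mul_nonneg (by norm_num) (hr z q).le)
      exact mul_le_mul (by linarith) h1 (mul_nonneg hσ0.le (mul_nonneg
        (Real.rpow_nonneg hs.le _) (hr z q).le)) (by norm_num)
    by_contra hlt
    nlinarith [hr z q]
  have h1 : 𝒢.wt q (X.hol h' w' - X.hol h' w) = σ * 𝒢.wt q (w' - w) := X.wt_hol_sub hd h' q w' w
  have h2 : X.hol h' w' - X.hol h' w = (X.hol h' w' - w') - (X.hol h' w - w) + (w' - w) := by abel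
  have h3 : 𝒢.wt q (X.hol h' w' - X.hol h' w) ≤ 𝒢.wt q (X.hol h' w' - w') +
      𝒢.wt q (X.hol h' w - w) + 𝒢.wt q (w' - w) := by
    rw [h2]
    exact (map_add_le_add _ _ _).trans (add_le_add_left (map_sub_le_add _ _ _) _)
  -- The gap is stretched by `σ ≥ 2`, yet the small displacements of the tips keep it below twice
  -- its size.
  nlinarith [hh.tip q, hh'.tip q]

/-- `shrink` towards `w` is surjective on the points with nearest point `w`. -/
theorem Nearest.exists_shrink_eq (hn : X.Nearest z w) {s : ℝ} (hs : 0 < s) (hs1 : s ≤ 1) :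
    ∃ x, X.Nearest x w ∧ X.shrink x w s = z := by
  have hr := X.rpow_radius_pos hd hinc
  -- After `symm`, `trans` and `of_shrink`, `1 / 36` becomes `18 / 36 = 1 / 2`, so limits remain
  -- strictly inside the box of `x 0`.
  have hεj : ∀ j : ℕ, 0 < 1 / 36 * (1 / ((j : ℝ) + 1)) := fun j => by positivity
  have hεj1 : ∀ j : ℕ, 1 / 36 * (1 / ((j : ℝ) + 1)) ≤ 1 / 36 := fun j => by
    refine mul_le_of_le_one_right (by norm_num) ?_
    rw [div_le_one (by positivity)]
    linarith [(Nat.cast_nonneg j : (0 : ℝ) ≤ j)]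
  have hεlim : Tendsto (fun j : ℕ => 1 / 36 * (1 / ((j : ℝ) + 1))) atTop (𝓝 0) := by
    simpa only [mul_zero] using
      (tendsto_one_div_add_atTop_nhds_zero_nat (𝕜 := ℝ)).const_mul (1 / 36)
  choose t ht0 hts ht1 h _ hnear _ using fun j : ℕ => X.exists_recurrence hd hinc hn hn (hεj j)
    ((hεj1 j).trans (by norm_num)) hs
  have hq0 : ∀ j, 0 < t j / s := fun j => div_pos (ht0 j) hs
  have hq1 : ∀ j, t j / s ≤ 1 := fun j => (div_le_one hs).2 (hts j)
  -- Recurrence gives `y j → z`, reached by shrinking by `t j ≤ s`. Stopping earlier, at `t j / s`,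
  -- gives `x j` with `shrink (x j) (u j) s = y j`; the limit of the `x j` is the preimage sought.
  set x : ℕ → N := fun j => (h j : N ≃ₜ N) (X.shrink z w (t j / s)) with hx
  set y : ℕ → N := fun j => (h j : N ≃ₜ N) (X.shrink z w (t j)) with hy
  set u : ℕ → RSpace n := fun j => X.hol (h j) w with hu
  have hxn : ∀ j, X.Nearest (x j) (u j) := fun j =>
    (hn.shrink X hd hinc (hq0 j) (hq1 j)).1.deck X hd hinc (h j)
  have hxy : ∀ j, X.shrink (x j) (u j) s = y j := fun j => by
    rw [hx, hu, (hn.shrink X hd hinc (hq0 j) (hq1 j)).1.shrink_deck X hd hinc hs hs1,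
      hn.shrink_shrink X hd hinc (hq0 j) (hq1 j) hs hs1, mul_div_cancel₀ _ hs.ne']
  have hlim0 : ∀ q, Tendsto (fun j : ℕ => 1 / 36 * (1 / ((j : ℝ) + 1)) * X.radius z ^ 𝒢.d q)
      atTop (𝓝 0) := fun q => by simpa using hεlim.mul_const (X.radius z ^ 𝒢.d q)
  have hulim : Tendsto u atTop (𝓝 w) := 𝒢.tendsto_of_wt fun q =>
    squeeze_zero (fun j => apply_nonneg _ _) (fun j => ((hnear j).tip q).le) (hlim0 q)
  have hDy : Tendsto (fun j => X.D (y j)) atTop (𝓝 (X.D z)) := 𝒢.tendsto_of_wt fun q =>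
    squeeze_zero (fun j => apply_nonneg _ _) (fun j => ((hnear j).base q).le) (hlim0 q)
  have hylim : Tendsto y atTop (𝓝 z) := by
    have h1 := (continuousAt_expMap X.D_local (visible_self (D := X.D) z)).tendsto.comp hDy
    rw [expMap_self X.D_local] at h1
    exact h1.congr fun j => (hnear j).exp
  have hDx : ∀ j, X.D (x j) = u j + 𝒢.a s⁻¹ (X.D (y j) - u j) := fun j => by
    rw [← hxy j, (hxn j).apply_shrink X hd hinc hs hs1, add_sub_cancel_left, 𝒢.a_inv_a hs]
    abel
  set c := w + 𝒢.a s⁻¹ (X.D z - w) with hc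
  have hDxlim : Tendsto (fun j => X.D (x j)) atTop (𝓝 c) := by
    simp only [hDx]
    exact hulim.add (((𝒢.a s⁻¹).continuous_of_finiteDimensional.tendsto _).comp (hDy.sub hulim))
  -- The developed points already converge. This keeps all `x j` on the sheet seen from `x 0`, so
  -- the points of `N` converge as well.
  have hx0 : ∀ j, X.Near (1 / 2) (x 0) (u 0) (x j) (u j) := fun j => by
    have h0 := ((hnear 0).mono X hd hinc (hεj1 0)).symm X hd hinc (by norm_num) (by norm_num)
    have h1 := h0.trans X hd hinc ((hnear j).mono X hd hinc ((hεj1 j).trans (by norm_num)))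
      (by norm_num) (by norm_num)
    have h2 : X.Near (3 * (2 * (1 / 36))) (X.shrink (x 0) (u 0) s) (u 0)
        (X.shrink (x j) (u j) s) (u j) := by
      rw [hxy, hxy]
      exact h1
    have h3 := h2.of_shrink X hd hinc hs hs1 (hxn 0) (hxn j) (by norm_num) (by norm_num)
    exact h3.mono X hd hinc (by norm_num)
  have hcbox : c ∈ 𝒢.box (X.D (x 0)) (X.radius (x 0)) := fun q _ => by
    have h1 : Tendsto (fun j => 𝒢.wt q (X.D (x j) - X.D (x 0))) atTop
        (𝓝 (𝒢.wt q (c - X.D (x 0)))) :=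
      ((𝒢.continuous_wt q).tendsto _).comp (hDxlim.sub_const _)
    have h2 := le_of_tendsto' h1 fun j => ((hx0 j).base q).le
    linarith [hr (x 0) q]
  have hcv := X.boxVisible_radius hd hinc (x 0) c hcbox
  have hxlim : Tendsto x atTop (𝓝 (expMap X.D (x 0) c)) :=
    ((continuousAt_expMap X.D_local hcv).tendsto.comp hDxlim).congr fun j => (hx0 j).exp
  set x' := expMap X.D (x 0) c
  have hxn' : X.Nearest x' w := Nearest.of_tendsto X hd hinc hxn hxlim hulim
  refine ⟨x', hxn', ?_⟩
  have hvis := X.boxVisible_radius hd hinc x' _ (hxn'.shrink_mem X hd hinc hs hs1)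
  have h1 : Tendsto (fun j => (x j, u j + 𝒢.a s (X.D (x j) - u j))) atTop
      (𝓝 (x', w + 𝒢.a s (X.D x' - w))) := by
    refine hxlim.prodMk_nhds (hulim.add (((𝒢.a s).continuous_of_finiteDimensional.tendsto _).comp
      (((X.D_local.continuous.tendsto _).comp hxlim).sub hulim)))
  have h2 := (visible_nhds X.D_local hvis).2.tendsto.comp h1
  exact tendsto_nhds_unique (h2.congr fun j => hxy j) hylim

/-- Write `z = shrink x w s` with `s` small. The second candidate `w'` is also nearest for `x`,
because the closed box of `z` lies in that of `x`. At the scale of `x` the two points are close, so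
`exists_near_tip_eq` applies; their neutral components are equal by definition of `Nearest`. -/
theorem Nearest.unique (h : X.Nearest z w) (h' : X.Nearest z w') : w' = w := by
  obtain ⟨ε, hε, hε1, htip⟩ := X.exists_near_tip_eq hd hinc
  obtain ⟨s, hs, hs1, hsq⟩ := 𝒢.exists_rpow_le hd (δ := ε / 4) (by positivity)
  obtain ⟨x, hx, hxz⟩ := h.exists_shrink_eq X hd hinc hs hs1
  have hrx := X.rpow_radius_pos hd hinc x
  have hr : X.radius z = s * X.radius x := by rw [← hxz, (hx.shrink X hd hinc hs hs1).2]
  have hrq : ∀ q, X.radius z ^ 𝒢.d q = s ^ 𝒢.d q * X.radius x ^ 𝒢.d q := fun q => by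
    rw [hr, Real.mul_rpow hs.le (X.radius_pos hd hinc x).le]
  have hDz : X.D z = w + 𝒢.a s (X.D x - w) := by rw [← hxz, hx.apply_shrink X hd hinc hs hs1]
  have e : X.D z - X.D x = (w - X.D x) - 𝒢.a s (w - X.D x) := by
    rw [hDz, ← neg_sub w (X.D x), map_neg]
    abel
  have hsq1 : ∀ q, s ^ 𝒢.d q ≤ 1 := fun q => Real.rpow_le_one hs.le hs1 (hd q)
  have hwt : ∀ q, 𝒢.wt q (w' - X.D x) ≤ X.radius x ^ 𝒢.d q := fun q => by
    have h1 := h'.wt_le q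
    rw [hrq] at h1
    have h2 : 𝒢.wt q (X.D z - X.D x) ≤ (1 - s ^ 𝒢.d q) * X.radius x ^ 𝒢.d q := by
      rw [e, 𝒢.wt_sub_a hd hs.le, abs_of_nonneg (by linarith [hsq1 q])]
      exact mul_le_mul_of_nonneg_left (hx.wt_le q) (by linarith [hsq1 q])
    rw [← sub_add_sub_cancel w' (X.D z) (X.D x)]
    refine (map_add_le_add _ _ _).trans ?_
    linarith
  have hbox := hx.shrink_mem X hd hinc hs hs1
  have hx' : X.Nearest x w' := by
    refine ⟨fun hv => h'.not_visible ?_, ?_, hwt⟩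
    · rw [← hxz]
      refine Visible.of_convex_closure X.D_local (𝒢.convex_box _ _)
        (X.boxVisible_radius hd hinc x) (c' := X.D x) hbox
        (𝒢.mem_box_self _ (X.radius_pos hd hinc x)) (fun t ht => 𝒢.lineMap_mem_box hbox
          (fun q _ => hwt q) ht) ?_
      rwa [expMap_self X.D_local]
    · rw [← sub_add_sub_cancel w' (X.D z) (X.D x), map_add, h'.neutral, e, map_sub,
        𝒢.a_zero_a hs.le, sub_self, add_zero]
  have hneu : 𝒢.a 0 (w' - w) = 0 := by
    rw [← sub_sub_sub_cancel_right w' w (X.D z), map_sub, h'.neutral, h.neutral, sub_zero]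
  have h0 : ∀ q, 𝒢.d q = 0 → 𝒢.wt q (w' - w) = 0 := fun q hq =>
    𝒢.wt_eq_zero_of_a_zero_eq_zero hd hneu hq
  have hnear : X.Near ε x w x w' := by
    refine ⟨expMap_self X.D_local x, fun q => ?_, fun q => ?_, fun q => ?_, fun q => ?_⟩
    · simpa using mul_pos hε (hrx q)
    · by_cases hq : 𝒢.d q = 0
      · rw [h0 q hq]
        exact mul_pos hε (hrx q)
      · rw [← sub_sub_sub_cancel_right w' w (X.D z)]
        refine (map_sub_le_add _ _ _).trans_lt ?_
        have h1 := h.wt_le q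
        have h2 := h'.wt_le q
        rw [hrq] at h1 h2
        have h3 := mul_le_mul_of_nonneg_right (hsq q hq) (hrx q).le
        nlinarith [mul_pos hε (hrx q)]
    · nlinarith [hrx q]
    · nlinarith [hrx q]
  refine sub_eq_zero.1 (𝒢.eq_zero_of_wt fun q => ?_)
  by_cases hq : 𝒢.d q = 0
  · exact h0 q hq
  · exact htip x x w w' hx hx' hnear q hq

/-- The nearest invisible points are the same for all points, up to the neutral directions. -/
theorem exists_nearest_const : ∃ w₀, ∀ z, ∃ w, X.Nearest z w ∧
    ∀ q, 𝒢.d q ≠ 0 → 𝒢.wt q (w - w₀) = 0 := by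
  choose W hW using X.exists_nearest hd hinc
  have hloc := X.D_local.locallyCompactSpace
  obtain ⟨ε, hε, hε1, htip⟩ := X.exists_near_tip_eq hd hinc
  -- Nearest pairs over a compact set stay in a compact set, limits of nearest pairs are nearest,
  -- and uniqueness identifies every limit point.
  have hcont : Continuous W := by
    refine continuous_iff_continuousAt.2 fun z => ?_
    obtain ⟨Q, hQ, hzQ⟩ := exists_compact_mem_nhds z
    obtain ⟨T, hT, hTn⟩ := X.isCompact_nearest hd hinc hQ
    refine (tendsto_iff_ultrafilter _ _ _).2 fun u hu => ?_
    have h1 : ∀ᶠ z' in (u : Filter N), (z', W z') ∈ T := mem_of_superset (hu hzQ)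
      fun z' hz' => hTn z' hz' _ (hW z')
    obtain ⟨⟨a, b⟩, -, hlim⟩ := hT.ultrafilter_le_nhds' (u.map fun z' => (z', W z')) h1
    have h2 : Tendsto (fun z' => (z', W z')) u (𝓝 (a, b)) := hlim
    have h3 : Tendsto W u (𝓝 b) := (continuous_snd.tendsto (a, b)).comp h2
    rwa [(hW z).unique X hd hinc (Nearest.of_tendsto X hd hinc hW hu h3)] at h3
  -- Only the non-neutral part can be constant, since the neutral part of `W z` follows that of `X.D
  -- z`.
  have hlc : IsLocallyConstant fun z => W z - 𝒢.a 0 (W z) := by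
    refine (IsLocallyConstant.iff_eventually_eq _).2 fun z => ?_
    obtain ⟨U, hU, hUn⟩ := X.eventually_near hd hinc hε z (W z)
    have hc : ContinuousAt (fun z' => (z', W z')) z := by fun_prop
    filter_upwards [hc.eventually_mem hU] with z' hz'
    have h1 := 𝒢.a_zero_eq_self_of_wt hd
      (htip z z' _ _ (hW z) (hW z') (hUn _ (mem_of_mem_nhds hU) _ hz'))
    rw [map_sub] at h1
    linear_combination (norm := module) (-1 : ℝ) • h1
  obtain ⟨z₀⟩ : Nonempty N := inferInstance
  refine ⟨W z₀, fun z => ⟨W z, hW z, fun q hq => ?_⟩⟩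
  have h1 := hlc.apply_eq_of_preconnectedSpace z z₀
  refine 𝒢.wt_eq_zero_of_a_zero_eq_self hd ?_ hq
  rw [map_sub]
  linear_combination (norm := module) (-1 : ℝ) • h1

end RayStructure

/-! ### The invisible subspace and the covering property. -/

/-- A point is evenly covered if it has a convex neighborhood that is visible from every point
lying over it. -/
theorem IsLocalHomeomorph.isEvenlyCovered_of_visible {n : ℕ} {N : Type*} [TopologicalSpace N]
    [T2Space N] {D : N → RSpace n} (hD : IsLocalHomeomorph D) {O : Set (RSpace n)} (hO : IsOpen O)
    (hc : Convex ℝ O) (h : ∀ z, D z ∈ O → ∀ u ∈ O, Visible D z u) {v : RSpace n} (hv : v ∈ O) :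
    IsEvenlyCovered D v (D ⁻¹' {v}) := by
  have hfib : ∀ y : D ⁻¹' {v}, D y = v := fun y => y.2
  have hfibO : ∀ y : D ⁻¹' {v}, D y ∈ O := fun y => (hfib y).symm ▸ hv
  refine ⟨?_, O, hv, hO, hO.preimage hD.continuous, ⟨⟨fun z => (⟨D z, z.2⟩, ⟨expMap D z v,
    apply_expMap (h z z.2 v hv)⟩), fun x => ⟨expMap D x.2 x.1, ?_⟩, fun z => ?_, fun x => ?_⟩,
    ?_, ?_⟩, fun _ => rfl⟩
  · have : Subsingleton (D '' (D ⁻¹' {v})) :=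
      (subsingleton_singleton.anti (image_preimage_subset D {v})).coe_sort
    exact (isLocalHomeomorph_iff_isLocalHomeomorphOn_univ.1 hD).mono (subset_univ _)
      |>.discreteTopology_of_image
  · change D _ ∈ O
    rw [apply_expMap (h _ (hfibO x.2) _ x.1.2)]
    exact x.1.2
  · refine Subtype.ext ?_
    change expMap D (expMap D z v) (D z) = z
    rw [(Visible.of_convex hD hc (h z z.2) hv z.2).2, expMap_self hD]
  · obtain ⟨u, y⟩ := x
    refine Prod.ext (Subtype.ext (apply_expMap (h _ (hfibO y) _ u.2))) (Subtype.ext ?_)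
    change expMap D (expMap D y u) v = y
    rw [(Visible.of_convex hD hc (h y (hfibO y)) u.2 hv).2]
    exact (congrArg (expMap D y) (hfib y).symm).trans (expMap_self hD _)
  · refine ((hD.continuous.comp continuous_subtype_val).subtype_mk _).prodMk
      (Continuous.subtype_mk (continuous_iff_continuousAt.2 fun z => ?_) _)
    exact (visible_nhds hD (h z z.2 v hv)).2.comp (f := fun z : D ⁻¹' O => ((z : N), v))
      (by fun_prop)
  · refine Continuous.subtype_mk (continuous_iff_continuousAt.2 fun x => ?_) _
    exact (visible_nhds hD (h x.2 (hfibO x.2) x.1 x.1.2)).2.comp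
      (f := fun x : O × (D ⁻¹' {v}) => ((x.2 : N), (x.1 : RSpace n))) (by fun_prop)

/-- The span of the neutral directions. -/
def RankOneRayGeometry.neutral {n : ℕ} (𝒢 : RankOneRayGeometry n) : Submodule ℝ (RSpace n) :=
  Submodule.span ℝ (𝒢.e '' {q | 𝒢.d q = 0})

theorem RankOneRayGeometry.mem_neutral_iff {n : ℕ} (𝒢 : RankOneRayGeometry n)
    (hd : ∀ q, 0 ≤ 𝒢.d q) {v : RSpace n} :
    v ∈ 𝒢.neutral ↔ ∀ q, 𝒢.d q ≠ 0 → 𝒢.wt q v = 0 := by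
  have key : v ∈ 𝒢.neutral ↔ ∀ q, 𝒢.d q ≠ 0 → 𝒢.e.repr v q = 0 := by
    rw [neutral, Module.Basis.mem_span_image]
    refine forall_congr' fun q => ?_
    rw [Finset.mem_coe, Finsupp.mem_support_iff]
    exact not_imp_comm
  rw [key]
  refine ⟨fun h q hq => 𝒢.wt_eq_zero_of_a_zero_eq_self hd ?_ hq, fun h q hq => ?_⟩
  · apply 𝒢.e.repr.injective
    ext q
    rw [𝒢.repr_a]
    by_cases hq : 𝒢.d q = 0
    · simp [hq]
    · rw [h q hq, mul_zero]
  · have := 𝒢.abs_repr_le_wt q v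
    rw [h q hq] at this
    exact abs_nonpos_iff.1 this

namespace RayStructure

variable {n : ℕ} {𝒢 : RankOneRayGeometry n} {M N : Type*} [MetricSpace M] [TopologicalSpace N]
  (X : RayStructure 𝒢 M N)

theorem exists_not_visible [T2Space N] [SimplyConnectedSpace N] (hX : ¬ X.IsComplete) (z : N) :
    ∃ v, ¬ Visible X.D z v := by
  by_contra! h
  exact hX (isHomeomorph_of_visible X.D_local h)

/-- The common nearest point modulo neutral directions defines `I`. Every point of `I` is invisible
from everywhere, and no geodesic can end off `I`, because there the radius has a local lower bound.
-/
theorem exists_isInvisibleSubspace [SimplyConnectedSpace N] [CompactSpace M]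
    (hd : ∀ q, 0 ≤ 𝒢.d q) (hX : ¬ X.IsComplete) :
    ∃ w, X.IsInvisibleSubspace (AffineSubspace.mk' w 𝒢.neutral) := by
  have := X.t2Space
  have hinc := X.exists_not_visible hX
  obtain ⟨w₀, hw₀⟩ := X.exists_nearest_const hd hinc
  set I := AffineSubspace.mk' w₀ 𝒢.neutral with hI
  have hmem : ∀ v, v ∈ I ↔ ∀ q, 𝒢.d q ≠ 0 → 𝒢.wt q (v - w₀) = 0 := fun v => by
    rw [hI, AffineSubspace.mem_mk', vsub_eq_sub, 𝒢.mem_neutral_iff hd]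
  have hnv : ∀ v ∈ I, ∀ z, ¬ Visible X.D z v := fun v hv z hvis => by
    obtain ⟨w, hw, hww⟩ := hw₀ z
    have hp : 𝒢.a 0 (v - w) = v - w := 𝒢.a_zero_eq_self_of_wt hd fun q hq => by
      rw [← sub_sub_sub_cancel_right v w w₀]
      refine le_antisymm ((map_sub_le_add _ _ _).trans ?_) (apply_nonneg _ _)
      rw [(hmem v).1 hv q hq, hww q hq, add_zero]
    refine hw.not_visible ((X.visible_add_neutral_iff hd hp).1 ?_)
    rwa [add_sub_cancel]
  have hrad : ∀ z q, 𝒢.d q ≠ 0 → 𝒢.wt q (w₀ - X.D z) ≤ X.radius z ^ 𝒢.d q := fun z q hq => by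
    obtain ⟨w, hw, hww⟩ := hw₀ z
    have h1 : w₀ - X.D z = (w - X.D z) - (w - w₀) := by abel
    rw [h1]
    refine (map_sub_le_add _ _ _).trans ?_
    rw [hww q hq, add_zero]
    exact hw.wt_le q
  have hvis : ∀ v ∉ I, ∃ O, IsOpen O ∧ Convex ℝ O ∧ v ∈ O ∧
      ∀ z, X.D z ∈ O → ∀ u ∈ O, Visible X.D z u := fun v hv => by
    simp only [hmem, not_forall] at hv
    obtain ⟨q₀, hq₀, hne⟩ := hv
    have hm : 0 < 𝒢.wt q₀ (v - w₀) := (apply_nonneg _ _).lt_of_ne' hne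
    set m := 𝒢.wt q₀ (v - w₀)
    obtain ⟨s, hs, hs1, hsq⟩ := 𝒢.exists_rpow_le hd (δ := 1 / 2) (by norm_num)
    -- With `R ^ d q₀ = m / 2` and `s ^ d q ≤ 1 / 2`, a point over the box of size `s * R` around
    -- `v` is still more than `R ^ d q₀` away from `I`, so its radius is at least `R`. Two half
    -- boxes then fit into its visible box.
    set R := (m / 2) ^ (𝒢.d q₀)⁻¹ with hR
    have hR0 : 0 < R := Real.rpow_pos_of_pos (by positivity) _
    have hRq : R ^ 𝒢.d q₀ = m / 2 := Real.rpow_inv_rpow (by positivity) hq₀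
    have hρ : ∀ q, 𝒢.d q ≠ 0 → (s * R) ^ 𝒢.d q ≤ 1 / 2 * R ^ 𝒢.d q := fun q hq => by
      rw [Real.mul_rpow hs.le hR0.le]
      exact mul_le_mul_of_nonneg_right (hsq q hq) (Real.rpow_nonneg hR0.le _)
    refine ⟨𝒢.box v (s * R), 𝒢.isOpen_box _ _, 𝒢.convex_box _ _,
      𝒢.mem_box_self _ (mul_pos hs hR0), fun z hz u hu => ?_⟩
    have hRr : R ≤ X.radius z := by
      by_contra! hlt
      have h1 := Real.rpow_lt_rpow (X.radius_pos hd hinc z).le hlt ((hd q₀).lt_of_ne' hq₀)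
      have h2 := hrad z q₀ hq₀
      have h3 : m ≤ 𝒢.wt q₀ (X.D z - v) + 𝒢.wt q₀ (w₀ - X.D z) := by
        have h4 : v - w₀ = -(X.D z - v) - (w₀ - X.D z) := by abel
        have h5 := map_sub_le_add (𝒢.wt q₀) (-(X.D z - v)) (w₀ - X.D z)
        rwa [← h4, map_neg_eq_map] at h5
      have h4 := (hz q₀ hq₀).trans_le (hρ q₀ hq₀)
      rw [hRq] at h1 h4
      linarith
    refine X.boxVisible_radius hd hinc z u fun q hq => ?_
    have h1 := Real.rpow_le_rpow hR0.le hRr (hd q)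
    have h2 := (hz q hq).trans_le (hρ q hq)
    have h3 := (hu q hq).trans_le (hρ q hq)
    rw [← sub_sub_sub_cancel_right u (X.D z) v]
    refine (map_sub_le_add _ _ _).trans_lt ?_
    linarith
  have havoid : ∀ x, X.D x ∉ I := fun x hx => hnv _ hx x (visible_self x)
  have hend : ∀ γ w, IsIncompleteGeodesic X.D γ w → w ∈ I := fun γ w hγ => by
    by_contra hw
    obtain ⟨O, hO, -, hwO, hvO⟩ := hvis w hw
    obtain ⟨t, ht, ht1⟩ := ((hγ.tendsto_develop.eventually_mem (hO.mem_nhds hwO)).and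
      (Ico_mem_nhdsLT (zero_lt_one' ℝ))).exists
    exact hγ.not_visible X.D_local ht1 (hvO _ ht w hwO)
  have hopen : IsOpen (range X.D) := X.D_local.isOpenMap.isOpen_range
  refine ⟨w₀, fun w => ⟨fun hw => ?_, fun ⟨γ, hγ⟩ => hend γ w hγ⟩, havoid, fun x => ?_, ?_⟩
  · obtain ⟨z⟩ : Nonempty N := inferInstance
    obtain ⟨s, hs, γ, -, hγ⟩ := exists_isIncompleteGeodesic X.D_local (hnv w hw z)
    rcases hs.2.lt_or_eq with h1 | rfl
    -- If the geodesic ended before `w`, its end and `w` would be two points of `I` on a line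
    -- through `X.D z`, which would then lie in `I`.
    · refine absurd ?_ (havoid z)
      have h2 := hend _ _ hγ
      rw [hI, AffineSubspace.mem_mk', vsub_eq_sub] at h2 ⊢
      rw [AffineSubspace.mem_mk', vsub_eq_sub] at hw
      have h3 : X.D z - w₀ = (1 - s)⁻¹ • ((AffineMap.lineMap (X.D z) w s - w₀) - s • (w - w₀)) := by
        rw [eq_inv_smul_iff₀ (by linarith), AffineMap.lineMap_apply_module]
        module
      rw [h3]
      exact Submodule.smul_mem _ _ (Submodule.sub_mem _ h2 (Submodule.smul_mem _ _ hw))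
    · rw [AffineMap.lineMap_apply_one] at hγ
      exact ⟨γ, hγ⟩
  · refine Subset.antisymm ((isPreconnected_range X.D_local.continuous).subset_connectedComponentIn
      (mem_range_self x) ?_) ?_
    · rintro _ ⟨y, rfl⟩
      exact havoid y
    -- The image is open, and closed off `I`: a point of its closure outside `I` is visible from any
    -- point over its small box.
    · refine isPreconnected_connectedComponentIn.subset_of_closure_inter_subset hopen
        ⟨X.D x, mem_connectedComponentIn (havoid x), mem_range_self x⟩ ?_
      rintro v ⟨hv, hv'⟩
      obtain ⟨O, hO, -, hvO, h⟩ := hvis v (connectedComponentIn_subset _ _ hv')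
      obtain ⟨_, hz, z, rfl⟩ := mem_closure_iff.1 hv O hO hvO
      exact ⟨_, apply_expMap (h z hz v hvO)⟩
  · rintro ⟨_, x, rfl⟩
    obtain ⟨O, hO, hc, hvO, h⟩ := hvis _ (havoid x)
    have h1 := (X.D_local.isEvenlyCovered_of_visible hO hc h hvO).restrictPreimage (range X.D)
      (mem_range_self x)
    have e : X.D ⁻¹' (range X.D) = univ := eq_univ_of_forall fun y => mem_range_self y
    exact (h1.comp_homeomorph
      ((Homeomorph.setCongr e).trans (Homeomorph.Set.univ N)).symm).to_isEvenlyCovered_preimage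

end RayStructure

/-! ### Reversing the parameter of `A`, and equivariance of incomplete geodesics. -/

theorem diagMap_neg {n : ℕ} (e : Module.Basis (Fin n) ℝ (RSpace n)) (d : Fin n → ℝ) {β : ℝ}
    (hβ : 0 < β) : diagMap e (-d) β = diagMap e d β⁻¹ := by
  apply e.ext
  intro q
  simp [diagMap, Real.rpow_neg hβ.le, Real.inv_rpow hβ.le]

namespace RankOneRayGeometry

variable {n : ℕ} (𝒢 : RankOneRayGeometry n)

/-- The same geometry with the inverse parametrization of `A`. -/
def reverse : RankOneRayGeometry n where
  e := 𝒢.e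
  d := -𝒢.d
  d_ne_zero := 𝒢.d_ne_zero.imp fun q hq => neg_ne_zero.2 hq
  K := 𝒢.K
  K_compact := 𝒢.K_compact
  K_centralizes k hk β hβ x := by
    rw [diagMap_neg _ _ hβ]
    exact 𝒢.K_centralizes k hk _ (inv_pos.2 hβ) x

theorem G_le_reverse : 𝒢.G ≤ 𝒢.reverse.G := by
  rintro T ⟨k, hk, β, hβ, hT⟩
  refine ⟨k, hk, β⁻¹, inv_pos.2 hβ, fun x => ?_⟩
  rw [hT, a, a, reverse, diagMap_neg _ _ (inv_pos.2 hβ), inv_inv]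

theorem neutral_reverse : 𝒢.reverse.neutral = 𝒢.neutral := by
  simp [neutral, reverse]

theorem wt_a_of_pos {s : ℝ} (hs : 0 < s) (q : Fin n) (v : RSpace n) :
    𝒢.wt q (𝒢.a s v) = s ^ 𝒢.d q * 𝒢.wt q v := by
  rw [wt_apply, wt_apply, Real.mul_iSup_of_nonneg (Real.rpow_nonneg hs.le _)]
  refine iSup_congr fun k => ?_
  have h : (k : (RSpace n →L[ℝ] RSpace n)ˣ) • 𝒢.a s v =
      𝒢.a s ((k : (RSpace n →L[ℝ] RSpace n)ˣ) • v) := 𝒢.K_centralizes k k.2 s hs v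
  rw [h, repr_a, abs_mul, abs_of_nonneg (Real.rpow_nonneg hs.le _)]

end RankOneRayGeometry

/-- On a compact set an injective continuous map reflects convergence. -/
theorem IsCompact.tendsto_of_injOn {A B ι : Type*} [TopologicalSpace A] [TopologicalSpace B]
    [T2Space B] {S : Set A} (hS : IsCompact S) {f : A → B} (hf : ContinuousOn f S)
    (hinj : InjOn f S) {u : ι → A} {l : Filter ι} (hu : ∀ᶠ i in l, u i ∈ S) {x : A} (hx : x ∈ S)
    (h : Tendsto (fun i => f (u i)) l (𝓝 (f x))) : Tendsto u l (𝓝 x) := by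
  refine (tendsto_iff_ultrafilter _ _ _).2 fun m hm => ?_
  obtain ⟨a, ha, hma⟩ := hS.ultrafilter_le_nhds' (m.map u) (hm hu)
  have h1 : Tendsto u m (𝓝[S] a) := tendsto_nhdsWithin_iff.2 ⟨hma, hm hu⟩
  have h2 := tendsto_nhds_unique ((hf a ha).tendsto.comp h1) (h.mono_left hm)
  rw [← hinj ha hx h2]
  exact hma

theorem IsCompact.continuousOn_invFunOn {A B : Type*} [TopologicalSpace A] [TopologicalSpace B]
    [T2Space B] [Nonempty A] {S : Set A} (hS : IsCompact S) {f : A → B} (hf : ContinuousOn f S)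
    (hinj : InjOn f S) : ContinuousOn (Function.invFunOn f S) (f '' S) := by
  rintro _ ⟨x, hx, rfl⟩
  have hl := hinj.leftInvOn_invFunOn
  rw [ContinuousWithinAt, hl hx]
  refine hS.tendsto_of_injOn hf hinj (eventually_mem_nhdsWithin.mono fun y hy =>
    Function.invFunOn_mem hy) hx ?_
  exact (tendsto_nhdsWithin_of_tendsto_nhds tendsto_id).congr' (eventually_mem_nhdsWithin.mono
    fun y hy => (Function.invFunOn_eq hy).symm)

/-- An incomplete geodesic does not start in a compact convex set whose image contains its
endpoint. -/
theorem IsIncompleteGeodesic.notMem_of_convex {n : ℕ} {N : Type*} [TopologicalSpace N] [T2Space N]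
    {D : N → RSpace n} (hD : IsLocalHomeomorph D) {γ : ℝ → N} {w : RSpace n}
    (h : IsIncompleteGeodesic D γ w) {S : Set N} (hS : IsCompact S) (hconv : DevConvex D S) {t : ℝ}
    (ht : t ∈ Ico (0 : ℝ) 1) (hw : w ∈ D '' S) : γ t ∉ S := by
  intro hγ
  have : Nonempty N := ⟨γ 0⟩
  refine h.not_section hD ht (hS.continuousOn_invFunOn hD.continuous.continuousOn hconv.1)
    (fun v hv => Function.invFunOn_eq hv) (hconv.1.leftInvOn_invFunOn hγ) (fun r hr => ?_) hw
  rw [h.develops r ⟨ht.1.trans hr.1, hr.2⟩]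
  have h1 := mem_image_of_mem D hγ
  rw [h.develops t ht] at h1
  have h1t : 0 < 1 - t := by linarith [ht.2]
  have e : (AffineMap.lineMap (D (γ 0)) w r : RSpace n) =
      AffineMap.lineMap (AffineMap.lineMap (D (γ 0)) w t) w ((r - t) / (1 - t)) := by
    simp only [AffineMap.lineMap_apply_module]
    match_scalars <;> field_simp <;> ring
  rw [e]
  refine hconv.2.lineMap_mem h1 hw ⟨div_nonneg (by linarith [hr.1]) h1t.le, ?_⟩
  rw [div_le_one h1t]
  linarith [hr.2]

namespace RayStructure

variable {n : ℕ} {𝒢 : RankOneRayGeometry n} {M N : Type*} [MetricSpace M] [TopologicalSpace N]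
  (X : RayStructure 𝒢 M N)

/-- The structure for the inverse parametrization of `A`. -/
def reverse : RayStructure 𝒢.reverse M N where
  p := X.p
  p_covering := X.p_covering
  p_surjective := X.p_surjective
  D := X.D
  D_local := X.D_local
  ρ := (Subgroup.inclusion 𝒢.G_le_reverse).comp X.ρ
  equivariant := X.equivariant

variable {X}

theorem IsInvisibleSubspace.of_reverse {I : AffineSubspace ℝ (RSpace n)}
    (h : X.reverse.IsInvisibleSubspace I) : X.IsInvisibleSubspace I where
  mem_iff := h.mem_iff
  avoids := h.avoids
  range_eq := h.range_eq
  covering := h.covering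

theorem exists_isInvisibleSubspace_neutral [SimplyConnectedSpace N] [CompactSpace M]
    (hd : (∀ q, 0 ≤ 𝒢.d q) ∨ ∀ q, 𝒢.d q ≤ 0) (hX : ¬ X.IsComplete) :
    ∃ w, X.IsInvisibleSubspace (AffineSubspace.mk' w 𝒢.neutral) := by
  rcases hd with hd | hd
  · exact X.exists_isInvisibleSubspace hd hX
  · obtain ⟨w, hw⟩ := X.reverse.exists_isInvisibleSubspace (fun q => neg_nonneg.2 (hd q)) hX
    rw [𝒢.neutral_reverse] at hw
    exact ⟨w, hw.of_reverse⟩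

theorem _root_.IsIncompleteGeodesic.deck {γ : ℝ → N} {w : RSpace n}
    (h : IsIncompleteGeodesic X.D γ w) (g : deckGroup X.p) :
    IsIncompleteGeodesic X.D (fun t => (g : N ≃ₜ N) (γ t)) (X.hol g w) where
  continuousOn := (g : N ≃ₜ N).continuous.comp_continuousOn h.continuousOn
  develops t ht := by
    rw [X.equivariant, X.equivariant, h.develops t ht]
    exact (X.hol g).toAffineMap.apply_lineMap _ _ _
  no_completion := by
    rintro ⟨z, hz⟩
    refine h.no_completion ⟨(g : N ≃ₜ N).symm z, ?_⟩
    simpa [Function.comp_def] using ((g : N ≃ₜ N).symm.continuous.tendsto z).comp hz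

/-- Deck transformations permute the incomplete geodesics, so the holonomy permutes their endpoints,
of which there is only one. -/
theorem IsInvisibleSubspace.isRadiant {w : RSpace n}
    (h : X.IsInvisibleSubspace (AffineSubspace.mk' w ⊥)) : X.IsRadiant := by
  refine ⟨w, fun g => ?_, h⟩
  obtain ⟨γ, hγ⟩ := (h.mem_iff w).1 (AffineSubspace.self_mem_mk' _ _)
  have h1 := (h.mem_iff _).2 ⟨_, hγ.deck g⟩
  rw [AffineSubspace.mem_mk', Submodule.mem_bot, vsub_eq_zero_iff_eq] at h1
  exact h1

/-! ### Contraction and expansion in a Fried dynamics. -/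

namespace FriedDynamics

variable (𝓕 : X.FriedDynamics)

/-- Compactness makes the inverse of `p` from `U` to `Ui i` continuous; composed with `p` it is the
identity near `yi i`, by local injectivity. -/
theorem Ui_mem_nhds (i : ℕ) : 𝓕.Ui i ∈ 𝓝 (𝓕.yi i) := by
  obtain ⟨V, hV, hyV, hinj⟩ := X.p_covering.isLocalHomeomorph.isLocallyInjective (𝓕.yi i)
  have hpc := X.p_covering.continuous
  have hbij := 𝓕.Ui_bijOn i
  have : Nonempty N := ⟨𝓕.yi i⟩
  set σ := Function.invFunOn X.p (𝓕.Ui i)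
  have hσ : Tendsto σ (𝓝 𝓕.y) (𝓝 (𝓕.yi i)) := by
    have h1 := (𝓕.Ui_compact i).continuousOn_invFunOn hpc.continuousOn hbij.injOn
    rw [hbij.image_eq] at h1
    have h2 := h1.continuousAt 𝓕.U_nhds
    have h3 := h2.tendsto
    rwa [← 𝓕.yi_lift i, hbij.injOn.leftInvOn_invFunOn (𝓕.yi_mem i), 𝓕.yi_lift i] at h3
  have h1 : ∀ᶠ x in 𝓝 (𝓕.yi i), σ (X.p x) ∈ V ∧ X.p x ∈ 𝓕.U := by
    have h2 := hpc.tendsto (𝓕.yi i)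
    rw [𝓕.yi_lift i] at h2
    exact h2.eventually ((hσ.eventually_mem (hV.mem_nhds hyV)).and 𝓕.U_nhds)
  filter_upwards [h1, hV.mem_nhds hyV] with x hx hxV
  have h4 : ∃ a ∈ 𝓕.Ui i, X.p a = X.p x := hbij.surjOn hx.2
  rw [← hinj hx.1 hxV (Function.invFunOn_eq h4)]
  exact Function.invFunOn_mem h4

/-- Some direction is contracted, whatever the starting index. -/
theorem exists_βLim_eq_zero (i : ℕ) : ∃ q, 𝓕.βLim i q = 0 := by
  by_contra! hne
  have := X.t2Space
  have hpc := X.p_covering.continuous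
  have hDc := X.D_local.continuous
  have hev : ∀ q, ∃ c > 0, ∀ᶠ j in atTop, c < 𝓕.β j i ^ 𝒢.d q := fun q => by
    obtain ⟨c, hc0, hc⟩ := ENNReal.lt_iff_exists_nnreal_btwn.1 (pos_iff_ne_zero.2 (hne q))
    refine ⟨c, by exact_mod_cast hc0, ?_⟩
    filter_upwards [(𝓕.β_tendsto i q).eventually_const_lt hc] with j hj
    rwa [← ENNReal.ofReal_coe_nnreal, ENNReal.ofReal_lt_ofReal_iff
      (Real.rpow_pos_of_pos (𝓕.β_pos j i) _)] at hj
  choose c hc0 hc using hev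
  have hmemx : ∀ j, ∃ x ∈ 𝓕.Ui i, (𝓕.g j i : N ≃ₜ N) x = 𝓕.γ (𝓕.t j) := fun j => by
    have := 𝓕.γ_mem j
    rwa [← 𝓕.g_image j i] at this
  choose x hxU hxγ using hmemx
  have hxlim : Tendsto x atTop (𝓝 (𝓕.yi i)) := by
    refine (𝓕.Ui_compact i).tendsto_of_injOn hpc.continuousOn (𝓕.Ui_bijOn i).injOn
      (Eventually.of_forall hxU) (𝓕.yi_mem i) ?_
    rw [𝓕.yi_lift i]
    refine tendsto_iff_dist_tendsto_zero.2 (squeeze_zero (fun _ => dist_nonneg) (fun j => ?_)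
      𝓕.ε_tendsto)
    rw [← X.deck_p (𝓕.g j i), hxγ]
    exact 𝓕.close j
  have hγlim : Tendsto (fun j => X.D (𝓕.γ (𝓕.t j))) atTop (𝓝 𝓕.w) :=
    𝓕.incomplete.tendsto_develop.comp (tendsto_nhdsWithin_iff.2
      ⟨𝓕.t_tendsto, Eventually.of_forall fun j => (𝓕.t_mem j).2⟩)
  -- The endpoint pulled back by `ρ (g j i)`. With all diagonal entries bounded below, it approaches
  -- `X.D (x j)` and hence `X.D (yi i)`, so it enters `D '' Ui i`.
  set v : ℕ → RSpace n := fun j => (X.hol (𝓕.g j i)).symm 𝓕.w with hv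
  have hwt : ∀ q j, 𝒢.wt q (𝓕.w - X.D (𝓕.γ (𝓕.t j))) =
      𝓕.β j i ^ 𝒢.d q * 𝒢.wt q (v j - X.D (x j)) := fun q j => by
    have h1 : 𝓕.w - X.D (𝓕.γ (𝓕.t j)) = (X.hol (𝓕.g j i)).linear (v j - X.D (x j)) := by
      rw [← X.hol_sub, ← hxγ, X.equivariant, hv, AffineEquiv.apply_symm_apply]
    rw [h1, 𝓕.linear_eq, ← 𝒢.wt_a_of_pos (𝓕.β_pos j i)]
    exact 𝒢.wt_smul (𝓕.k_mem j i) q _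
  have hvx : Tendsto (fun j => v j - X.D (x j)) atTop (𝓝 0) := by
    refine 𝒢.tendsto_of_wt fun q => ?_
    have h1 : Tendsto (fun j => (c q)⁻¹ * 𝒢.wt q (𝓕.w - X.D (𝓕.γ (𝓕.t j)))) atTop (𝓝 0) := by
      have h2 := ((𝒢.continuous_wt q).tendsto _).comp (hγlim.const_sub 𝓕.w)
      rw [sub_self, map_zero] at h2
      simpa using h2.const_mul (c q)⁻¹
    refine squeeze_zero' (Eventually.of_forall fun j => apply_nonneg _ _) ?_ h1
    filter_upwards [hc q] with j hj
    rw [sub_zero, ← div_eq_inv_mul, le_div_iff₀ (hc0 q), hwt, mul_comm]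
    exact mul_le_mul_of_nonneg_right hj.le (apply_nonneg _ _)
  have hvlim : Tendsto v atTop (𝓝 (X.D (𝓕.yi i))) := by
    simpa using hvx.add ((hDc.tendsto _).comp hxlim)
  have hnhds : X.D '' 𝓕.Ui i ∈ 𝓝 (X.D (𝓕.yi i)) :=
    X.D_local.isOpenMap.image_mem_nhds (𝓕.Ui_mem_nhds i)
  obtain ⟨j, u, hu, huv⟩ := (hvlim.eventually_mem hnhds).exists
  refine 𝓕.incomplete.notMem_of_convex X.D_local (𝓕.Ui_compact j) (𝓕.Ui_convex j) (𝓕.t_mem j) ?_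
    (𝓕.γ_mem j)
  refine ⟨(𝓕.g j i : N ≃ₜ N) u, ?_, ?_⟩
  · rw [← 𝓕.g_image j i]
    exact mem_image_of_mem _ hu
  · rw [X.equivariant, huv, hv]
    exact AffineEquiv.apply_symm_apply _ _

theorem βLim_eq_one {q : Fin n} (hq : 𝒢.d q = 0) (i : ℕ) : 𝓕.βLim i q = 1 := by
  refine tendsto_nhds_unique (𝓕.β_tendsto i q) ?_
  simp [hq]

theorem d_ne_zero_of_βLim {i : ℕ} {q : Fin n} (hq : 𝓕.βLim i q = 0) : 𝒢.d q ≠ 0 := fun h =>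
  zero_ne_one (hq.symm.trans (𝓕.βLim_eq_one h i))

theorem ω_eq_one {q : Fin n} (hq : 𝒢.d q = 0) : 𝓕.ω q = 1 := by
  refine tendsto_nhds_unique (𝓕.βLim_tendsto q) ?_
  simp [𝓕.βLim_eq_one hq]

/-- If `q` is contracted, then so are the directions whose exponent has the same sign, and those
whose exponent has the opposite sign are expanded. -/
theorem βLim_eq {i : ℕ} {q : Fin n} (hq : 𝓕.βLim i q = 0) (q' : Fin n) :
    (0 < 𝒢.d q' / 𝒢.d q → 𝓕.βLim i q' = 0) ∧ (𝒢.d q' / 𝒢.d q < 0 → 𝓕.βLim i q' = ⊤) := by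
  have hd := 𝓕.d_ne_zero_of_βLim hq
  have h0 : Tendsto (fun j => 𝓕.β j i ^ 𝒢.d q) atTop (𝓝 0) := by
    have h1 := (ENNReal.tendsto_toReal ENNReal.zero_ne_top).comp (hq ▸ 𝓕.β_tendsto i q)
    refine h1.congr fun j => ENNReal.toReal_ofReal (Real.rpow_nonneg (𝓕.β_pos j i).le _)
  have h0' : Tendsto (fun j => 𝓕.β j i ^ 𝒢.d q) atTop (𝓝[>] 0) :=
    tendsto_nhdsWithin_iff.2 ⟨h0, Eventually.of_forall fun j =>
      Real.rpow_pos_of_pos (𝓕.β_pos j i) _⟩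
  have e : ∀ j, 𝓕.β j i ^ 𝒢.d q' = (𝓕.β j i ^ 𝒢.d q) ^ (𝒢.d q' / 𝒢.d q) := fun j => by
    rw [← Real.rpow_mul (𝓕.β_pos j i).le, mul_div_cancel₀ _ hd]
  refine ⟨fun hs => tendsto_nhds_unique (𝓕.β_tendsto i q') ?_,
    fun hs => tendsto_nhds_unique (𝓕.β_tendsto i q') ?_⟩
  · have h1 := ((Real.continuous_rpow_const hs.le).tendsto 0).comp h0
    rw [Real.zero_rpow hs.ne'] at h1
    have h2 := ENNReal.tendsto_ofReal h1
    rw [ENNReal.ofReal_zero] at h2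
    exact h2.congr fun j => by simp [e]
  · have h1 := (tendsto_rpow_neg_nhdsGT_zero hs).comp h0'
    exact (ENNReal.tendsto_ofReal_atTop.comp h1).congr fun j => by simp [e]

theorem ω_ne_top (hF : 𝓕.F = ⊥) (q : Fin n) : 𝓕.ω q ≠ ⊤ := by
  intro h
  have h1 : 𝒢.e q ∈ 𝓕.F := Submodule.subset_span (mem_image_of_mem _ h)
  rw [hF, Submodule.mem_bot] at h1
  exact 𝒢.e.ne_zero q h1

theorem ω_eq_of_frequently {q : Fin n} {b : ENNReal} (h : ∃ᶠ i in atTop, 𝓕.βLim i q = b) :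
    𝓕.ω q = b :=
  isClosed_singleton.mem_of_frequently_of_tendsto h (𝓕.βLim_tendsto q)

/-- For each `i` some direction is contracted, so a direction with nonzero exponent is either
contracted or expanded. If it were eventually never contracted, its `ω` would be `⊤`. -/
theorem ω_eq_zero (hF : 𝓕.F = ⊥) {q : Fin n} (hq : 𝒢.d q ≠ 0) : 𝓕.ω q = 0 := by
  refine 𝓕.ω_eq_of_frequently fun hev => 𝓕.ω_ne_top hF q (tendsto_nhds_unique (𝓕.βLim_tendsto q)
    (tendsto_const_nhds.congr' ?_))
  filter_upwards [hev] with i hi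
  obtain ⟨q₀, hq₀⟩ := 𝓕.exists_βLim_eq_zero i
  have hd := 𝓕.d_ne_zero_of_βLim hq₀
  rcases lt_or_gt_of_ne (div_ne_zero hq hd) with h | h
  · exact ((𝓕.βLim_eq hq₀ q).2 h).symm
  · exact absurd ((𝓕.βLim_eq hq₀ q).1 h) hi

theorem P_eq_neutral (hF : 𝓕.F = ⊥) : 𝓕.P = 𝒢.neutral := by
  have : {q | 𝓕.ω q = 1} = {q | 𝒢.d q = 0} := by
    ext q
    refine ⟨fun h => ?_, fun h => 𝓕.ω_eq_one h⟩
    by_contra hq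
    have h1 : 𝓕.ω q = 1 := h
    rw [𝓕.ω_eq_zero hF hq] at h1
    exact zero_ne_one h1
  rw [P, this, RankOneRayGeometry.neutral]

theorem d_nonneg_or_nonpos (hF : 𝓕.F = ⊥) : (∀ q, 0 ≤ 𝒢.d q) ∨ ∀ q, 𝒢.d q ≤ 0 := by
  by_contra! h
  obtain ⟨⟨q, hq⟩, q', hq'⟩ := h
  have h1 : ∀ᶠ i in atTop, 𝓕.βLim i q ≠ ⊤ :=
    (𝓕.βLim_tendsto q).eventually_ne (𝓕.ω_ne_top hF q)
  have h2 : ∀ᶠ i in atTop, 𝓕.βLim i q' ≠ ⊤ :=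
    (𝓕.βLim_tendsto q').eventually_ne (𝓕.ω_ne_top hF q')
  obtain ⟨i, hi, hi'⟩ := (h1.and h2).exists
  obtain ⟨q₀, hq₀⟩ := 𝓕.exists_βLim_eq_zero i
  rcases lt_trichotomy (𝒢.d q₀) 0 with h | h | h
  · exact hi' ((𝓕.βLim_eq hq₀ q').2 (div_neg_of_pos_of_neg hq' h))
  · exact 𝓕.d_ne_zero_of_βLim hq₀ h
  · exact hi ((𝓕.βLim_eq hq₀ q).2 (div_neg_of_neg_of_pos hq h))

end FriedDynamics

end RayStructure

/-! ### Existence of Fried dynamics. -/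

theorem monotone_or_antitone_rpow {b : ℕ → ℝ} (hb : ∀ i, 0 < b i) (h : Monotone b ∨ Antitone b)
    (d : ℝ) : (Monotone fun i => b i ^ d) ∨ Antitone fun i => b i ^ d := by
  rcases le_total 0 d with hd | hd <;> rcases h with h | h
  · exact .inl fun i j hij => Real.rpow_le_rpow (hb i).le (h hij) hd
  · exact .inr fun i j hij => Real.rpow_le_rpow (hb j).le (h hij) hd
  · exact .inr fun i j hij => Real.rpow_le_rpow_of_nonpos (hb i) (h hij) hd
  · exact .inl fun i j hij => Real.rpow_le_rpow_of_nonpos (hb j) (h hij) hd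

/-- The iterated limits of the quotients of a monotone sequence exist in `[0, ∞]`. -/
theorem exists_tendsto_div {c : ℕ → ℝ} (hc : ∀ i, 0 < c i) (h : Monotone c ∨ Antitone c) :
    ∃ (L : ℕ → ENNReal) (ω : ENNReal),
      (∀ i, Tendsto (fun j => ENNReal.ofReal (c j / c i)) atTop (𝓝 (L i))) ∧
      Tendsto L atTop (𝓝 ω) := by
  set C : ℕ → ENNReal := fun i => ENNReal.ofReal (c i) with hC
  have hC0 : ∀ i, C i ≠ 0 := fun i => (ENNReal.ofReal_pos.2 (hc i)).ne'
  have hCt : ∀ i, C i ≠ ⊤ := fun i => ENNReal.ofReal_ne_top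
  obtain ⟨l, hl⟩ : ∃ l, Tendsto C atTop (𝓝 l) := by
    rcases h with h | h
    · exact ⟨_, tendsto_atTop_iSup fun i j hij => ENNReal.ofReal_le_ofReal (h hij)⟩
    · exact ⟨_, tendsto_atTop_iInf fun i j hij => ENNReal.ofReal_le_ofReal (h hij)⟩
  have h1 : ∀ i, Tendsto (fun j => ENNReal.ofReal (c j / c i)) atTop (𝓝 (l / C i)) := fun i => by
    simp only [ENNReal.ofReal_div_of_pos (hc i)]
    exact ENNReal.Tendsto.div_const hl (.inr (hC0 i))
  by_cases h0 : l = 0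
  · exact ⟨_, 0, h1, by simp [h0]⟩
  by_cases ht : l = ⊤
  · refine ⟨_, ⊤, h1, tendsto_const_nhds.congr fun i => ?_⟩
    rw [ht, ENNReal.top_div_of_ne_top (hCt i)]
  · exact ⟨_, l / l, h1, ENNReal.Tendsto.const_div hl (.inl ht)⟩

instance {A : Type*} [Monoid A] [TopologicalSpace A] [FirstCountableTopology A] :
    FirstCountableTopology Aˣ :=
  have : FirstCountableTopology Aᵐᵒᵖ :=
    MulOpposite.opHomeomorph.symm.isInducing.firstCountableTopology
  Units.isEmbedding_embedProduct.isInducing.firstCountableTopology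

theorem IsCompact.exists_subseq_monotone {A : Type*} [TopologicalSpace A]
    [FirstCountableTopology A] {S : Set A} (hS : IsCompact S) {k : ℕ → A} (hk : ∀ i, k i ∈ S)
    (b : ℕ → ℝ) : ∃ φ : ℕ → ℕ, StrictMono φ ∧ (∃ a, Tendsto (fun i => k (φ i)) atTop (𝓝 a)) ∧
      ((Monotone fun i => b (φ i)) ∨ Antitone fun i => b (φ i)) := by
  obtain ⟨a, -, φ, hφ, ha⟩ := hS.tendsto_subseq hk
  obtain ⟨ψ, hψ⟩ := exists_increasing_or_nonincreasing_subseq (· ≤ ·) (b ∘ φ)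
  refine ⟨φ ∘ ψ, hφ.comp ψ.strictMono, ⟨a, ha.comp ψ.strictMono.tendsto_atTop⟩, ?_⟩
  rcases hψ with h | h
  · refine .inl fun i j hij => ?_
    rcases hij.lt_or_eq with hij | rfl
    · exact h i j hij
    · exact le_rfl
  · refine .inr fun i j hij => ?_
    rcases hij.lt_or_eq with hij | rfl
    · exact (not_le.1 (h i j hij)).le
    · exact le_rfl

namespace RayStructure

variable {n : ℕ} {𝒢 : RankOneRayGeometry n} {M N : Type*} [MetricSpace M] [TopologicalSpace N]
  {X : RayStructure 𝒢 M N}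

theorem _root_.DevConvex.deck {S : Set N} (h : DevConvex X.D S) (g : deckGroup X.p) :
    DevConvex X.D ((g : N ≃ₜ N) '' S) := by
  refine ⟨?_, ?_⟩
  · rintro _ ⟨x, hx, rfl⟩ _ ⟨y, hy, rfl⟩ hxy
    rw [X.equivariant, X.equivariant] at hxy
    rw [h.1 hx hy ((X.hol g).injective hxy)]
  · have : X.D '' ((g : N ≃ₜ N) '' S) = (X.hol g).toAffineMap '' (X.D '' S) := by
      rw [image_image, image_image]
      exact image_congr fun x _ => X.equivariant g x
    rw [this]
    exact h.2.affine_image _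

variable (X) in
/-- Every point has a compact convex neighborhood on which the covering is injective. -/
theorem exists_sheet (x : N) : ∃ S V : Set N, IsCompact S ∧ S ∈ 𝓝 x ∧ DevConvex X.D S ∧ S ⊆ V ∧
    IsOpen V ∧ InjOn X.p V := by
  obtain ⟨V, hV, hxV, hinj⟩ := X.p_covering.isLocalHomeomorph.isLocallyInjective x
  obtain ⟨e, hxe, he⟩ := X.D_local x
  have hex : e.symm (e x) = x := e.left_inv hxe
  have hnhds : e.target ∩ e.symm ⁻¹' V ∈ 𝓝 (e x) :=
    (e.symm.isOpen_inter_preimage hV).mem_nhds ⟨e.map_source hxe, by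
      rw [mem_preimage, hex]; exact hxV⟩
  obtain ⟨r, hr, hrs⟩ := Metric.nhds_basis_closedBall.mem_iff.1 hnhds
  have ht : Metric.closedBall (e x) r ⊆ e.target := fun v hv => (hrs hv).1
  refine ⟨e.symm '' Metric.closedBall (e x) r, V,
    (isCompact_closedBall _ _).image_of_continuousOn (e.continuousOn_symm.mono ht), ?_, ⟨?_, ?_⟩,
    ?_, hV, hinj⟩
  · have := e.symm.image_mem_nhds (e.map_source hxe) (Metric.closedBall_mem_nhds (e x) hr)
    rwa [hex] at this
  · rw [he]
    refine e.injOn.mono ?_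
    rintro _ ⟨v, hv, rfl⟩
    exact e.map_target (ht hv)
  · have : X.D '' (e.symm '' Metric.closedBall (e x) r) = Metric.closedBall (e x) r := by
      rw [he, image_image]
      exact (image_congr fun v hv => e.right_inv (ht hv)).trans (image_id _)
    rw [this]
    exact convex_closedBall _ _
  · rintro _ ⟨v, hv, rfl⟩
    exact (hrs hv).2

section

variable [SimplyConnectedSpace N] {γ : ℝ → N} {w : RSpace n}

/-- An incomplete geodesic leaves evenly covered compact convex sets again and again. -/
theorem _root_.IsIncompleteGeodesic.exists_exit (hγ : IsIncompleteGeodesic X.D γ w) {S V : Set N}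
    (hS : IsCompact S) (hconv : DevConvex X.D S) (hSV : S ⊆ V) (hV : IsOpen V) (hinj : InjOn X.p V)
    {t : ℝ} (ht : t ∈ Ico (0 : ℝ) 1) : ∃ s ∈ Ioo t 1, X.p (γ s) ∉ X.p '' S := by
  have := X.t2Space
  by_contra! hcon
  obtain ⟨t₁, ht₁⟩ := exists_between ht.2
  have ht₁' : t₁ ∈ Ico (0 : ℝ) 1 := ⟨ht.1.trans ht₁.1.le, ht₁.2⟩
  obtain ⟨u, hu, hpu⟩ := hcon t₁ ht₁
  obtain ⟨g, hg⟩ := X.exists_deck hpu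
  have hgS : IsCompact ((g : N ≃ₜ N) '' S) := hS.image (g : N ≃ₜ N).continuous
  have hγt : γ t₁ ∈ (g : N ≃ₜ N) '' S := ⟨u, hu, hg⟩
  have hC : IsPreconnected (γ '' Ico t₁ 1) :=
    isPreconnected_Ico.image _ (hγ.continuousOn.mono (Ico_subset_Ico_left ht₁'.1))
  have hkey : ∀ x ∈ γ '' Ico t₁ 1, x ∈ (g : N ≃ₜ N) '' V → x ∈ (g : N ≃ₜ N) '' S := by
    rintro _ ⟨s, hs, rfl⟩ ⟨v, hv, hvs⟩
    obtain ⟨u', hu', hpu'⟩ := hcon s ⟨ht₁.1.trans_le hs.1, hs.2⟩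
    rw [← hvs, X.deck_p] at hpu'
    exact ⟨v, hinj (hSV hu') hv hpu' ▸ hu', hvs⟩
  -- A curve staying over `p '' S` meets the open sheet `g V` only in the compact `g S`, so `g V`
  -- and the complement of `g S` would disconnect it unless it stays in one sheet.
  have hsub : γ '' Ico t₁ 1 ⊆ (g : N ≃ₜ N) '' V := by
    refine (isPreconnected_iff_subset_of_disjoint.1 hC _ ((g : N ≃ₜ N) '' S)ᶜ
      ((g : N ≃ₜ N).isOpenMap V hV) hgS.isClosed.isOpen_compl (fun x _ => ?_) ?_).resolve_right
      fun h => h ⟨t₁, ⟨le_rfl, ht₁.2⟩, rfl⟩ hγt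
    · by_cases hx : x ∈ (g : N ≃ₜ N) '' S
      · exact .inl (image_mono hSV hx)
      · exact .inr hx
    · exact eq_empty_of_forall_notMem fun x hx => hx.2.2 (hkey x hx.1 hx.2.1)
  refine hγ.notMem_of_convex X.D_local hgS (hconv.deck g) ht₁' ?_ hγt
  refine (hgS.image X.D_local.continuous).isClosed.mem_of_tendsto hγ.tendsto_develop ?_
  filter_upwards [Ico_mem_nhdsLT ht₁.2] with s hs
  have h1 : γ s ∈ γ '' Ico t₁ 1 := mem_image_of_mem _ hs
  exact mem_image_of_mem _ (hkey _ h1 (hsub h1))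

/-- After each time choose an exit from `U`, and after that exit a return close to the cluster
point: every gap then contains an exit. -/
theorem exists_times {q : ℝ → M} {y : M} (hy : MapClusterPt y (𝓝[<] 1) q) {U : Set M}
    (hU : U ∈ 𝓝 y) (hexit : ∀ t ∈ Ico (0 : ℝ) 1, ∃ s ∈ Ioo t 1, q s ∉ U) :
    ∃ t : ℕ → ℝ, (∀ i, t i ∈ Ico (0 : ℝ) 1) ∧ StrictMono t ∧ Tendsto t atTop (𝓝 1) ∧
      (∀ i, dist (q (t i)) y ≤ 1 / ((i : ℝ) + 1)) ∧ (∀ i, q (t i) ∈ U) ∧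
      ∀ i, ∃ s ∈ Ioo (t i) (t (i + 1)), q s ∉ U := by
  have hnext : ∀ (a : Ico (0 : ℝ) 1) (k : ℕ), ∃ b : Ico (0 : ℝ) 1,
      1 - 1 / ((k : ℝ) + 1) ≤ b ∧ dist (q b) y ≤ 1 / ((k : ℝ) + 1) ∧ q b ∈ U ∧
      ∃ s ∈ Ioo (a : ℝ) b, q s ∉ U := fun a k => by
    obtain ⟨s, hs, hsU⟩ := hexit a a.2
    have hk : 0 < 1 / ((k : ℝ) + 1) := by positivity
    have h1 := mapClusterPt_iff_frequently.1 hy _ (inter_mem hU (Metric.closedBall_mem_nhds y hk))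
    obtain ⟨b, hb, hb'⟩ := (h1.and_eventually (Ioo_mem_nhdsLT
      (max_lt hs.2 (by linarith : 1 - 1 / ((k : ℝ) + 1) < 1)))).exists
    have hsb := (le_max_left _ _).trans_lt hb'.1
    exact ⟨⟨b, a.2.1.trans (hs.1.trans hsb).le, hb'.2⟩, ((le_max_right _ _).trans_lt hb'.1).le,
      hb.2, hb.1, s, ⟨hs.1, hsb⟩, hsU⟩
  choose f hf1 hf2 hf3 hf4 using hnext
  let T : ℕ → Ico (0 : ℝ) 1 := fun i =>
    Nat.rec (f ⟨0, le_rfl, one_pos⟩ 0) (fun i a => f a (i + 1)) i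
  have hT : ∀ i, ∃ a, T i = f a i := fun i => by
    cases i with
    | zero => exact ⟨_, rfl⟩
    | succ i => exact ⟨T i, rfl⟩
  have hTe : ∀ i : ℕ, ∃ s ∈ Ioo (T i).1 (T (i + 1)).1, q s ∉ U := fun i =>
    hf4 (T i) (i + 1)
  refine ⟨fun i => (T i).1, fun i => (T i).2, strictMono_nat_of_lt_succ fun i => ?_, ?_, fun i => ?_,
    fun i => ?_, hTe⟩
  · obtain ⟨s, hs, -⟩ := hTe i
    exact hs.1.trans hs.2
  · have h1 : Tendsto (fun k : ℕ => 1 - 1 / ((k : ℝ) + 1)) atTop (𝓝 1) := by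
      simpa only [sub_zero] using (tendsto_one_div_add_atTop_nhds_zero_nat (𝕜 := ℝ)).const_sub 1
    refine tendsto_of_tendsto_of_tendsto_of_le_of_le h1 tendsto_const_nhds (fun i => ?_)
      fun i => (T i).2.2.le
    obtain ⟨a, ha⟩ := hT i
    simp only [ha]
    exact hf1 a i
  · obtain ⟨a, ha⟩ := hT i
    simp only [ha]
    exact hf2 a i
  · obtain ⟨a, ha⟩ := hT i
    simp only [ha]
    exact hf3 a i

theorem _root_.RankOneRayGeometry.linear_mul_inv {S T : RSpace n ≃ᵃ[ℝ] RSpace n}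
    {k l : (RSpace n →L[ℝ] RSpace n)ˣ} (hl : l ∈ 𝒢.K) {b c : ℝ} (hb : 0 < b) (hc : 0 < c)
    (hS : ∀ x, S.linear x = (k : RSpace n →L[ℝ] RSpace n) (𝒢.a b x))
    (hT : ∀ x, T.linear x = (l : RSpace n →L[ℝ] RSpace n) (𝒢.a c x)) (x : RSpace n) :
    (S * T⁻¹).linear x =
      ((k * l⁻¹ : (RSpace n →L[ℝ] RSpace n)ˣ) : RSpace n →L[ℝ] RSpace n) (𝒢.a (b / c) x) := by
  obtain ⟨y, rfl⟩ := T.linear.surjective x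
  have h1 : (S * T⁻¹).linear (T.linear y) = S.linear y := by
    change S.linear (T.linear.symm (T.linear y)) = S.linear y
    rw [LinearEquiv.symm_apply_apply]
  have h2 : ((k * l⁻¹ : (RSpace n →L[ℝ] RSpace n)ˣ) : RSpace n →L[ℝ] RSpace n)
      ((l : RSpace n →L[ℝ] RSpace n) (𝒢.a b y)) = (k : RSpace n →L[ℝ] RSpace n) (𝒢.a b y) := by
    change ((k * l⁻¹ * l : (RSpace n →L[ℝ] RSpace n)ˣ) : RSpace n →L[ℝ] RSpace n) (𝒢.a b y) = _
    rw [inv_mul_cancel_right]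
  have h3 : 𝒢.a (b / c) ((l : RSpace n →L[ℝ] RSpace n) (𝒢.a c y)) =
      (l : RSpace n →L[ℝ] RSpace n) (𝒢.a b y) := by
    have h4 := 𝒢.K_centralizes l hl (b / c) (div_pos hb hc) (𝒢.a c y)
    refine h4.symm.trans ?_
    congr 1
    change 𝒢.a (b / c) (𝒢.a c y) = _
    rw [← 𝒢.a_mul (div_pos hb hc).le hc.le, div_mul_cancel₀ _ hc.ne']
  rw [h1, hS, hT, h3, h2]

variable [CompactSpace M]

/-- Every incomplete geodesic has an associated Fried dynamics. -/
theorem exists_friedDynamics (hγ : IsIncompleteGeodesic X.D γ w) :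
    ∃ 𝓕 : X.FriedDynamics, 𝓕.γ = γ ∧ 𝓕.w = w := by
  have := X.t2Space
  have hpc := X.p_covering.continuous
  obtain ⟨y, -, hy⟩ := isCompact_univ.exists_mapClusterPt (u := fun t => X.p (γ t))
    (f := 𝓝[<] (1 : ℝ)) (by simp)
  obtain ⟨y₀, rfl⟩ := X.p_surjective y
  obtain ⟨S, V, hS, hSy, hconv, hSV, hV, hinj⟩ := X.exists_sheet y₀
  have hinjS : InjOn X.p S := hinj.mono hSV
  have hU : X.p '' S ∈ 𝓝 (X.p y₀) :=
    X.p_covering.isLocalHomeomorph.isOpenMap.image_mem_nhds hSy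
  obtain ⟨t, ht, htm, htl, htd, htU, hte⟩ := exists_times hy hU
    fun t ht => hγ.exists_exit hS hconv hSV hV hinj ht
  choose u hu hpu using htU
  choose g hg using fun i => X.exists_deck (hpu i)
  choose k hk b hb hlin using fun i => (X.ρ (g i)).2
  obtain ⟨φ, hφ, ⟨k₀, hk₀⟩, hmon⟩ := 𝒢.K_compact.exists_subseq_monotone hk b
  have hbφ : ∀ q i, 0 < b (φ i) ^ 𝒢.d q := fun q i => Real.rpow_pos_of_pos (hb _) _
  have hdiv : ∀ q i j, (b (φ j) / b (φ i)) ^ 𝒢.d q = b (φ j) ^ 𝒢.d q / b (φ i) ^ 𝒢.d q :=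
    fun q i j => Real.div_rpow (hb _).le (hb _).le _
  have hmonq := fun q => monotone_or_antitone_rpow (fun i => hb (φ i)) hmon (𝒢.d q)
  choose L ω hL hω using fun q => exists_tendsto_div (hbφ q) (hmonq q)
  refine ⟨{
    γ := γ
    w := w
    incomplete := hγ
    y := X.p y₀
    U := X.p '' S
    U_nhds := hU
    U_compact := hS.image hpc
    ε := fun i => 1 / ((i : ℝ) + 1)
    ε_antitone := fun i j hij => by
      have : (i : ℝ) ≤ j := Nat.cast_le.2 hij
      exact one_div_le_one_div_of_le (by positivity) (by linarith)
    ε_tendsto := tendsto_one_div_add_atTop_nhds_zero_nat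
    t := fun i => t (φ i)
    t_mem := fun i => ht _
    t_strictMono := htm.comp hφ
    t_tendsto := htl.comp hφ.tendsto_atTop
    close := fun i => (htd (φ i)).trans (by
      have : (i : ℝ) ≤ φ i := Nat.cast_le.2 hφ.le_apply
      gcongr)
    exits := fun i => by
      obtain ⟨s, hs, hsU⟩ := hte (φ i)
      exact ⟨s, ⟨hs.1, hs.2.trans_le (htm.monotone (hφ (Nat.lt_succ_self i)))⟩, hsU⟩
    Ui := fun i => (g (φ i) : N ≃ₜ N) '' S
    Ui_compact := fun i => hS.image (g (φ i) : N ≃ₜ N).continuous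
    Ui_bijOn := fun i => by
      refine ⟨?_, ?_, ?_⟩
      · rintro _ ⟨x, hx, rfl⟩
        exact ⟨x, hx, (X.deck_p _ _).symm⟩
      · rintro _ ⟨x, hx, rfl⟩ _ ⟨x', hx', rfl⟩ h
        rw [X.deck_p, X.deck_p] at h
        rw [hinjS hx hx' h]
      · rintro _ ⟨x, hx, rfl⟩
        exact ⟨_, mem_image_of_mem _ hx, X.deck_p _ _⟩
    Ui_convex := fun i => hconv.deck _
    yi := fun i => (g (φ i) : N ≃ₜ N) y₀
    yi_mem := fun i => mem_image_of_mem _ (mem_of_mem_nhds hSy)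
    yi_lift := fun i => X.deck_p _ _
    γ_mem := fun i => ⟨_, hu _, hg _⟩
    g := fun j i => g (φ j) * (g (φ i))⁻¹
    g_image := fun j i => by
      rw [image_image]
      refine image_congr fun x _ => ?_
      exact congrArg (g (φ j) : N ≃ₜ N) (X.deck_inv_deck (g (φ i)) x)
    k := fun j i => k (φ j) * (k (φ i))⁻¹
    k_mem := fun j i => 𝒢.K.mul_mem (hk _) (𝒢.K.inv_mem (hk _))
    β := fun j i => b (φ j) / b (φ i)
    β_pos := fun j i => div_pos (hb _) (hb _)
    linear_eq := fun j i x => by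
      rw [map_mul, map_inv]
      exact 𝒢.linear_mul_inv (hk _) (hb _) (hb _) (hlin _) (hlin _) x
    kLim := fun i => k₀ * (k (φ i))⁻¹
    k_tendsto := fun i => hk₀.mul_const _
    kLim_tendsto := by simpa using hk₀.inv.const_mul k₀
    β_monotone := fun i q => by
      simp only [hdiv]
      rcases hmonq q with h | h
      · exact .inl fun j _ j' _ hjj => div_le_div_of_nonneg_right (h hjj) (hbφ q i).le
      · exact .inr fun j _ j' _ hjj => div_le_div_of_nonneg_right (h hjj) (hbφ q i).le
    βLim := fun i q => L q i
    β_tendsto := fun i q => by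
      simp only [hdiv]
      exact hL q i
    ω := ω
    βLim_tendsto := hω }, rfl, rfl⟩

end

end RayStructure

end

/-! ### The main theorem. -/

theorem mainTheorem4 {n : ℕ} (𝒢 : RankOneRayGeometry n) {M N : Type*}
    [MetricSpace M] [CompactSpace M] [TopologicalSpace N] [SimplyConnectedSpace N]
    (X : RayStructure 𝒢 M N) (hX : ¬ X.IsComplete) :
    ((∀ 𝓕 : X.FriedDynamics, 𝓕.F = ⊥) →
      ∃ I : AffineSubspace ℝ (RSpace n), (I : Set (RSpace n)).Nonempty ∧
        X.IsInvisibleSubspace I ∧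
        (∀ (γ : ℝ → N) (w : RSpace n), IsIncompleteGeodesic X.D γ w →
          w ∈ I ∧ ∃ 𝓕 : X.FriedDynamics, 𝓕.γ = γ ∧ 𝓕.w = w) ∧
        ∀ 𝓕 : X.FriedDynamics, I = AffineSubspace.mk' 𝓕.w 𝓕.P) ∧
    ((∀ 𝓕 : X.FriedDynamics, 𝓕.F = ⊥ ∧ 𝓕.P = ⊥) → X.IsRadiant) ∧
    ((∀ q, 0 < 𝒢.d q) → X.IsRadiant) := by
  have ht2 := X.t2Space
  obtain ⟨γ₀, w₀, hγ₀⟩ : ∃ γ w, IsIncompleteGeodesic X.D γ w := by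
    obtain ⟨z⟩ : Nonempty N := inferInstance
    obtain ⟨v, hv⟩ := X.exists_not_visible hX z
    obtain ⟨s, -, γ, -, hγ⟩ := exists_isIncompleteGeodesic X.D_local hv
    exact ⟨γ, _, hγ⟩
  -- At least one Fried dynamics exists, so a hypothesis on all of them does constrain the signs of
  -- the exponents.
  obtain ⟨𝓕₀, -, -⟩ := X.exists_friedDynamics hγ₀
  refine ⟨fun hF => ?_, fun h => ?_, fun hd => ?_⟩
  · obtain ⟨w, hw⟩ := X.exists_isInvisibleSubspace_neutral (𝓕₀.d_nonneg_or_nonpos (hF 𝓕₀)) hX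
    refine ⟨_, ⟨w, AffineSubspace.self_mem_mk' _ _⟩, hw,
      fun γ v hγ => ⟨(hw.mem_iff v).2 ⟨γ, hγ⟩, X.exists_friedDynamics hγ⟩, fun 𝓕 => ?_⟩
    rw [𝓕.P_eq_neutral (hF 𝓕)]
    have h1 := (hw.mem_iff 𝓕.w).2 ⟨𝓕.γ, 𝓕.incomplete⟩
    have h2 := AffineSubspace.mk'_eq h1
    rwa [AffineSubspace.direction_mk', eq_comm] at h2
  · obtain ⟨w, hw⟩ :=
      X.exists_isInvisibleSubspace_neutral (𝓕₀.d_nonneg_or_nonpos (h 𝓕₀).1) hX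
    rw [← 𝓕₀.P_eq_neutral (h 𝓕₀).1, (h 𝓕₀).2] at hw
    exact hw.isRadiant
  -- With positive exponents the geometric half applies directly, and there are no neutral
  -- directions.
  · obtain ⟨w, hw⟩ := X.exists_isInvisibleSubspace (fun q => (hd q).le) hX
    have h1 : 𝒢.neutral = ⊥ := by
      have : {q | 𝒢.d q = 0} = ∅ := eq_empty_of_forall_notMem fun q hq => (hd q).ne' hq
      rw [RankOneRayGeometry.neutral, this, image_empty, Submodule.span_empty]
    rw [h1] at hw
    exact hw.isRadiant
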